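/- Let $G$ be a connected semisimple Lie group with finite center, $K\subset G$ a maximal compact subgroup, $\theta$ the corresponding Cartan involution of the Lie algebra $\mathfrak g$ (so its fixed space is the Lie algebra of $K$), and $\mathfrak p$ the $(-1)$-eigenspace of $\theta$. Let $M\cong G/K$ be a connected Riemannian manifold on which $G$ acts smoothly, transitively and by isometries, $p\in M$ a point with stabilizer $K$ such that $g\mapsto \pi(g)=g\cdot p$ has surjective differential at the identity $e$, and let $\mu$ be the Riemannian volume measure of $M$. (This includes the symmetric spaces of noncompact type and rank one.) Every $x\in M$ is $x=\exp(X)\cdot p$ for a unique $X\in\mathfrak p$. Put $-x=\exp(-X)\cdot p$. The generalized Möbius sum $x\oplus y$ of $x=\exp(X)\cdot p$ and $y=\exp(Y)\cdot p$, with $X,Y\in\mathfrak p$, is the point reached at time $1$ by the geodesic of $M$ that starts from $x$ with velocity $(d\exp X)_p\,(d\pi)_e Y\in T_xM$, where $\exp X$ acts on $M$ as an element of $G$; below, $-x\oplus y$ means $(-x)\oplus y$. Let $dk$ be the Haar measure of $K$ with total mass $\operatorname{vol}(K)=\int_K dk=1$. Then there is exactly one Haar measure $dg$ on $G$ such that $$\int_G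 f(g)\,dg=\int_{G/K}\Big(\int_K f(gk)\,dk\Big)\,d\mu(gK)\qquad\text{for all } f\in C_c(G).$$ For this $dg$, let $\varphi,\psi$ be continuous, compactly supported, bi-$K$-invariant (real- or complex-valued) functions on $G$, regarded also as functions on $M$ through $\varphi(g\cdot p)=\varphi(g)$. Then for every $y=g_y\cdot p\in M$ the integrands of the two convolutions $$(\varphi *^M\psi)(y)=\int_M\varphi(-x\oplus y)\,\psi(x)\,\mu(dx),\qquad (\varphi *^G\psi)(g_y)=\int_G\varphi(g^{-1}g_y)\,\psi(g)\,dg$$ are integrable, and $$(\varphi *^M\psi)(y)=\operatorname{vol}(K)\,(\varphi *^G\psi)(g_y).$$ -/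

import Mathlib

open scoped Manifold ContDiff
open MeasureTheory Bundle

noncomputable section

namespace SymmetricSpace

section Curves

variable {E : Type*} [NormedAddCommGroup E] [NormedSpace ℝ E]
  {M : Type*} [TopologicalSpace M] [ChartedSpace E M]

/-- The velocity `(γ t, γ' t)` of a curve, as a point of the tangent bundle. -/
def velocity (γ : ℝ → M) (t : ℝ) : TangentBundle 𝓘(ℝ, E) M :=
  ⟨γ t, mfderiv 𝓘(ℝ, ℝ) 𝓘(ℝ, E) γ t (1 : ℝ)⟩

end Curves

section LieGroups

variable {m : ℕ}
  {G : Type*} [TopologicalSpace G] [ChartedSpace (EuclideanSpace ℝ (Fin m)) G] [Group G]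

/-- A smooth Lie group has the regularity under which Mathlib defines its Lie algebra. -/
instance lieGroupMinSmoothness [LieGroup (𝓡 m) ∞ G] : LieGroup (𝓡 m) (minSmoothness ℝ 3) G :=
  LieGroup.of_le (n := ∞) (by
    rw [minSmoothness_of_isRCLikeNormedField]
    exact ENat.LEInfty.out)

/-- `γ` is the smooth one-parameter subgroup of `G` with initial velocity `X`. -/
structure IsOneParameterSubgroup (X : GroupLieAlgebra (𝓡 m) G) (γ : ℝ → G) : Prop where
  contMDiff : ContMDiff 𝓘(ℝ, ℝ) (𝓡 m) ∞ γ
  map_add : ∀ s t : ℝ, γ (s + t) = γ s * γ t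
  velocity_zero : velocity γ 0 = (⟨1, X⟩ : TangentBundle (𝓡 m) G)

open Classical in
/-- The Lie group exponential `exp X = γ 1`, with `γ` the one-parameter subgroup generated by `X`
(there is exactly one; the other branch of the definition is never met in a Lie group). -/
def lieExp (X : GroupLieAlgebra (𝓡 m) G) : G :=
  if h : ∃ γ : ℝ → G, IsOneParameterSubgroup X γ then h.choose 1 else 1

/-- A Cartan involution: an involutive automorphism `θ` such that `-B(X, θ Y)` is positive
definite, `B` the Killing form. -/
structure IsCartanInvolution {𝔤 : Type*} [LieRing 𝔤] [LieAlgebra ℝ 𝔤] (θ : 𝔤 →ₗ⁅ℝ⁆ 𝔤) :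
    Prop where
  involutive : ∀ X, θ (θ X) = X
  pos : ∀ X, X ≠ 0 → 0 < -(killingForm ℝ 𝔤 X (θ X))

/-- `K` is a maximal compact subgroup. -/
def IsMaximalCompact (K : Subgroup G) : Prop :=
  Maximal (fun L : Subgroup G ↦ IsCompact (L : Set G)) K

/-- Bi-`K`-invariance of a function on `G`. -/
def IsBiInvariant {𝕜 : Type*} (K : Subgroup G) (φ : G → 𝕜) : Prop :=
  ∀ k ∈ K, ∀ k' ∈ K, ∀ g, φ (k * g * k') = φ g

/-- The convolution on `G`: `h ↦ ∫ φ(g⁻¹ h) ψ(g) dg`. -/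
def groupConv {𝕜 : Type*} [RCLike 𝕜] [MeasurableSpace G] (dg : Measure G) (φ ψ : G → 𝕜) (h : G) :
    𝕜 :=
  ∫ g, φ (g⁻¹ * h) * ψ g ∂dg

end LieGroups

theorem exists_chart_cover (n : ℕ) (M : Type*) [TopologicalSpace M]
    [ChartedSpace (EuclideanSpace ℝ (Fin n)) M] [SecondCountableTopology M] [Nonempty M] :
    ∃ c : ℕ → M, ⋃ i, (extChartAt (𝓡 n) (c i)).source = Set.univ := by
  obtain ⟨s, hs, hu⟩ := TopologicalSpace.countable_cover_nhds
    (fun x : M ↦ extChartAt_source_mem_nhds (I := 𝓡 n) x)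
  have hne : s.Nonempty := by
    by_contra h
    rw [Set.not_nonempty_iff_eq_empty] at h
    subst h
    simp at hu
    exact (Set.univ_nonempty (α := M)).ne_empty hu.symm
  obtain ⟨c, rfl⟩ := hs.exists_eq_range hne
  exact ⟨c, by simpa using hu⟩

section Geodesics

variable {E : Type*} [NormedAddCommGroup E] [NormedSpace ℝ E]
  {M : Type*} [TopologicalSpace M] [ChartedSpace E M]
  [RiemannianBundle (fun x : M ↦ TangentSpace 𝓘(ℝ, E) x)]

/-- The Riemannian metric read in the chart around `c`: the inner product, at the point of `M` with
coordinates `z`, of the tangent vectors with coordinates `u` and `v`. -/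
def chartMetric (c : M) (z u v : E) : ℝ :=
  inner ℝ (mfderiv 𝓘(ℝ, E) 𝓘(ℝ, E) (extChartAt 𝓘(ℝ, E) c).symm z u)
    (mfderiv 𝓘(ℝ, E) 𝓘(ℝ, E) (extChartAt 𝓘(ℝ, E) c).symm z v)

variable (E) in
/-- A (complete, affinely parametrized) geodesic: a smooth curve which in every chart satisfies the
geodesic equation, here in the form of the Euler-Lagrange equations
`d/dt g_u(u', w) = (1/2) ∂_w [g(u', u')]` of the energy. -/
structure IsGeodesic (γ : ℝ → M) : Prop where
  contMDiff : ContMDiff 𝓘(ℝ, ℝ) 𝓘(ℝ, E) ∞ γ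
  eq : ∀ (c : M) (t : ℝ), γ t ∈ (extChartAt 𝓘(ℝ, E) c).source → ∀ w : E,
    HasDerivAt
      (fun s ↦ chartMetric c (extChartAt 𝓘(ℝ, E) c (γ s))
        (deriv (fun r ↦ extChartAt 𝓘(ℝ, E) c (γ r)) s) w)
      ((1 / 2) * fderiv ℝ
        (fun z ↦ chartMetric c z (deriv (fun r ↦ extChartAt 𝓘(ℝ, E) c (γ r)) t)
          (deriv (fun r ↦ extChartAt 𝓘(ℝ, E) c (γ r)) t))
        (extChartAt 𝓘(ℝ, E) c (γ t)) w) t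

open Classical in
/-- The point reached at time `1` by the geodesic that starts from `x` with velocity `v`. -/
def geodesicEndpoint (x : M) (v : TangentSpace 𝓘(ℝ, E) x) : M :=
  if h : ∃ γ : ℝ → M, IsGeodesic E γ ∧ velocity γ 0 = (⟨x, v⟩ : TangentBundle 𝓘(ℝ, E) M)
    then h.choose 1 else x

end Geodesics

section Volume

variable {n : ℕ} {M : Type*} [TopologicalSpace M] [ChartedSpace (EuclideanSpace ℝ (Fin n)) M]
  [RiemannianBundle (fun x : M ↦ TangentSpace (𝓡 n) x)]

variable (n) in
/-- The Riemannian volume on the domain of the chart around `c`: it has the density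
`√(det (g_ij))` with respect to Lebesgue measure in the coordinates. -/
def chartVolume [MeasurableSpace M] (c : M) : Measure M :=
  (((volume : Measure (EuclideanSpace ℝ (Fin n))).restrict (extChartAt (𝓡 n) c).target).withDensity
    (fun z ↦ ENNReal.ofReal (Real.sqrt (Matrix.det (Matrix.of fun i j : Fin n ↦
      chartMetric c z (EuclideanSpace.single i 1) (EuclideanSpace.single j 1)))))).map
    (extChartAt (𝓡 n) c).symm

variable (n M) in
/-- The Riemannian volume measure: the chart volumes glued along a countable atlas, whose domains
are first made disjoint (the result does not depend on the atlas). -/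
def riemannianVolume [MeasurableSpace M] [SecondCountableTopology M] [Nonempty M] : Measure M :=
  Measure.sum fun i : ℕ ↦ (chartVolume n ((exists_chart_cover n M).choose i)).restrict
    (disjointed (fun j ↦ (extChartAt (𝓡 n) ((exists_chart_cover n M).choose j)).source) i)

end Volume

section Quotient

variable {m : ℕ}
  {G : Type*} [TopologicalSpace G] [ChartedSpace (EuclideanSpace ℝ (Fin m)) G] [Group G]
  {M : Type*} [MulAction G M]

/-- The function on `M = G/K` induced by a right-`K`-invariant function on `G`, `K` the stabilizer
of `o`: its value at `g • o` is `φ g`. -/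
def descend {𝕜 : Type*} [Zero 𝕜] (o : M) (φ : G → 𝕜) : M → 𝕜 :=
  Function.extend (fun g : G ↦ g • o) φ 0

/-- The quotient integral formula `∫_G f dg = ∫_{G/K} (∫_K f(gk) dk) dμ(gK)` for all `f` in
`C_c(G)`: it says how the three measures are normalized relative to each other. -/
def QuotientIntegralFormula [MeasurableSpace G] [MeasurableSpace M] (K : Subgroup G) (o : M)
    (dg : Measure G) (dk : Measure K) (μ : Measure M) : Prop :=
  ∀ f : G → ℝ, Continuous f → HasCompactSupport f →
    ∫ g, f g ∂dg = ∫ x, descend o (fun g ↦ ∫ k : K, f (g * k) ∂dk) x ∂μ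

variable [LieGroup (𝓡 m) ∞ G]
  (θ : GroupLieAlgebra (𝓡 m) G →ₗ⁅ℝ⁆ GroupLieAlgebra (𝓡 m) G) (o : M)

open Classical in
/-- The vector `X ∈ 𝔭` with `x = exp X • o`, where `𝔭` is the `-1` eigenspace of `θ`. -/
def polarVector (x : M) : GroupLieAlgebra (𝓡 m) G :=
  if h : ∃ X : GroupLieAlgebra (𝓡 m) G, θ X = -X ∧ lieExp X • o = x then h.choose else 0

/-- The opposite of a point: `-(exp X • o) = exp (-X) • o` for `X ∈ 𝔭`. -/
def mobiusNeg (x : M) : M := lieExp (-polarVector θ o x) • o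

variable {n : ℕ} [TopologicalSpace M] [ChartedSpace (EuclideanSpace ℝ (Fin n)) M]
  [RiemannianBundle (fun x : M ↦ TangentSpace (𝓡 n) x)]

/-- The generalized Möbius addition `x ⊕ y`. Write `x = exp X • o` and `y = exp Y • o` with `X` and
`Y` in `𝔭`; move the initial velocity of `t ↦ exp (tY) • o` from `o` to `x` by the differential of
`exp X` (this is parallel transport along `t ↦ exp (tX) • o`), and follow the geodesic from `x` with
the resulting velocity up to time `1`. -/
def mobiusAdd (x y : M) : M :=
  geodesicEndpoint (lieExp (polarVector θ o x) • o)
    (mfderiv (𝓡 n) (𝓡 n) (fun z : M ↦ lieExp (polarVector θ o x) • z) o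
      (mfderiv (𝓡 m) (𝓡 n) (fun g : G ↦ g • o) 1 (polarVector θ o y)))

/-- The integrand of the convolution on `M`, as a function of `x`: `φ((-x) ⊕ y) ψ(x)`. -/
def mobiusConvIntegrand {𝕜 : Type*} [RCLike 𝕜] (φ ψ : G → 𝕜) (y x : M) : 𝕜 :=
  descend o φ (mobiusAdd (n := n) θ o (mobiusNeg θ o x) y) * descend o ψ x

/-- The convolution on `M`: `y ↦ ∫ φ((-x) ⊕ y) ψ(x) μ(dx)`, `μ` the Riemannian volume. -/
def mobiusConv [MeasurableSpace M] [SecondCountableTopology M] [Nonempty M]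
    {𝕜 : Type*} [RCLike 𝕜] (φ ψ : G → 𝕜) (y : M) : 𝕜 :=
  ∫ x, mobiusConvIntegrand (n := n) θ o φ ψ y x ∂(riemannianVolume n M)

end Quotient

end SymmetricSpace

end

/-! For `X`, `Y` in 𝔭 the curve `t ↦ exp(X) exp(tY)·p` is the geodesic that defines the Möbius sum,
so `(exp X·p) ⊕ (exp Y·p) = exp(X) exp(Y)·p` (`mobiusAdd_gexp_smul`). Hence `(-x) ⊕ y = exp(-X)·y`
when `x = exp(X)·p`, and the integrand on `M` is the function induced by the right-`K`-invariant
function `a ↦ φ(a⁻¹ g_y) ψ(a)` on `G` (`mobiusConvIntegrand_eq_descend`). The quotient integral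
formula then identifies the two convolutions, the fibres having mass one.

That orbit curves are geodesics (`isGeodesic_orbitCurve`) is Noether's theorem read backwards. A
flow of isometries together with a constant momentum along its Killing field yields the
Euler-Lagrange equation in the direction of that field (`hasDerivAt_momentum`). The Killing fields
of the action span every tangent space, and the momenta of the orbit curve are constant because
`dπ(Y)` is orthogonal to `dπ([Y, Z])` for all `Z` (`metric_orbitDeriv_bracket`). No connection is
needed. Uniqueness of geodesics (`IsGeodesic.unique`) is uniqueness for the resulting first-order
system in charts.

Polar coordinates on `M` (`exists_polar`, `polar_unique`) come from the Cartan decomposition. With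
transposes taken for `-B(·, θ·)`, the operator `Ad(g)ᵀ Ad(g)` is a positive automorphism of the Lie
algebra. Its logarithm is a derivation, hence `ad Y`, and `Y` lies in 𝔭
(`IsCartanInvolution.exists_log`). With `X = Y/2`, the element `g exp(-X)` commutes with `θ`. It
lies in `K` on a set of `g` that is open, closed and nonempty: `X` depends continuously on `g`, and
elements near the identity that commute with `θ` belong to `K` (`eventually_mem_of_commutes`).
Connectedness of `G` concludes.

On the measure side, the change of variables formula makes the Riemannian volume invariant under
isometries (`riemannianVolume_isometry`). The right side of the quotient formula is therefore a
left-invariant positive functional on `C_c(G)`, and Riesz representation provides the Haar measure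
(`existsUnique_isHaarMeasure_quotient`). -/

namespace SymmetricSpace

open Set Filter Topology

/-! ### Differentials and velocities in charts -/

section Calculus

variable {E : Type*} [NormedAddCommGroup E] [NormedSpace ℝ E]
  {M : Type*} [TopologicalSpace M] [ChartedSpace E M]
  {E' : Type*} [NormedAddCommGroup E'] [NormedSpace ℝ E']
  {M' : Type*} [TopologicalSpace M'] [ChartedSpace E' M']
  {E'' : Type*} [NormedAddCommGroup E''] [NormedSpace ℝ E'']
  {M'' : Type*} [TopologicalSpace M''] [ChartedSpace E'' M'']

/-- The differential of a map of manifolds, as a map between the model spaces. -/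
noncomputable def dAt (f : M → M') (x : M) : E →L[ℝ] E' :=
  mfderiv 𝓘(ℝ, E) 𝓘(ℝ, E') f x

theorem dAt_comp {g : M' → M''} {f : M → M'} (x : M)
    (hg : MDifferentiableAt 𝓘(ℝ, E') 𝓘(ℝ, E'') g (f x))
    (hf : MDifferentiableAt 𝓘(ℝ, E) 𝓘(ℝ, E') f x) :
    dAt (E := E) (E' := E'') (fun z ↦ g (f z)) x =
      (dAt (E := E') (E' := E'') g (f x)).comp (dAt (E := E) (E' := E') f x) :=
  mfderiv_comp x hg hf

theorem dAt_id (x : M) : dAt (E := E) (E' := E) (fun z : M ↦ z) x = ContinuousLinearMap.id ℝ E :=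
  mfderiv_id

theorem dAt_const (x : M) (y : M') : dAt (E := E) (E' := E') (fun _ : M ↦ y) x = 0 :=
  mfderiv_const

theorem dAt_eq_fderiv (f : E → E') (x : E) : dAt (E := E) (E' := E') f x = fderiv ℝ f x :=
  mfderiv_eq_fderiv

theorem dAt_congr {f g : M → M'} {x : M} (h : f =ᶠ[𝓝 x] g) :
    dAt (E := E) (E' := E') f x = dAt (E := E) (E' := E') g x :=
  h.mfderiv_eq

theorem mdiff_of_smooth {f : M → M'} {x : M} (h : ContMDiffAt 𝓘(ℝ, E) 𝓘(ℝ, E') ∞ f x) :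
    MDifferentiableAt 𝓘(ℝ, E) 𝓘(ℝ, E') f x :=
  h.mdifferentiableAt (by simp)

theorem velocity_eq_iff {γ : ℝ → M} {t : ℝ} {x : M} {v : E} :
    velocity (E := E) γ t = (⟨x, v⟩ : TangentBundle 𝓘(ℝ, E) M) ↔
      γ t = x ∧ dAt (E := ℝ) (E' := E) γ t 1 = v := by
  constructor
  · intro h
    have h1 : γ t = x := congrArg TotalSpace.proj h
    subst h1
    exact ⟨rfl, eq_of_heq ((TotalSpace.mk.injEq ..).mp h).2⟩
  · rintro ⟨rfl, rfl⟩
    rfl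

variable [IsManifold 𝓘(ℝ, E) ∞ M]

variable (E) in
theorem isManifold_one (M : Type*) [TopologicalSpace M] [ChartedSpace E M]
    [IsManifold 𝓘(ℝ, E) ∞ M] : IsManifold 𝓘(ℝ, E) 1 M :=
  IsManifold.of_le (n := ∞) (by exact_mod_cast le_top)

theorem contMDiffAt_chart {c x : M} (hx : x ∈ (extChartAt 𝓘(ℝ, E) c).source) :
    ContMDiffAt 𝓘(ℝ, E) 𝓘(ℝ, E) ∞ (extChartAt 𝓘(ℝ, E) c) x :=
  contMDiffAt_extChartAt' (by simpa using hx)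

theorem contMDiffAt_chart_symm {c : M} {z : E} (hz : z ∈ (extChartAt 𝓘(ℝ, E) c).target) :
    ContMDiffAt 𝓘(ℝ, E) 𝓘(ℝ, E) ∞ (extChartAt 𝓘(ℝ, E) c).symm z :=
  (contMDiffOn_extChartAt_symm c).contMDiffAt ((isOpen_extChartAt_target c).mem_nhds hz)

/-- The tangent space at a point is the model space by way of the preferred chart there. This
removes all correction factors when computing in the chart at `1` or at `p`. -/
theorem dAt_chart_self (x : M) :
    dAt (E := E) (E' := E) (extChartAt 𝓘(ℝ, E) x) x = ContinuousLinearMap.id ℝ E :=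
  have := isManifold_one E M
  mfderiv_extChartAt_self

theorem dAt_symm_comp_dAt_chart {c x : M} (hx : x ∈ (extChartAt 𝓘(ℝ, E) c).source) :
    (dAt (E := E) (E' := E) (extChartAt 𝓘(ℝ, E) c).symm (extChartAt 𝓘(ℝ, E) c x)).comp
      (dAt (E := E) (E' := E) (extChartAt 𝓘(ℝ, E) c) x) = ContinuousLinearMap.id ℝ E := by
  rw [← dAt_comp]
  · rw [← dAt_id x]
    apply dAt_congr
    filter_upwards [(isOpen_extChartAt_source c).mem_nhds hx] with z hz
    exact (extChartAt 𝓘(ℝ, E) c).left_inv hz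
  · exact mdiff_of_smooth (contMDiffAt_chart_symm ((extChartAt 𝓘(ℝ, E) c).map_source hx))
  · exact (mdiff_of_smooth (contMDiffAt_chart hx))

theorem dAt_chart_comp_dAt_symm {c x : M} (hx : x ∈ (extChartAt 𝓘(ℝ, E) c).source) :
    (dAt (E := E) (E' := E) (extChartAt 𝓘(ℝ, E) c) x).comp
      (dAt (E := E) (E' := E) (extChartAt 𝓘(ℝ, E) c).symm (extChartAt 𝓘(ℝ, E) c x)) =
      ContinuousLinearMap.id ℝ E := by
  have hz := (extChartAt 𝓘(ℝ, E) c).map_source hx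
  have hxx := (extChartAt 𝓘(ℝ, E) c).left_inv hx
  have : dAt (E := E) (E' := E) (extChartAt 𝓘(ℝ, E) c) x =
      dAt (E := E) (E' := E) (extChartAt 𝓘(ℝ, E) c)
        ((extChartAt 𝓘(ℝ, E) c).symm (extChartAt 𝓘(ℝ, E) c x)) := by rw [hxx]
  rw [this, ← dAt_comp]
  · rw [← dAt_id (extChartAt 𝓘(ℝ, E) c x)]
    apply dAt_congr
    filter_upwards [(isOpen_extChartAt_target c).mem_nhds hz] with z hz
    exact (extChartAt 𝓘(ℝ, E) c).right_inv hz
  · rw [hxx]; exact (mdiff_of_smooth (contMDiffAt_chart hx))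
  · exact (mdiff_of_smooth (contMDiffAt_chart_symm hz))

theorem dAt_symm_chart_apply {c x : M} (hx : x ∈ (extChartAt 𝓘(ℝ, E) c).source) (v : E) :
    dAt (E := E) (E' := E) (extChartAt 𝓘(ℝ, E) c).symm (extChartAt 𝓘(ℝ, E) c x)
      (dAt (E := E) (E' := E) (extChartAt 𝓘(ℝ, E) c) x v) = v :=
  congrArg (fun L : E →L[ℝ] E ↦ L v) (dAt_symm_comp_dAt_chart hx)

theorem dAt_chart_symm_apply {c x : M} (hx : x ∈ (extChartAt 𝓘(ℝ, E) c).source) (v : E) :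
    dAt (E := E) (E' := E) (extChartAt 𝓘(ℝ, E) c) x
      (dAt (E := E) (E' := E) (extChartAt 𝓘(ℝ, E) c).symm (extChartAt 𝓘(ℝ, E) c x) v) = v :=
  congrArg (fun L : E →L[ℝ] E ↦ L v) (dAt_chart_comp_dAt_symm hx)

theorem dAt_symm_self (x : M) :
    dAt (E := E) (E' := E) (extChartAt 𝓘(ℝ, E) x).symm (extChartAt 𝓘(ℝ, E) x x) =
      ContinuousLinearMap.id ℝ E := by
  have h := dAt_symm_comp_dAt_chart (mem_extChartAt_source (I := 𝓘(ℝ, E)) x)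
  rwa [dAt_chart_self, ContinuousLinearMap.comp_id] at h

/-- The coordinates of a curve have the coordinates of its velocity as derivative. -/
theorem hasDerivAt_chart {γ : ℝ → M} {t : ℝ} {c : M}
    (hγ : MDifferentiableAt 𝓘(ℝ, ℝ) 𝓘(ℝ, E) γ t)
    (hc : γ t ∈ (extChartAt 𝓘(ℝ, E) c).source) :
    HasDerivAt (fun s ↦ extChartAt 𝓘(ℝ, E) c (γ s))
      (dAt (E := E) (E' := E) (extChartAt 𝓘(ℝ, E) c) (γ t)
        (dAt (E := ℝ) (E' := E) γ t 1)) t := by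
  have h1 : MDifferentiableAt 𝓘(ℝ, ℝ) 𝓘(ℝ, E) (fun s ↦ extChartAt 𝓘(ℝ, E) c (γ s)) t :=
    MDifferentiableAt.comp t (mdiff_of_smooth (contMDiffAt_chart hc)) hγ
  have h2 := (mdifferentiableAt_iff_differentiableAt.1 h1).hasDerivAt
  have h3 := dAt_comp t (mdiff_of_smooth (contMDiffAt_chart hc)) hγ
  rw [dAt_eq_fderiv] at h3
  have h4 : fderiv ℝ (fun s ↦ extChartAt 𝓘(ℝ, E) c (γ s)) t 1 =
    dAt (E := E) (E' := E) (extChartAt 𝓘(ℝ, E) c) (γ t)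
        (dAt (E := ℝ) (E' := E) γ t 1) := by rw [h3]; rfl
  rwa [← h4]

theorem contDiffAt_chart_comp {F : Type*} [NormedAddCommGroup F] [NormedSpace ℝ F]
    {γ : F → M} {t : F} {c : M}
    (hγ : ContMDiffAt 𝓘(ℝ, F) 𝓘(ℝ, E) ∞ γ t)
    (hc : γ t ∈ (extChartAt 𝓘(ℝ, E) c).source) :
    ContDiffAt ℝ ∞ (fun s ↦ extChartAt 𝓘(ℝ, E) c (γ s)) t :=
  ((contMDiffAt_chart hc).comp t hγ).contDiffAt

end Calculus

end SymmetricSpace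

namespace SymmetricSpace

open Set Filter Topology

/-! ### One-parameter subgroups as integral curves of left-invariant fields -/

section Exponential

variable {m : ℕ} {G : Type*} [TopologicalSpace G] [ChartedSpace (EuclideanSpace ℝ (Fin m)) G]
  [Group G]

local notation "V" => EuclideanSpace ℝ (Fin m)

omit [Group G] in
theorem hasMFDerivAt_of_dAt {γ : ℝ → G} {t : ℝ} {v : V}
    (h : MDifferentiableAt 𝓘(ℝ, ℝ) (𝓡 m) γ t) (hv : dAt (E := ℝ) (E' := V) γ t 1 = v) :
    HasMFDerivAt 𝓘(ℝ, ℝ) (𝓡 m) γ t ((1 : ℝ →L[ℝ] ℝ).smulRight (M₂ := TangentSpace (𝓡 m) (γ t)) v) := by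
  have h1 := h.hasMFDerivAt
  have h2 : (1 : ℝ →L[ℝ] ℝ).smulRight (M₂ := V) v = dAt (E := ℝ) (E' := V) γ t := by
    refine ContinuousLinearMap.ext_ring ?_
    rw [hv]
    exact one_smul ℝ v
  exact h2 ▸ h1

omit [Group G] in
theorem dAt_of_hasMFDerivAt {γ : ℝ → G} {t : ℝ} {v : V}
    (h : HasMFDerivAt 𝓘(ℝ, ℝ) (𝓡 m) γ t
      ((1 : ℝ →L[ℝ] ℝ).smulRight (M₂ := TangentSpace (𝓡 m) (γ t)) v)) :
    dAt (E := ℝ) (E' := V) γ t 1 = v := by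
  have := h.mfderiv
  unfold dAt
  rw [this]
  exact one_smul ℝ v

variable [LieGroup (𝓡 m) ∞ G]

theorem smooth_mul_left (g : G) : ContMDiff (𝓡 m) (𝓡 m) ∞ (fun h : G ↦ g * h) :=
  contMDiff_mul_left

theorem mdiff_mul_left (g h : G) : MDifferentiableAt (𝓡 m) (𝓡 m) (fun h : G ↦ g * h) h :=
  mdiff_of_smooth (smooth_mul_left g h)

/-- The left invariant vector field generated by `X`. -/
noncomputable def leftField (X : V) (g : G) : V :=
  dAt (E := V) (E' := V) (fun h : G ↦ g * h) 1 X

theorem leftField_mul (X : V) (g h : G) :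
    leftField X (g * h) = dAt (E := V) (E' := V) (fun x : G ↦ g * x) h (leftField X h) := by
  have := dAt_comp (E := V) (E' := V) (E'' := V) (f := fun x : G ↦ h * x) (g := fun x : G ↦ g * x) 1
    (mdiff_mul_left g _) (mdiff_mul_left h _)
  simp only [mul_one, ← mul_assoc] at this
  unfold leftField
  rw [this]
  rfl

omit [LieGroup (𝓡 m) ∞ G] in
theorem leftField_one (X : V) : leftField X (1 : G) = X := by
  unfold leftField
  simp only [one_mul, dAt_id]
  rfl

variable (G) in
/-- Multiplication of `G` in the chart at the identity. -/
noncomputable def mulChart (q : V × V) : V :=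
  extChartAt (𝓡 m) (1 : G) ((extChartAt (𝓡 m) (1 : G)).symm q.1 * (extChartAt (𝓡 m) (1 : G)).symm q.2)

theorem contDiffAt_mulChart {x y : V} (hx : x ∈ (extChartAt (𝓡 m) (1 : G)).target)
    (hy : y ∈ (extChartAt (𝓡 m) (1 : G)).target)
    (hxy : (extChartAt (𝓡 m) (1 : G)).symm x * (extChartAt (𝓡 m) (1 : G)).symm y ∈
      (extChartAt (𝓡 m) (1 : G)).source) :
    ContDiffAt ℝ ∞ (mulChart G) (x, y) := by
  refine contDiffAt_chart_comp (γ := fun q : V × V ↦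
    (extChartAt (𝓡 m) (1 : G)).symm q.1 * (extChartAt (𝓡 m) (1 : G)).symm q.2) ?_ hxy
  refine ContMDiffAt.mul (I := 𝓡 m) ?_ ?_
  · exact ContMDiffAt.comp (x, y) (contMDiffAt_chart_symm hx) contDiffAt_fst.contMDiffAt
  · exact ContMDiffAt.comp (x, y) (contMDiffAt_chart_symm hy) contDiffAt_snd.contMDiffAt

variable (m G) in
/-- The coordinates of the identity. -/
noncomputable def oneChart : V := extChartAt (𝓡 m) (1 : G) 1

omit [LieGroup (𝓡 m) ∞ G] in
theorem oneChart_mem : oneChart m G ∈ (extChartAt (𝓡 m) (1 : G)).target :=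
  mem_extChartAt_target 1

omit [LieGroup (𝓡 m) ∞ G] in
theorem symm_oneChart : (extChartAt (𝓡 m) (1 : G)).symm (oneChart m G) = 1 :=
  extChartAt_to_inv (I := 𝓡 m) 1

variable (G) in
/-- The left invariant vector fields in the chart at the identity. -/
noncomputable def chartField (x : V) : V →L[ℝ] V :=
  (fderiv ℝ (mulChart G) (x, oneChart m G)).comp (ContinuousLinearMap.inr ℝ V V)

theorem contDiffAt_mulChart_one {x : V} (hx : x ∈ (extChartAt (𝓡 m) (1 : G)).target) :
    ContDiffAt ℝ ∞ (mulChart G) (x, oneChart m G) := by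
  refine contDiffAt_mulChart hx oneChart_mem ?_
  rw [symm_oneChart, mul_one]
  exact (extChartAt (𝓡 m) (1 : G)).map_target hx

theorem contDiffAt_chartField {x : V} (hx : x ∈ (extChartAt (𝓡 m) (1 : G)).target) :
    ContDiffAt ℝ ∞ (chartField (m := m) G) x := by
  have h1 : ContDiffAt ℝ ∞ (fderiv ℝ (mulChart (m := m) G)) (x, oneChart m G) :=
    (contDiffAt_mulChart_one hx).fderiv_right (by simp)
  have h2 : ContDiffAt ℝ ∞ (fun x : V ↦ fderiv ℝ (mulChart (m := m) G) (x, oneChart m G)) x :=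
    h1.comp x (contDiffAt_id.prodMk contDiffAt_const)
  exact h2.clm_comp contDiffAt_const

/-- Chain rule for `y ↦ chart(x · y)` at the coordinates of the identity. It turns the flow of a
left-invariant field into an ODE with smooth right side on the model space. -/
theorem chart_leftField {x : V} (hx : x ∈ (extChartAt (𝓡 m) (1 : G)).target) (X : V) :
    dAt (E := V) (E' := V) (extChartAt (𝓡 m) (1 : G)) ((extChartAt (𝓡 m) (1 : G)).symm x)
      (leftField X ((extChartAt (𝓡 m) (1 : G)).symm x)) = chartField G x X := by
  set c := extChartAt (𝓡 m) (1 : G) with hc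
  have h1 : HasFDerivAt (fun y : V ↦ mulChart G (x, y)) (chartField G x) (oneChart m G) := by
    have := ((contDiffAt_mulChart_one hx).differentiableAt (by simp)).hasFDerivAt
    exact this.comp (oneChart m G) (hasFDerivAt_prodMk_right x (oneChart m G))
  have hd2 : MDifferentiableAt (𝓡 m) (𝓡 m) c.symm (oneChart m G) :=
    mdiff_of_smooth (contMDiffAt_chart_symm oneChart_mem)
  have hd3 : MDifferentiableAt (𝓡 m) (𝓡 m) c (c.symm x * c.symm (oneChart m G)) := by
    rw [symm_oneChart, mul_one]
    exact mdiff_of_smooth (contMDiffAt_chart (c.map_target hx))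
  have h4 := dAt_comp (E := V) (E' := V) (E'' := V) (oneChart m G) (mdiff_mul_left (c.symm x) _) hd2
  have h5 := dAt_comp (E := V) (E' := V) (E'' := V) (f := fun y : V ↦ c.symm x * c.symm y)
    (oneChart m G) hd3 ((mdiff_mul_left (c.symm x) _).comp _ hd2)
  have h6 : dAt (E := V) (E' := V) (fun y : V ↦ c (c.symm x * c.symm y)) (oneChart m G) =
      chartField G x := by
    rw [dAt_eq_fderiv]; exact h1.fderiv
  have h7 : dAt (E := V) (E' := V) c.symm (oneChart m G) = ContinuousLinearMap.id ℝ V :=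
    dAt_symm_self (1 : G)
  rw [h6, h4, h7] at h5
  rw [h5, symm_oneChart]
  simp only [mul_one]
  rfl

theorem contMDiff_leftField (X : GroupLieAlgebra (𝓡 m) G) :
    ContMDiff (𝓡 m) (𝓡 m).tangent 1
      (fun g ↦ (⟨g, mulInvariantVectorField X g⟩ : TangentBundle (𝓡 m) G)) := by
  refine (contMDiff_mulInvariantVectorField (I := 𝓡 m) (G := G) X).of_le ?_
  rw [minSmoothness_of_isRCLikeNormedField]
  norm_num

theorem isMIntegralCurveOn_mul_left {X : GroupLieAlgebra (𝓡 m) G} {γ : ℝ → G} {s : Set ℝ}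
    (hs : IsOpen s)
    (h : IsMIntegralCurveOn γ (mulInvariantVectorField X) s) (g : G) :
    IsMIntegralCurveOn (fun t ↦ g * γ t) (mulInvariantVectorField X) s := by
  intro t ht
  have h1 := (h t ht).hasMFDerivAt (hs.mem_nhds ht)
  refine (hasMFDerivAt_of_dAt ?_ ?_).hasMFDerivWithinAt
  · exact (mdiff_mul_left g _).comp t h1.mdifferentiableAt
  · rw [dAt_comp (E := ℝ) (E' := V) (E'' := V) t (mdiff_mul_left g _) h1.mdifferentiableAt]
    have := dAt_of_hasMFDerivAt h1
    rw [ContinuousLinearMap.comp_apply, this]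
    exact (leftField_mul X g (γ t)).symm

variable [T2Space G]

/-- Left translates of one local integral curve through `1` are integral curves through every point
with the same lifetime, and a uniform lifetime makes a vector field complete. -/
theorem exists_integralCurve (X : GroupLieAlgebra (𝓡 m) G) :
    ∃ γ : ℝ → G, γ 0 = 1 ∧ IsMIntegralCurve γ (mulInvariantVectorField X) := by
  have := isManifold_one V G
  obtain ⟨γ, h0, hγ⟩ := exists_isMIntegralCurveAt_of_contMDiffAt_boundaryless (I := 𝓡 m) 0
    (contMDiff_leftField X (1 : G))
  rw [isMIntegralCurveAt_iff'] at hγ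
  obtain ⟨ε, hε, hγ⟩ := hγ
  refine exists_isMIntegralCurve_of_isMIntegralCurveOn (contMDiff_leftField X) hε (fun g ↦ ?_) 1
  refine ⟨fun t ↦ g * γ t, by simp [h0], ?_⟩
  have := isMIntegralCurveOn_mul_left Metric.isOpen_ball hγ g
  rwa [Real.ball_eq_Ioo, zero_sub, zero_add] at this

/-- Both sides, as functions of `t`, are integral curves of the same field that start at `γ s`. -/
theorem integralCurve_add {X : GroupLieAlgebra (𝓡 m) G} {γ : ℝ → G} (h0 : γ 0 = 1)
    (h : IsMIntegralCurve γ (mulInvariantVectorField X)) (s t : ℝ) :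
    γ (s + t) = γ s * γ t := by
  have := isManifold_one V G
  have h1 : IsMIntegralCurve (γ ∘ (· + s)) (mulInvariantVectorField X) := h.comp_add s
  have h2 : IsMIntegralCurve (fun t ↦ γ s * γ t) (mulInvariantVectorField X) := by
    rw [isMIntegralCurve_iff_isMIntegralCurveOn] at h ⊢
    exact isMIntegralCurveOn_mul_left isOpen_univ h (γ s)
  have := isMIntegralCurve_Ioo_eq_of_contMDiff_boundaryless (t₀ := 0) (contMDiff_leftField X) h1 h2
    (by simp [h0])
  have := congrFun this t
  simpa [add_comm] using this

omit [T2Space G] in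
theorem hasDerivAt_chart_integralCurve {X : GroupLieAlgebra (𝓡 m) G} {γ : ℝ → G} {t : ℝ}
    (h : HasMFDerivAt 𝓘(ℝ, ℝ) (𝓡 m) γ t ((1 : ℝ →L[ℝ] ℝ).smulRight (mulInvariantVectorField X (γ t))))
    (ht : γ t ∈ (extChartAt (𝓡 m) (1 : G)).source) :
    HasDerivAt (fun s ↦ extChartAt (𝓡 m) (1 : G) (γ s))
      (chartField G (extChartAt (𝓡 m) (1 : G) (γ t)) X) t := by
  have h1 := hasDerivAt_chart h.mdifferentiableAt ht
  have h2 := chart_leftField ((extChartAt (𝓡 m) (1 : G)).map_source ht) X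
  rw [(extChartAt (𝓡 m) (1 : G)).left_inv ht] at h2
  rw [← h2]
  have h3 := dAt_of_hasMFDerivAt h
  rw [h3] at h1
  exact h1

/-- Near time `0` the curve solves a smooth ODE in the chart at `1`, so its regularity bootstraps.
The homomorphism law `γ s = γ t · γ(s - t)` carries smoothness to every other time. -/
theorem contMDiff_integralCurve {X : GroupLieAlgebra (𝓡 m) G} {γ : ℝ → G} (h0 : γ 0 = 1)
    (h : IsMIntegralCurve γ (mulInvariantVectorField X)) : ContMDiff 𝓘(ℝ, ℝ) (𝓡 m) ∞ γ := by
  set c := extChartAt (𝓡 m) (1 : G) with hc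
  have hsrc : ∀ᶠ t in 𝓝 (0 : ℝ), γ t ∈ c.source := by
    refine h.continuous.continuousAt.eventually_mem ?_
    rw [h0]
    exact extChartAt_source_mem_nhds 1
  have key : ContMDiffAt 𝓘(ℝ, ℝ) (𝓡 m) ∞ γ 0 := by
    obtain ⟨ε, hε, hb⟩ := Metric.eventually_nhds_iff_ball.1 hsrc
    have hI : ∀ t ∈ Icc (-(ε / 2)) (ε / 2), γ t ∈ c.source := fun t ht ↦ hb t (by
      rw [Real.ball_eq_Ioo]; constructor <;> linarith [ht.1, ht.2])
    have h1 : ContDiffOn ℝ ((⊤ : ℕ∞) : WithTop ℕ∞) (fun s ↦ c (γ s)) (Icc (-(ε / 2)) (ε / 2)) := by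
      refine ODE.contDiffOn_enat_Icc_of_hasDerivWithinAt
        (f := fun _ x ↦ chartField G x X) (u := c.target) ?_ ?_ ?_
      · rintro ⟨t, x⟩ ⟨-, hx⟩
        refine ContDiffAt.contDiffWithinAt ?_
        have := (contDiffAt_chartField hx).comp (t, x) contDiffAt_snd
        exact this.clm_apply contDiffAt_const
      · intro t ht
        exact (hasDerivAt_chart_integralCurve (h t) (hI t ht)).hasDerivWithinAt
      · intro t ht
        exact c.map_source (hI t ht)
    have h2 : ContDiffAt ℝ ∞ (fun s ↦ c (γ s)) 0 :=
      h1.contDiffAt (Icc_mem_nhds (by linarith) (by linarith))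
    have h3 : ContMDiffAt 𝓘(ℝ, ℝ) (𝓡 m) ∞ (fun s ↦ c.symm (c (γ s))) 0 :=
      ContMDiffAt.comp 0 (contMDiffAt_chart_symm (by rw [h0]; exact mem_extChartAt_target 1))
        h2.contMDiffAt
    refine h3.congr_of_eventuallyEq ?_
    filter_upwards [hsrc] with t ht
    exact (c.left_inv ht).symm
  intro t
  have h1 : γ = fun s ↦ γ t * γ (s - t) := by
    funext s
    rw [← integralCurve_add h0 h]
    congr 1
    ring
  rw [h1]
  refine (smooth_mul_left (γ t)).contMDiffAt.comp t ?_
  have h2 : ContMDiffAt 𝓘(ℝ, ℝ) 𝓘(ℝ, ℝ) ∞ (fun s : ℝ ↦ s - t) t :=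
    (contDiff_id.sub contDiff_const).contMDiff.contMDiffAt
  have h3 : ContMDiffAt 𝓘(ℝ, ℝ) (𝓡 m) ∞ γ (t - t) := by rwa [sub_self]
  exact ContMDiffAt.comp (g := γ) (f := fun s : ℝ ↦ s - t) t h3 h2

theorem isOneParameterSubgroup_of_integralCurve {X : GroupLieAlgebra (𝓡 m) G} {γ : ℝ → G}
    (h0 : γ 0 = 1) (h : IsMIntegralCurve γ (mulInvariantVectorField X)) :
    IsOneParameterSubgroup X γ where
  contMDiff := contMDiff_integralCurve h0 h
  map_add := integralCurve_add h0 h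
  velocity_zero := by
    refine velocity_eq_iff.2 ⟨h0, ?_⟩
    rw [dAt_of_hasMFDerivAt (h 0), h0]
    exact leftField_one X

omit [LieGroup (𝓡 m) ∞ G] [T2Space G] in
theorem IsOneParameterSubgroup.map_zero {X : GroupLieAlgebra (𝓡 m) G} {γ : ℝ → G}
    (h : IsOneParameterSubgroup X γ) : γ 0 = 1 :=
  (velocity_eq_iff.1 h.velocity_zero).1

-- Differentiate `γ s = γ t · γ(s - t)` at `s = t`.
omit [T2Space G] in
theorem IsOneParameterSubgroup.isMIntegralCurve {X : GroupLieAlgebra (𝓡 m) G} {γ : ℝ → G}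
    (h : IsOneParameterSubgroup X γ) : IsMIntegralCurve γ (mulInvariantVectorField X) := by
  intro t
  refine hasMFDerivAt_of_dAt (mdiff_of_smooth (h.contMDiff t)) ?_
  have h1 : γ = fun s ↦ γ t * γ (s - t) := by
    funext s
    rw [← h.map_add]
    congr 1
    ring
  have h2 : MDifferentiableAt 𝓘(ℝ, ℝ) 𝓘(ℝ, ℝ) (fun s : ℝ ↦ s - t) t :=
    mdiff_of_smooth (contDiff_id.sub contDiff_const).contMDiff.contMDiffAt
  have h3 : MDifferentiableAt 𝓘(ℝ, ℝ) (𝓡 m) γ (t - t) := mdiff_of_smooth (h.contMDiff _)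
  have h4 := dAt_comp (E := ℝ) (E' := ℝ) (E'' := V) (g := γ) (f := fun s : ℝ ↦ s - t) t h3 h2
  have h5 := dAt_comp (E := ℝ) (E' := V) (E'' := V) (f := fun s : ℝ ↦ γ (s - t)) t
    (mdiff_mul_left (γ t) _) (MDifferentiableAt.comp (g := γ) (f := fun s : ℝ ↦ s - t) t h3 h2)
  have h6 : dAt (E := ℝ) (E' := ℝ) (fun s : ℝ ↦ s - t) t 1 = 1 := by
    rw [dAt_eq_fderiv]
    simp
  have h7 : dAt (E := ℝ) (E' := V) γ t 1 = dAt (E := ℝ) (E' := V) (fun s ↦ γ t * γ (s - t)) t 1 :=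
    congrArg (fun f : ℝ → G ↦ dAt (E := ℝ) (E' := V) f t 1) h1
  rw [h7]
  refine (congrArg (fun L : ℝ →L[ℝ] V ↦ L 1) h5).trans ?_
  rw [ContinuousLinearMap.comp_apply, h4, ContinuousLinearMap.comp_apply, h6,
    sub_self, (velocity_eq_iff.1 h.velocity_zero).2, h.map_zero]
  rfl

theorem IsOneParameterSubgroup.eq {X : GroupLieAlgebra (𝓡 m) G} {γ γ' : ℝ → G}
    (h : IsOneParameterSubgroup X γ) (h' : IsOneParameterSubgroup X γ') : γ = γ' :=
  have := isManifold_one V G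
  isMIntegralCurve_Ioo_eq_of_contMDiff_boundaryless (t₀ := 0) (contMDiff_leftField X)
    h.isMIntegralCurve h'.isMIntegralCurve (by rw [h.map_zero, h'.map_zero])

theorem lieExp_eq {X : GroupLieAlgebra (𝓡 m) G} {γ : ℝ → G}
    (h : IsOneParameterSubgroup X γ) : lieExp X = γ 1 := by
  have hex : ∃ γ : ℝ → G, IsOneParameterSubgroup X γ := ⟨γ, h⟩
  rw [lieExp, dif_pos hex, hex.choose_spec.eq h]

omit [LieGroup (𝓡 m) ∞ G] [T2Space G] in
theorem IsOneParameterSubgroup.comp_smul {X : GroupLieAlgebra (𝓡 m) G} {γ : ℝ → G}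
    (h : IsOneParameterSubgroup X γ) (a : ℝ) :
    IsOneParameterSubgroup (a • X) (fun t ↦ γ (t * a)) where
  contMDiff := h.contMDiff.comp (contDiff_id.mul contDiff_const).contMDiff
  map_add s t := by rw [add_mul, h.map_add]
  velocity_zero := by
    have h1 : MDifferentiableAt 𝓘(ℝ, ℝ) 𝓘(ℝ, ℝ) (fun s : ℝ ↦ s * a) 0 :=
      mdiff_of_smooth (contDiff_id.mul contDiff_const).contMDiff.contMDiffAt
    have h2 := dAt_comp (E := ℝ) (E' := ℝ) (E'' := V) 0 (mdiff_of_smooth (h.contMDiff (0 * a))) h1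
    have h6 : dAt (E := ℝ) (E' := ℝ) (fun s : ℝ ↦ s * a) 0 1 = a • 1 := by
      rw [dAt_eq_fderiv]
      simp
    refine velocity_eq_iff.2 ⟨by rw [zero_mul, h.map_zero], ?_⟩
    rw [h2, ContinuousLinearMap.comp_apply, h6, map_smul, zero_mul,
      (velocity_eq_iff.1 h.velocity_zero).2]
    rfl

/-- If `γ` is generated by `X`, then `s ↦ γ(s t)` is generated by `t X`, whence `exp(tX) = γ t`. -/
theorem isOneParameterSubgroup_lieExp (X : GroupLieAlgebra (𝓡 m) G) :
    IsOneParameterSubgroup X (fun t : ℝ ↦ lieExp (t • X)) := by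
  obtain ⟨γ, h0, hγ⟩ := exists_integralCurve X
  have h := isOneParameterSubgroup_of_integralCurve h0 hγ
  have : (fun t : ℝ ↦ lieExp (t • X)) = γ := by
    funext t
    rw [lieExp_eq (h.comp_smul t), one_mul]
  rwa [this]

theorem lieExp_add_smul (s t : ℝ) (X : GroupLieAlgebra (𝓡 m) G) :
    lieExp ((s + t) • X) = lieExp (s • X) * lieExp (t • X) :=
  (isOneParameterSubgroup_lieExp X).map_add s t

theorem lieExp_zero : lieExp (0 : GroupLieAlgebra (𝓡 m) G) = 1 := by
  have := (isOneParameterSubgroup_lieExp (0 : GroupLieAlgebra (𝓡 m) G)).map_zero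
  rwa [smul_zero] at this

theorem lieExp_neg (X : GroupLieAlgebra (𝓡 m) G) : lieExp (-X) = (lieExp X)⁻¹ := by
  rw [eq_inv_iff_mul_eq_one]
  have := lieExp_add_smul (-1) 1 X
  rwa [neg_add_cancel, zero_smul, lieExp_zero, neg_smul, one_smul, eq_comm] at this

theorem lieExp_nat_smul (n : ℕ) (X : GroupLieAlgebra (𝓡 m) G) :
    lieExp ((n : ℝ) • X) = lieExp X ^ n := by
  induction n with
  | zero => simp [lieExp_zero]
  | succ n ih => rw [Nat.cast_succ, lieExp_add_smul, ih, one_smul, pow_succ]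

variable (G) in
/-- The exponential as a function on the model space of `G`. -/
noncomputable def gexp (X : V) : G := lieExp (m := m) (X : GroupLieAlgebra (𝓡 m) G)

theorem gexp_add_smul (s t : ℝ) (X : V) : gexp G ((s + t) • X) = gexp G (s • X) * gexp G (t • X) :=
  lieExp_add_smul s t (X : GroupLieAlgebra (𝓡 m) G)

theorem gexp_zero : gexp G (0 : V) = 1 := lieExp_zero

theorem gexp_neg (X : V) : gexp G (-X) = (gexp G X)⁻¹ := lieExp_neg (X : GroupLieAlgebra (𝓡 m) G)

theorem gexp_nat_smul (n : ℕ) (X : V) : gexp G ((n : ℝ) • X) = gexp G X ^ n :=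
  lieExp_nat_smul n (X : GroupLieAlgebra (𝓡 m) G)

theorem contMDiff_gexp_smul (X : V) : ContMDiff 𝓘(ℝ, ℝ) (𝓡 m) ∞ (fun t : ℝ ↦ gexp G (t • X)) :=
  (isOneParameterSubgroup_lieExp (X : GroupLieAlgebra (𝓡 m) G)).contMDiff

theorem dAt_gexp_smul (X : V) : dAt (E := ℝ) (E' := V) (fun t : ℝ ↦ gexp G (t • X)) 0 1 = X :=
  (velocity_eq_iff.1 (isOneParameterSubgroup_lieExp (X : GroupLieAlgebra (𝓡 m) G)).velocity_zero).2

/-- A smooth homomorphism from `ℝ` is determined by its initial velocity. -/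
theorem eq_gexp {γ : ℝ → G} {X : V} (h : ContMDiff 𝓘(ℝ, ℝ) (𝓡 m) ∞ γ)
    (hadd : ∀ s t, γ (s + t) = γ s * γ t) (h0 : γ 0 = 1)
    (hv : dAt (E := ℝ) (E' := V) γ 0 1 = X) (t : ℝ) : γ t = gexp G (t • X) :=
  congrFun (IsOneParameterSubgroup.eq (X := (X : GroupLieAlgebra (𝓡 m) G))
    ⟨h, hadd, velocity_eq_iff.2 ⟨h0, hv⟩⟩ (isOneParameterSubgroup_lieExp _)) t

end Exponential

end SymmetricSpace

namespace SymmetricSpace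

open Set Filter Topology

/-! ### Continuity of the exponential map -/

section ExponentialContinuity

variable {m : ℕ} {G : Type*} [TopologicalSpace G] [ChartedSpace (EuclideanSpace ℝ (Fin m)) G]
  [Group G] [LieGroup (𝓡 m) ∞ G] [T2Space G]

local notation "V" => EuclideanSpace ℝ (Fin m)

theorem gexp_eqOn_of_chart {X : V} {δ : ℝ} (hδ : 0 < δ) {α : ℝ → V}
    (h0 : α 0 = oneChart m G) (hmem : ∀ t ∈ Ioo (-δ) δ, α t ∈ (extChartAt (𝓡 m) (1 : G)).target)
    (hα : ∀ t ∈ Ioo (-δ) δ, HasDerivAt α (chartField G (α t) X) t) :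
    ∀ t ∈ Ioo (-δ) δ, gexp G (t • X) = (extChartAt (𝓡 m) (1 : G)).symm (α t) := by
  have := isManifold_one V G
  set c := extChartAt (𝓡 m) (1 : G) with hc
  have h1 : IsMIntegralCurveOn (fun t ↦ c.symm (α t)) (mulInvariantVectorField (I := 𝓡 m) (G := G) X) (Ioo (-δ) δ) := by
    intro t ht
    have hd1 : MDifferentiableAt 𝓘(ℝ, ℝ) (𝓡 m) α t := (hα t ht).differentiableAt.mdifferentiableAt
    have hd2 : MDifferentiableAt (𝓡 m) (𝓡 m) c.symm (α t) :=
      mdiff_of_smooth (contMDiffAt_chart_symm (hmem t ht))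
    refine (hasMFDerivAt_of_dAt (γ := fun t ↦ c.symm (α t)) (hd2.comp t hd1) ?_).hasMFDerivWithinAt
    refine (congrArg (fun L : ℝ →L[ℝ] V ↦ L 1) (dAt_comp (E := ℝ) (E' := V) (E'' := V) t hd2 hd1)).trans ?_
    rw [ContinuousLinearMap.comp_apply, dAt_eq_fderiv]
    have h2 : fderiv ℝ α t 1 = chartField G (α t) X := (hα t ht).deriv
    have h3 := dAt_symm_chart_apply (E := V) (c.map_target (hmem t ht)) (leftField X (c.symm (α t)))
    rw [h2, ← chart_leftField (hmem t ht) X]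
    rw [← hc, c.right_inv (hmem t ht)] at h3
    exact h3
  have h2 : IsMIntegralCurveOn (fun t : ℝ ↦ gexp G (t • X)) (mulInvariantVectorField (I := 𝓡 m) (G := G) X)
      (Ioo (-δ) δ) :=
    (isOneParameterSubgroup_lieExp (X : GroupLieAlgebra (𝓡 m) G)).isMIntegralCurve.isMIntegralCurveOn _
  refine isMIntegralCurveOn_Ioo_eqOn_of_contMDiff_boundaryless (t₀ := 0) ⟨by linarith, hδ⟩
    (contMDiff_leftField (X : GroupLieAlgebra (𝓡 m) G)) h2 h1 ?_
  rw [zero_smul, gexp_zero, h0]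
  exact symm_oneChart.symm

/-- The generator is adjoined to the unknown as a second component with zero derivative. Dependence
on `X` becomes dependence on the initial value, which the Picard-Lindelöf theorem makes continuous.
-/
theorem exists_continuousOn_gexp :
    ∃ r > 0, ContinuousOn (fun X : V ↦ gexp G X)
      (Metric.ball 0 r) := by
  set c := extChartAt (𝓡 m) (1 : G) with hc
  have hf : ContDiffAt ℝ 1 (fun q : V × V ↦ ((chartField G q.1 q.2, 0) : V × V))
      (oneChart m G, 0) := by
    have h1 : ContDiffAt ℝ ∞ (fun q : V × V ↦ chartField G q.1) (oneChart m G, 0) :=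
      (contDiffAt_chartField oneChart_mem).comp (oneChart m G, (0 : V)) contDiffAt_fst
    exact ((h1.clm_apply contDiffAt_snd).of_le (by exact_mod_cast le_top)).prodMk contDiffAt_const
  obtain ⟨ε, hε, a, r, L, K, hr, hp⟩ := IsPicardLindelof.of_contDiffAt_one hf
  obtain ⟨α, hα, hcont⟩ := (hp 0).exists_forall_mem_closedBall_eq_hasDerivWithinAt_continuousOn
  simp only [zero_sub, zero_add] at hα hcont
  have hr' : (0 : ℝ) < r := hr
  have hc0 : ContinuousAt α ((oneChart m G, 0), 0) := by
    refine hcont.continuousAt (prod_mem_nhds (Metric.closedBall_mem_nhds _ hr')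
      (Icc_mem_nhds (by linarith) hε))
  have hα0 : α ((oneChart m G, 0), 0) = (oneChart m G, 0) :=
    (hα _ (Metric.mem_closedBall_self hr'.le)).1
  have hev : ∀ᶠ q in 𝓝 (((oneChart m G, (0 : V)), (0 : ℝ)) : (V × V) × ℝ), (α q).1 ∈ c.target := by
    refine (continuous_fst.continuousAt.comp hc0).eventually_mem ?_
    rw [Function.comp_apply, hα0]
    exact (isOpen_extChartAt_target (I := 𝓡 m) (1 : G)).mem_nhds oneChart_mem
  obtain ⟨δ₀, hδ₀, hb⟩ := Metric.eventually_nhds_iff_ball.1 hev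
  obtain ⟨δ, hδ, hδ1, hδ2, hδ3⟩ : ∃ δ : ℝ, 0 < δ ∧ δ < δ₀ ∧ δ < ε ∧ δ < r := by
    refine ⟨min δ₀ (min ε r) / 2, by positivity, ?_, ?_, ?_⟩
    · exact (half_lt_self (by positivity)).trans_le (min_le_left _ _)
    · exact (half_lt_self (by positivity)).trans_le ((min_le_right _ _).trans (min_le_left _ _))
    · exact (half_lt_self (by positivity)).trans_le ((min_le_right _ _).trans (min_le_right _ _))
  have hball : ∀ X : V, ‖X‖ < δ → (oneChart m G, X) ∈ Metric.closedBall (oneChart m G, (0 : V)) r := by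
    intro X hX
    rw [Metric.mem_closedBall, Prod.dist_eq, dist_self, dist_zero_right]
    exact max_le hr'.le (by linarith)
  have hexp : ∀ X : V, ‖X‖ < δ → ∀ t ∈ Ioo (-δ) δ,
      gexp G (t • X) = c.symm (α ((oneChart m G, X), t)).1 := by
    intro X hX
    obtain ⟨hi, hd⟩ := hα _ (hball X hX)
    have hd' : ∀ t ∈ Ioo (-δ) δ, HasDerivAt (fun t ↦ α ((oneChart m G, X), t))
        (chartField G (α ((oneChart m G, X), t)).1 (α ((oneChart m G, X), t)).2, 0) t := fun t ht ↦
      (hd t ⟨by linarith [ht.1], by linarith [ht.2]⟩).hasDerivAt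
        (Icc_mem_nhds (by linarith [ht.1]) (by linarith [ht.2]))
    -- The second component has zero derivative, so it keeps its initial value `X`.
    have h2 : ∀ t ∈ Ioo (-δ) δ, (α ((oneChart m G, X), t)).2 = X := by
      intro t ht
      have h3 : ∀ s ∈ Ioo (-δ) δ, HasDerivWithinAt (fun t ↦ (α ((oneChart m G, X), t)).2) 0
          (Ioo (-δ) δ) s := fun s hs ↦
        ((ContinuousLinearMap.snd ℝ V V).hasFDerivAt.comp_hasDerivAt s (hd' s hs)).hasDerivWithinAt
      have h4 := (convex_Ioo (-δ) δ).is_const_of_fderivWithin_eq_zero (𝕜 := ℝ)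
        (fun s hs ↦ (h3 s hs).differentiableWithinAt)
        (fun s hs ↦ by
          rw [(h3 s hs).hasFDerivWithinAt.fderivWithin (isOpen_Ioo.uniqueDiffWithinAt hs)]
          ext; simp) ht (show (0 : ℝ) ∈ Ioo (-δ) δ from ⟨by linarith, hδ⟩)
      have h5 := congrArg Prod.snd hi
      exact h4.trans h5
    refine gexp_eqOn_of_chart hδ (α := fun t ↦ (α ((oneChart m G, X), t)).1) ?_ ?_ ?_
    · rw [hi]
    · intro t ht
      refine hb _ ?_
      rw [Metric.mem_ball, Prod.dist_eq, Prod.dist_eq, dist_self, dist_zero_right, dist_zero_right,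
        Real.norm_eq_abs]
      have := abs_lt.2 ht
      exact max_lt (max_lt hδ₀ (by linarith)) (by linarith)
    · intro t ht
      have h6 := (ContinuousLinearMap.fst ℝ V V).hasFDerivAt.comp_hasDerivAt t (hd' t ht)
      rw [h2 t ht] at h6
      exact h6
  -- Time `δ / 2` is interior to the common interval of existence. A generator shorter than `δ / 2 *
  -- δ`, divided by `δ / 2`, has norm below `δ`, so `exp X` is a solution at the fixed time `δ / 2`.
  refine ⟨δ / 2 * δ, by positivity, ?_⟩
  have hs : (0 : ℝ) < δ / 2 := by linarith
  have heq : ∀ X ∈ Metric.ball (0 : V) (δ / 2 * δ),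
      ‖(δ / 2)⁻¹ • X‖ < δ := by
    intro X hX
    rw [mem_ball_zero_iff] at hX
    rw [norm_smul, Real.norm_of_nonneg (by positivity), inv_mul_lt_iff₀ hs]
    exact hX
  have hcong : ∀ X ∈ Metric.ball (0 : V) (δ / 2 * δ),
      gexp G X =
        c.symm (α ((oneChart m G, (δ / 2)⁻¹ • X), δ / 2)).1 := by
    intro X hX
    rw [← hexp _ (heq X hX) (δ / 2) ⟨by linarith, by linarith⟩]
    congr 1
    exact (smul_inv_smul₀ hs.ne' X).symm
  refine ContinuousOn.congr ?_ hcong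
  have h7 : ContinuousOn (fun X : V ↦ α ((oneChart m G, (δ / 2)⁻¹ • X), δ / 2))
      (Metric.ball (0 : V) (δ / 2 * δ)) := by
    refine hcont.comp (by fun_prop) ?_
    intro X hX
    exact ⟨hball _ (heq X hX), by linarith, by linarith⟩
  refine (continuousOn_extChartAt_symm (I := 𝓡 m) (1 : G)).comp
    (continuous_fst.comp_continuousOn h7) ?_
  intro X hX
  refine hb _ ?_
  have := heq X hX
  rw [Metric.mem_ball, Prod.dist_eq, Prod.dist_eq, dist_self, dist_zero_right, dist_zero_right,
        Real.norm_of_nonneg hs.le]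
  exact max_lt (max_lt hδ₀ (by linarith)) (by linarith)

/-- Near a given `X₀` write `exp X = exp(X/N)^N` with `N` so large that `X₀/N` lies in the ball
where continuity is known. -/
theorem continuous_gexp : Continuous (gexp G : V → G) := by
  obtain ⟨r, hr, hc⟩ := exists_continuousOn_gexp (m := m) (G := G)
  have key : ∀ X₀ : V, ContinuousAt (fun X : V ↦ gexp G X) X₀ := by
    intro X₀
    obtain ⟨N, hN⟩ := exists_nat_gt (‖X₀‖ / r)
    have hN0 : (0 : ℝ) < N := (by positivity : 0 ≤ ‖X₀‖ / r).trans_lt hN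
    have h1 : (fun X : V ↦ gexp G X) =
        fun X : V ↦ gexp G ((N : ℝ)⁻¹ • X) ^ N := by
      funext X
      rw [← gexp_nat_smul]
      congr 1
      exact (smul_inv_smul₀ hN0.ne' X).symm
    rw [h1]
    have := topologicalGroup_of_lieGroup (𝓡 m) ∞ (G := G)
    refine ContinuousAt.pow ?_ N
    have h2 : (N : ℝ)⁻¹ • X₀ ∈ Metric.ball (0 : V) r := by
      rw [mem_ball_zero_iff, norm_smul, norm_inv, Real.norm_of_nonneg hN0.le, inv_mul_lt_iff₀ hN0]
      rw [div_lt_iff₀ hr] at hN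
      exact hN
    exact ContinuousAt.comp (f := fun X : V ↦ (N : ℝ)⁻¹ • X)
      (hc.continuousAt (Metric.isOpen_ball.mem_nhds h2)) (by fun_prop)
  exact continuous_iff_continuousAt.2 key

end ExponentialContinuity

end SymmetricSpace

namespace SymmetricSpace

open Set Filter Topology

/-! ### The adjoint representation and its derivative -/

section Adjoint

variable {m : ℕ} {G : Type*} [TopologicalSpace G] [ChartedSpace (EuclideanSpace ℝ (Fin m)) G]
  [Group G]

local notation "V" => EuclideanSpace ℝ (Fin m)

/-- The adjoint representation. -/
noncomputable def Ad (g : G) : V →L[ℝ] V :=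
  dAt (E := V) (E' := V) (fun h : G ↦ g * h * g⁻¹) 1

/-- The Lie bracket on the model space of `G`. -/
noncomputable def bracket (G : Type*) [TopologicalSpace G]
    [ChartedSpace (EuclideanSpace ℝ (Fin m)) G] [Group G] (X Y : V) : V :=
  @Bracket.bracket (GroupLieAlgebra (𝓡 m) G) (GroupLieAlgebra (𝓡 m) G) _ X Y

variable [LieGroup (𝓡 m) ∞ G]

theorem smooth_mul_right (g : G) : ContMDiff (𝓡 m) (𝓡 m) ∞ (fun h : G ↦ h * g) :=
  contMDiff_mul_right

theorem mdiff_mul_right (g h : G) : MDifferentiableAt (𝓡 m) (𝓡 m) (fun h : G ↦ h * g) h :=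
  mdiff_of_smooth (smooth_mul_right g h)

theorem smooth_conj (g : G) : ContMDiff (𝓡 m) (𝓡 m) ∞ (fun h : G ↦ g * h * g⁻¹) :=
  (smooth_mul_right g⁻¹).comp (smooth_mul_left g)

theorem mdiff_conj (g h : G) : MDifferentiableAt (𝓡 m) (𝓡 m) (fun h : G ↦ g * h * g⁻¹) h :=
  mdiff_of_smooth (smooth_conj g h)

omit [LieGroup (𝓡 m) ∞ G] in
theorem Ad_one : Ad (1 : G) = ContinuousLinearMap.id ℝ V := by
  unfold Ad
  simp only [one_mul, inv_one, mul_one]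
  exact dAt_id _

theorem Ad_mul (g h : G) : Ad (m := m) (g * h) = (Ad g).comp (Ad h) := by
  have := dAt_comp (E := V) (E' := V) (E'' := V) (f := fun x : G ↦ h * x * h⁻¹)
    (g := fun x : G ↦ g * x * g⁻¹) 1 (mdiff_conj g _) (mdiff_conj h _)
  simp only [mul_one, mul_inv_cancel] at this
  unfold Ad
  rw [← this]
  congr 1
  funext x
  group

theorem Ad_mul_apply (g h : G) (X : V) : Ad (g * h) X = Ad g (Ad h X) := by
  rw [Ad_mul]; rfl

theorem Ad_inv_apply (g : G) (X : V) : Ad g⁻¹ (Ad g X) = X := by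
  rw [← Ad_mul_apply, inv_mul_cancel, Ad_one]; rfl

theorem Ad_apply_inv (g : G) (X : V) : Ad g (Ad g⁻¹ X) = X := by
  rw [← Ad_mul_apply, mul_inv_cancel, Ad_one]; rfl

/-- From `g h = (g h g⁻¹) g`. Differentiating this comparison of left and right translates is how
the derivative of `Ad` is computed. -/
theorem leftField_eq_right (X : V) (g : G) :
    leftField X g = dAt (E := V) (E' := V) (fun h : G ↦ h * g) 1 (Ad g X) := by
  have h1 : MDifferentiableAt (𝓡 m) (𝓡 m) (fun h : G ↦ h * g) (g * 1 * g⁻¹) := mdiff_mul_right g _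
  have := dAt_comp (E := V) (E' := V) (E'' := V) (f := fun x : G ↦ g * x * g⁻¹)
    (g := fun x : G ↦ x * g) 1 h1 (mdiff_conj g _)
  simp only [mul_one, mul_inv_cancel, inv_mul_cancel_right] at this
  unfold leftField Ad
  rw [this]
  rfl

theorem chart_right {x : V} (hx : x ∈ (extChartAt (𝓡 m) (1 : G)).target) (X : V) :
    dAt (E := V) (E' := V) (extChartAt (𝓡 m) (1 : G)) ((extChartAt (𝓡 m) (1 : G)).symm x)
      (dAt (E := V) (E' := V) (fun h : G ↦ h * (extChartAt (𝓡 m) (1 : G)).symm x) 1 X) =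
    fderiv ℝ (mulChart G) (oneChart m G, x) (X, 0) := by
  set c := extChartAt (𝓡 m) (1 : G) with hc
  have hsm : ContDiffAt ℝ ∞ (mulChart G) (oneChart m G, x) := by
    refine contDiffAt_mulChart oneChart_mem hx ?_
    rw [symm_oneChart, one_mul]
    exact c.map_target hx
  have h1 : HasFDerivAt (fun y : V ↦ mulChart G (y, x))
      ((fderiv ℝ (mulChart G) (oneChart m G, x)).comp (ContinuousLinearMap.inl ℝ V V))
      (oneChart m G) := by
    have := (hsm.differentiableAt (by simp)).hasFDerivAt
    exact HasFDerivAt.comp (g := mulChart G) (f := fun y : V ↦ (y, x)) (oneChart m G) this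
      (hasFDerivAt_prodMk_left (oneChart m G) x)
  have hd2 : MDifferentiableAt (𝓡 m) (𝓡 m) c.symm (oneChart m G) :=
    mdiff_of_smooth (contMDiffAt_chart_symm oneChart_mem)
  have hd3 : MDifferentiableAt (𝓡 m) (𝓡 m) c (c.symm (oneChart m G) * c.symm x) := by
    rw [symm_oneChart, one_mul]
    exact mdiff_of_smooth (contMDiffAt_chart (c.map_target hx))
  have h4 := dAt_comp (E := V) (E' := V) (E'' := V) (oneChart m G) (mdiff_mul_right (c.symm x) _) hd2
  have h5 := dAt_comp (E := V) (E' := V) (E'' := V) (f := fun y : V ↦ c.symm y * c.symm x)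
    (oneChart m G) hd3 ((mdiff_mul_right (c.symm x) _).comp _ hd2)
  have h6 : dAt (E := V) (E' := V) (fun y : V ↦ c (c.symm y * c.symm x)) (oneChart m G) =
      (fderiv ℝ (mulChart G) (oneChart m G, x)).comp (ContinuousLinearMap.inl ℝ V V) := by
    rw [dAt_eq_fderiv]; exact h1.fderiv
  have h7 : dAt (E := V) (E' := V) c.symm (oneChart m G) = ContinuousLinearMap.id ℝ V :=
    dAt_symm_self (1 : G)
  rw [h6, h4, h7] at h5
  have h8 := congrArg (fun L : V →L[ℝ] V ↦ L X) h5
  simp only [ContinuousLinearMap.comp_apply, ContinuousLinearMap.inl_apply] at h8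
  rw [h8, symm_oneChart]
  simp only [one_mul]
  rfl

variable (G) in
/-- Conjugation in the chart at the identity. -/
noncomputable def conjChart (q : V × V) : V :=
  extChartAt (𝓡 m) (1 : G) ((extChartAt (𝓡 m) (1 : G)).symm q.1 *
    (extChartAt (𝓡 m) (1 : G)).symm q.2 * ((extChartAt (𝓡 m) (1 : G)).symm q.1)⁻¹)

theorem contDiffAt_conjChart {x : V} (hx : x ∈ (extChartAt (𝓡 m) (1 : G)).target) :
    ContDiffAt ℝ ∞ (conjChart G) (x, oneChart m G) := by
  refine contDiffAt_chart_comp (γ := fun q : V × V ↦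
    (extChartAt (𝓡 m) (1 : G)).symm q.1 * (extChartAt (𝓡 m) (1 : G)).symm q.2 *
      ((extChartAt (𝓡 m) (1 : G)).symm q.1)⁻¹) ?_ ?_
  · have h1 : ContMDiffAt 𝓘(ℝ, V × V) (𝓡 m) ∞
        (fun q : V × V ↦ (extChartAt (𝓡 m) (1 : G)).symm q.1) (x, oneChart m G) :=
      ContMDiffAt.comp (x, oneChart m G) (contMDiffAt_chart_symm hx) contDiffAt_fst.contMDiffAt
    refine ContMDiffAt.mul (I := 𝓡 m) (ContMDiffAt.mul (I := 𝓡 m) h1 ?_) h1.inv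
    exact ContMDiffAt.comp (x, oneChart m G) (contMDiffAt_chart_symm oneChart_mem)
      contDiffAt_snd.contMDiffAt
  · rw [symm_oneChart, mul_one, mul_inv_cancel]
    exact mem_extChartAt_source 1

theorem Ad_symm_chart {x : V} (hx : x ∈ (extChartAt (𝓡 m) (1 : G)).target) :
    Ad ((extChartAt (𝓡 m) (1 : G)).symm x) =
      (fderiv ℝ (conjChart G) (x, oneChart m G)).comp (ContinuousLinearMap.inr ℝ V V) := by
  set c := extChartAt (𝓡 m) (1 : G) with hc
  have h1 : HasFDerivAt (fun y : V ↦ conjChart G (x, y))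
      ((fderiv ℝ (conjChart G) (x, oneChart m G)).comp (ContinuousLinearMap.inr ℝ V V))
      (oneChart m G) := by
    have := ((contDiffAt_conjChart hx).differentiableAt (by simp)).hasFDerivAt
    exact HasFDerivAt.comp (g := conjChart G) (f := fun y : V ↦ (x, y)) (oneChart m G) this
      (hasFDerivAt_prodMk_right x (oneChart m G))
  have hd2 : MDifferentiableAt (𝓡 m) (𝓡 m) c.symm (oneChart m G) :=
    mdiff_of_smooth (contMDiffAt_chart_symm oneChart_mem)
  have hd3 : MDifferentiableAt (𝓡 m) (𝓡 m) c (c.symm x * c.symm (oneChart m G) * (c.symm x)⁻¹) := by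
    rw [symm_oneChart, mul_one, mul_inv_cancel]
    exact mdiff_of_smooth (contMDiffAt_chart (mem_extChartAt_source 1))
  have h4 := dAt_comp (E := V) (E' := V) (E'' := V) (oneChart m G) (mdiff_conj (c.symm x) _) hd2
  have h5 := dAt_comp (E := V) (E' := V) (E'' := V)
    (f := fun y : V ↦ c.symm x * c.symm y * (c.symm x)⁻¹)
    (oneChart m G) hd3 ((mdiff_conj (c.symm x) _).comp _ hd2)
  have h6 : dAt (E := V) (E' := V) (fun y : V ↦ c (c.symm x * c.symm y * (c.symm x)⁻¹))
      (oneChart m G) = (fderiv ℝ (conjChart G) (x, oneChart m G)).comp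
        (ContinuousLinearMap.inr ℝ V V) := by
    rw [dAt_eq_fderiv]; exact h1.fderiv
  have h7 : dAt (E := V) (E' := V) c.symm (oneChart m G) = ContinuousLinearMap.id ℝ V :=
    dAt_symm_self (1 : G)
  rw [h6, h4, h7] at h5
  rw [h5, symm_oneChart, mul_one, mul_inv_cancel, dAt_chart_self]
  rfl

theorem contDiffAt_Ad_symm_chart {x : V} (hx : x ∈ (extChartAt (𝓡 m) (1 : G)).target) :
    ContDiffAt ℝ ∞ (fun z : V ↦ Ad (m := m) ((extChartAt (𝓡 m) (1 : G)).symm z)) x := by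
  have h1 : ContDiffAt ℝ ∞ (fderiv ℝ (conjChart (m := m) G)) (x, oneChart m G) :=
    (contDiffAt_conjChart hx).fderiv_right (by simp)
  have h2 : ContDiffAt ℝ ∞ (fun x : V ↦ fderiv ℝ (conjChart (m := m) G) (x, oneChart m G)) x :=
    h1.comp x (contDiffAt_id.prodMk contDiffAt_const)
  refine (h2.clm_comp (contDiffAt_const (c := ContinuousLinearMap.inr ℝ V V))).congr_of_eventuallyEq ?_
  filter_upwards [(isOpen_extChartAt_target (I := 𝓡 m) (1 : G)).mem_nhds hx] with z hz
  exact Ad_symm_chart hz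

/-- The bracket of left-invariant fields at `1` is computed in the chart at `1`, where the fields
are given by `chartField` and the differential of the chart is the identity. -/
theorem bracket_eq_chart (X Y : V) : bracket G X Y =
    fderiv ℝ (fun x ↦ chartField G x Y) (oneChart m G) X -
      fderiv ℝ (fun x ↦ chartField G x X) (oneChart m G) Y := by
  have := isManifold_one V G
  let A : V → V → V := fun Z ↦ VectorField.mpullbackWithin 𝓘(ℝ, V) (𝓡 m)
    (extChartAt (𝓡 m) (1 : G)).symm (mulInvariantVectorField (I := 𝓡 m) (G := G) Z) (range (𝓡 m))
  have h1 : ∀ Z : V, A Z =ᶠ[𝓝 (oneChart m G)] fun x : V ↦ chartField G x Z := by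
    intro Z
    filter_upwards [(isOpen_extChartAt_target (I := 𝓡 m) (1 : G)).mem_nhds oneChart_mem] with x hx
    rw [← chart_leftField hx Z]
    have h2 : mfderivWithin 𝓘(ℝ, V) (𝓡 m) (extChartAt (𝓡 m) (1 : G)).symm (range (𝓡 m)) x =
        dAt (E := V) (E' := V) (extChartAt (𝓡 m) (1 : G)).symm x := by
      rw [ModelWithCorners.range_eq_univ, mfderivWithin_univ]
      rfl
    have h3 : (dAt (E := V) (E' := V) (extChartAt (𝓡 m) (1 : G)).symm x).inverse =
        dAt (E := V) (E' := V) (extChartAt (𝓡 m) (1 : G)) ((extChartAt (𝓡 m) (1 : G)).symm x) := by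
      have hs := (extChartAt (𝓡 m) (1 : G)).map_target hx
      have h4 := dAt_symm_comp_dAt_chart (E := V) hs
      have h5 := dAt_chart_comp_dAt_symm (E := V) hs
      rw [(extChartAt (𝓡 m) (1 : G)).right_inv hx] at h4 h5
      exact ContinuousLinearMap.inverse_eq h4 h5
    refine Eq.trans ?_ (congrArg (fun L : V →L[ℝ] V ↦ L (leftField Z _)) h3)
    exact congrArg (fun L : V →L[ℝ] V ↦ L.inverse (leftField Z _)) h2
  -- Unfolding the manifold bracket: pull the fields back to the model space, take the flat bracket,
  -- and return to the tangent space at `1`.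
  have h2 : bracket G X Y = (dAt (E := V) (E' := V) (extChartAt (𝓡 m) (1 : G)) 1).inverse
    (VectorField.lieBracketWithin ℝ (A X) (A Y)
      ((extChartAt (𝓡 m) (1 : G)).symm ⁻¹' univ ∩ range (𝓡 m)) (oneChart m G)) := rfl
  have hs : (extChartAt (𝓡 m) (1 : G)).symm ⁻¹' univ ∩ range (𝓡 m) = univ := by
    rw [preimage_univ, ModelWithCorners.range_eq_univ, univ_inter]
  rw [h2, dAt_chart_self, ContinuousLinearMap.inverse_id, hs, VectorField.lieBracketWithin_univ]
  have h3 := Filter.EventuallyEq.lieBracket_vectorField_eq (𝕜 := ℝ) (h1 X) (h1 Y)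
  refine (congrArg (ContinuousLinearMap.id ℝ V) h3).trans ?_
  have h4 : ∀ Z : V, chartField G (oneChart m G) Z = Z := by
    intro Z
    rw [← chart_leftField oneChart_mem, symm_oneChart, dAt_chart_self, leftField_one]
    rfl
  rw [ContinuousLinearMap.id_apply, VectorField.lieBracket, h4, h4]

/-- Differentiate at the identity the relation that the left translate of `Y` at `x` is the right
translate of `Ad(x) Y`. The derivative of `Ad` comes out as a difference of two mixed second
derivatives of the multiplication, and so does the bracket. -/
theorem fderiv_Ad_symm_chart (X Y : V) :
    fderiv ℝ (fun z : V ↦ Ad (m := m) ((extChartAt (𝓡 m) (1 : G)).symm z)) (oneChart m G) X Y =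
      bracket G X Y := by
  set c := extChartAt (𝓡 m) (1 : G) with hc
  set e := oneChart m G with he
  have hμ : ContDiffAt ℝ ∞ (mulChart (m := m) G) (e, e) := contDiffAt_mulChart_one oneChart_mem
  have hμ' : ContDiffAt ℝ ∞ (fderiv ℝ (mulChart (m := m) G)) (e, e) := hμ.fderiv_right (by simp)
  have hd := (hμ'.differentiableAt (by simp)).hasFDerivAt
  set D := fderiv ℝ (fderiv ℝ (mulChart (m := m) G)) (e, e) with hD
  have hsymm : ∀ a b : V × V, D a b = D b a :=
    hμ.isSymmSndFDerivAt (by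
      rw [minSmoothness_of_isRCLikeNormedField]
      exact WithTop.coe_le_coe.2 le_top)
  have hL : HasFDerivAt (fun x : V ↦ fderiv ℝ (mulChart (m := m) G) (x, e))
      (D.comp (ContinuousLinearMap.inl ℝ V V)) e :=
    HasFDerivAt.comp (f := fun x : V ↦ (x, e)) e hd (hasFDerivAt_prodMk_left e e)
  have hR : HasFDerivAt (fun x : V ↦ fderiv ℝ (mulChart (m := m) G) (e, x))
      (D.comp (ContinuousLinearMap.inr ℝ V V)) e :=
    HasFDerivAt.comp (f := fun x : V ↦ (e, x)) e hd (hasFDerivAt_prodMk_right e e)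
  have hLZ : ∀ Z : V, HasFDerivAt (fun x : V ↦ chartField G x Z)
      ((ContinuousLinearMap.apply ℝ V ((0, Z) : V × V)).comp
        (D.comp (ContinuousLinearMap.inl ℝ V V))) e := fun Z ↦
    (ContinuousLinearMap.apply ℝ V ((0, Z) : V × V)).hasFDerivAt.comp e hL
  have hA := ((contDiffAt_Ad_symm_chart (m := m) (G := G) oneChart_mem).differentiableAt
    (by simp)).hasFDerivAt
  rw [← hc, ← he] at hA
  set A := fderiv ℝ (fun z : V ↦ Ad (m := m) (c.symm z)) e with hAdef
  have hAY : HasFDerivAt (fun x : V ↦ Ad (m := m) (c.symm x) Y)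
      ((ContinuousLinearMap.apply ℝ V Y).comp A) e :=
    (ContinuousLinearMap.apply ℝ V Y).hasFDerivAt.comp e hA
  have hRcomp : HasFDerivAt
      (fun x : V ↦ fderiv ℝ (mulChart (m := m) G) (e, x)
        (ContinuousLinearMap.inl ℝ V V (Ad (m := m) (c.symm x) Y))) _ e :=
    hR.clm_apply ((ContinuousLinearMap.inl ℝ V V).hasFDerivAt.comp e hAY)
  -- The comparison of left and right translates, written through partial derivatives of the
  -- multiplication.
  have hEq : (fun x : V ↦ chartField G x Y) =ᶠ[𝓝 e]
      (fun x : V ↦ fderiv ℝ (mulChart (m := m) G) (e, x)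
        (ContinuousLinearMap.inl ℝ V V (Ad (m := m) (c.symm x) Y))) := by
    filter_upwards [(isOpen_extChartAt_target (I := 𝓡 m) (1 : G)).mem_nhds oneChart_mem] with x hx
    rw [← chart_leftField hx, leftField_eq_right, chart_right hx]
    rfl
  have hkey := ((hLZ Y).congr_of_eventuallyEq hEq.symm).unique hRcomp
  have hkeyX := congrArg (fun L : V →L[ℝ] V ↦ L X) hkey
  have h1 : fderiv ℝ (mulChart (m := m) G) (e, e) (A X Y, 0) = A X Y := by
    have := chart_right (G := G) oneChart_mem (A X Y)
    rw [symm_oneChart, dAt_chart_self] at this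
    simp only [mul_one, dAt_id] at this
    exact this.symm
  have h2 : Ad (m := m) (c.symm e) Y = Y := by
    rw [hc, he, symm_oneChart, Ad_one]; rfl
  simp only [ContinuousLinearMap.comp_apply, add_apply,
    ContinuousLinearMap.apply_apply, ContinuousLinearMap.flip_apply, h2, h1,
    ContinuousLinearMap.inl_apply, ContinuousLinearMap.inr_apply] at hkeyX
  rw [bracket_eq_chart, (hLZ Y).fderiv, (hLZ X).fderiv]
  simp only [ContinuousLinearMap.comp_apply, ContinuousLinearMap.apply_apply,
    ContinuousLinearMap.inl_apply]
  -- Symmetry of the second derivative matches the remaining mixed terms.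
  rw [hkeyX, hsymm (0, X) (Y, 0)]
  abel

omit [LieGroup (𝓡 m) ∞ G] in
theorem eventually_symm_chart_one :
    ∀ᶠ g : G in 𝓝 1, (extChartAt (𝓡 m) (1 : G)).symm (extChartAt (𝓡 m) (1 : G) g) = g := by
  filter_upwards [extChartAt_source_mem_nhds (I := 𝓡 m) (1 : G)] with g hg
  exact (extChartAt (𝓡 m) (1 : G)).left_inv hg

/-- The chart gives continuity at `1`; multiplicativity, `Ad h = Ad g ∘ Ad(g⁻¹h)`, spreads it over
`G`. -/
theorem continuous_Ad : Continuous (Ad (m := m) : G → V →L[ℝ] V) := by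
  have := topologicalGroup_of_lieGroup (𝓡 m) ∞ (G := G)
  have h1 : ContinuousAt (Ad (m := m) : G → V →L[ℝ] V) 1 := by
    have h2 : ContinuousAt (fun g : G ↦ Ad (m := m)
        ((extChartAt (𝓡 m) (1 : G)).symm (extChartAt (𝓡 m) (1 : G) g))) 1 :=
      ContinuousAt.comp (f := extChartAt (𝓡 m) (1 : G))
        (contDiffAt_Ad_symm_chart oneChart_mem).continuousAt (continuousAt_extChartAt 1)
    refine h2.congr ?_
    filter_upwards [eventually_symm_chart_one (m := m) (G := G)] with g hg
    rw [hg]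
  refine continuous_iff_continuousAt.2 fun g ↦ ?_
  have h2 : (Ad (m := m) : G → V →L[ℝ] V) = fun h ↦ (Ad g).comp (Ad (g⁻¹ * h)) := by
    funext h
    rw [← Ad_mul, mul_inv_cancel_left]
  rw [h2]
  have h3 : ContinuousAt (fun h : G ↦ Ad (m := m) (g⁻¹ * h)) g :=
    ContinuousAt.comp (g := (Ad (m := m) : G → V →L[ℝ] V)) (f := fun h : G ↦ g⁻¹ * h) (by rwa [inv_mul_cancel]) (by fun_prop)
  exact (ContinuousLinearMap.compL ℝ V V V (Ad g)).continuous.continuousAt.comp h3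

variable [T2Space G]

theorem hasDerivAt_Ad_gexp_zero (X Y : V) :
    HasDerivAt (fun t : ℝ ↦ Ad (gexp G (t • X)) Y) (bracket G X Y) 0 := by
  set c := extChartAt (𝓡 m) (1 : G) with hc
  have h0 : gexp G ((0 : ℝ) • X) = 1 := by rw [zero_smul, gexp_zero]
  have hmd := mdiff_of_smooth (contMDiff_gexp_smul (G := G) X 0)
  have h1 : HasDerivAt (fun t : ℝ ↦ c (gexp G (t • X))) X 0 := by
    have := hasDerivAt_chart (c := 1) hmd (by rw [h0]; exact mem_extChartAt_source 1)
    rwa [dAt_gexp_smul, h0, dAt_chart_self] at this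
  have hA : HasFDerivAt (fun z : V ↦ Ad (m := m) (c.symm z)) (fderiv ℝ
      (fun z : V ↦ Ad (m := m) (c.symm z)) (oneChart m G)) (c (gexp G ((0 : ℝ) • X))) := by
    rw [h0]
    exact ((contDiffAt_Ad_symm_chart (m := m) (G := G) oneChart_mem).differentiableAt
      (by simp)).hasFDerivAt
  have h2 := (ContinuousLinearMap.apply ℝ V Y).hasFDerivAt.comp_hasDerivAt (0 : ℝ)
    (hA.comp_hasDerivAt (0 : ℝ) h1)
  rw [ContinuousLinearMap.apply_apply, fderiv_Ad_symm_chart] at h2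
  refine h2.congr_of_eventuallyEq ?_
  have h3 : Tendsto (fun t : ℝ ↦ gexp G (t • X)) (𝓝 0) (𝓝 1) := by
    rw [← h0]
    exact (contMDiff_gexp_smul X).continuous.tendsto 0
  filter_upwards [h3.eventually (eventually_symm_chart_one (m := m) (G := G))] with t ht
  simp only [Function.comp_apply, ContinuousLinearMap.apply_apply]
  rw [hc, ht]

theorem hasDerivAt_Ad_gexp (X Y : V) (t : ℝ) :
    HasDerivAt (fun t : ℝ ↦ Ad (gexp G (t • X)) Y) (bracket G X (Ad (gexp G (t • X)) Y)) t := by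
  have h1 : (fun s : ℝ ↦ Ad (gexp G (s • X)) Y) =
      fun s ↦ Ad (gexp G ((s - t) • X)) (Ad (gexp G (t • X)) Y) := by
    funext s
    rw [← Ad_mul_apply, ← gexp_add_smul, sub_add_cancel]
  rw [h1]
  have h2 := hasDerivAt_Ad_gexp_zero (G := G) X (Ad (gexp G (t • X)) Y)
  rw [← sub_self t] at h2
  exact h2.comp_sub_const t t

/-- The curve `t ↦ g exp(tX) g⁻¹` is a smooth homomorphism with initial velocity `Ad g X`. -/
theorem conj_gexp (g : G) (X : V) : g * gexp G X * g⁻¹ = gexp G (Ad g X) := by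
  have h := eq_gexp (γ := fun t : ℝ ↦ g * gexp G (t • X) * g⁻¹) (X := Ad g X)
    ((smooth_conj g).comp (contMDiff_gexp_smul X))
    (fun s t ↦ by rw [gexp_add_smul]; group) (by simp [gexp_zero]) (by
      have hmd := mdiff_of_smooth (contMDiff_gexp_smul (G := G) X 0)
      have := dAt_comp (E := ℝ) (E' := V) (E'' := V) (g := fun h : G ↦ g * h * g⁻¹)
        (f := fun t : ℝ ↦ gexp G (t • X)) 0 (mdiff_conj g _) hmd
      rw [this, ContinuousLinearMap.comp_apply, dAt_gexp_smul, zero_smul, gexp_zero]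
      rfl) 1
  simpa using h

/-- Differentiate `Ad g (Ad(exp tX) Y) = Ad(exp(t Ad g X)) (Ad g Y)` at `t = 0`. -/
theorem Ad_bracket (g : G) (X Y : V) : Ad g (bracket G X Y) = bracket G (Ad g X) (Ad g Y) := by
  have h1 := (Ad (m := m) g).hasFDerivAt.comp_hasDerivAt (0 : ℝ) (hasDerivAt_Ad_gexp_zero (G := G) X Y)
  have h2 := hasDerivAt_Ad_gexp_zero (G := G) (Ad g X) (Ad g Y)
  refine h1.unique (h2.congr_of_eventuallyEq (Eventually.of_forall fun t ↦ ?_))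
  simp only [Function.comp_apply]
  rw [← map_smul, ← conj_gexp, ← Ad_mul_apply, ← Ad_mul_apply, inv_mul_cancel_right]

theorem Ad_gexp_of_bracket_eq {X v : V} {a : ℝ} (h : bracket G X v = a • v) :
    Ad (gexp G X) v = Real.exp a • v := by
  -- `Ad (exp (-t X)) (exp (t a) v)` is constant
  have h1 : ∀ t : ℝ, HasDerivAt (fun t : ℝ ↦ Ad (gexp G (t • X)) v)
      (a • Ad (gexp G (t • X)) v) t := by
    intro t
    have h2 := hasDerivAt_Ad_gexp (G := G) X v t
    -- Since `[X, X] = 0`, the flow fixes `X`. Applying `Ad (exp tX)` to `[X, v] = a v` then shows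
    -- that `Ad(exp tX) v` remains an eigenvector of `ad X`.
    have h3 : Ad (gexp G (t • X)) X = X := by
      have h5 := hasDerivAt_Ad_gexp_zero (G := G) X X
      have h6 : ∀ s : ℝ, HasDerivAt (fun s : ℝ ↦ Ad (gexp G (s • X)) X) 0 s := by
        intro s
        have h7 : bracket G X X = 0 := lie_self (L := GroupLieAlgebra (𝓡 m) G) X
        have h8 : (fun r : ℝ ↦ Ad (gexp G (r • X)) X) =
            fun r ↦ Ad (gexp G (s • X)) (Ad (gexp G ((r - s) • X)) X) := by
          funext r
          rw [← Ad_mul_apply, ← gexp_add_smul, add_sub_cancel]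
        rw [h8]
        rw [h7, ← sub_self s] at h5
        have := (Ad (m := m) (gexp G (s • X))).hasFDerivAt.comp_hasDerivAt s (h5.comp_sub_const s s)
        rwa [map_zero] at this
      have h9 := is_const_of_deriv_eq_zero (fun s ↦ (h6 s).differentiableAt)
        (fun s ↦ (h6 s).deriv) t 0
      simpa [gexp_zero, Ad_one] using h9
    have h4 : bracket G X (Ad (gexp G (t • X)) v) = a • Ad (gexp G (t • X)) v := by
      have := Ad_bracket (gexp G (t • X)) X v
      rw [h3, h, map_smul] at this
      exact this.symm
    rwa [h4] at h2
  have h2 : ∀ t : ℝ, HasDerivAt (fun t : ℝ ↦ Real.exp (-(t * a)) • Ad (gexp G (t • X)) v) 0 t := by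
    intro t
    have h3 : HasDerivAt (fun t : ℝ ↦ Real.exp (-(t * a))) (Real.exp (-(t * a)) * (-a)) t := by
      have := ((hasDerivAt_id t).mul_const a).neg.exp
      simpa using this
    have := h3.smul (h1 t)
    refine this.congr_deriv ?_
    rw [smul_smul, ← add_smul]
    simp
  have h3 := is_const_of_deriv_eq_zero (fun s ↦ (h2 s).differentiableAt)
        (fun s ↦ (h2 s).deriv) 1 0
  simp only [one_mul, one_smul, zero_mul, neg_zero, Real.exp_zero, zero_smul, gexp_zero, Ad_one,
    ContinuousLinearMap.id_apply] at h3
  conv_rhs => rw [← h3]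
  rw [smul_smul, ← Real.exp_add, add_neg_cancel, Real.exp_zero, one_smul]

end Adjoint

end SymmetricSpace

namespace SymmetricSpace

open Set Filter Topology Module

/-! ### Cartan involutions, eigenbases and logarithms of positive automorphisms -/

section CartanInvolution

variable {𝔤 : Type*} [LieRing 𝔤] [LieAlgebra ℝ 𝔤] [FiniteDimensional ℝ 𝔤] {θ : 𝔤 →ₗ⁅ℝ⁆ 𝔤}

/-- A Cartan involution, as an automorphism. -/
def IsCartanInvolution.equiv (h : IsCartanInvolution θ) : 𝔤 ≃ₗ⁅ℝ⁆ 𝔤 :=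
  { θ with
    invFun := θ
    left_inv := h.involutive
    right_inv := h.involutive }

omit [FiniteDimensional ℝ 𝔤] in
theorem IsCartanInvolution.killing (h : IsCartanInvolution θ) (X Y : 𝔤) :
    killingForm ℝ 𝔤 (θ X) (θ Y) = killingForm ℝ 𝔤 X Y :=
  LieAlgebra.killingForm_of_equiv_apply h.equiv X Y

omit [FiniteDimensional ℝ 𝔤] in
theorem IsCartanInvolution.symm (h : IsCartanInvolution θ) (X Y : 𝔤) :
    killingForm ℝ 𝔤 X (θ Y) = killingForm ℝ 𝔤 Y (θ X) := by
  rw [← h.killing, h.involutive, LieModule.traceForm_comm]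

-- A vector `X` in the radical of the Killing form pairs to zero with `θ X`, so positivity forces `X
-- = 0`.
omit [FiniteDimensional ℝ 𝔤] in
theorem IsCartanInvolution.isKilling (h : IsCartanInvolution θ) : LieAlgebra.IsKilling ℝ 𝔤 := by
  refine ⟨(LieSubmodule.eq_bot_iff _).2 fun X hX ↦ ?_⟩
  by_contra hne
  have h1 := h.pos X hne
  have h2 := (LieIdeal.mem_killingCompl ℝ 𝔤 ⊤).1 hX (θ X) (LieSubmodule.mem_top _)
  rw [LieModule.traceForm_comm] at h2
  rw [h2] at h1
  simp at h1

/-- The inner product `-B(X, θ Y)`. -/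
@[reducible]
noncomputable def IsCartanInvolution.core (h : IsCartanInvolution θ) :
    InnerProductSpace.Core ℝ 𝔤 where
  inner X Y := -(killingForm ℝ 𝔤 X (θ Y))
  conj_inner_symm X Y := by
    rw [h.symm]
    rfl
  re_inner_nonneg X := by
    by_cases hX : X = 0
    · simp [hX]
    · exact (h.pos X hX).le
  add_left X Y Z := by
    rw [map_add, LinearMap.add_apply, neg_add]
  smul_left X Y r := by
    rw [map_smul, LinearMap.smul_apply, smul_eq_mul, conj_trivial, mul_neg]
  definite X hX := by
    by_contra hne
    exact (h.pos X hne).ne' hX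

/-- The spectral theorem for the inner product `-B(X, θ Y)`; `hS` is self-adjointness. -/
theorem IsCartanInvolution.exists_eigenbasis (h : IsCartanInvolution θ) (S : 𝔤 →ₗ[ℝ] 𝔤)
    (hS : ∀ X Y, killingForm ℝ 𝔤 (S X) (θ Y) = killingForm ℝ 𝔤 X (θ (S Y))) :
    ∃ (v : Basis (Fin (finrank ℝ 𝔤)) ℝ 𝔤) (a : Fin (finrank ℝ 𝔤) → ℝ), ∀ i, S (v i) = a i • v i := by
  let : NormedAddCommGroup 𝔤 := h.core.toNormedAddCommGroup
  let : InnerProductSpace ℝ 𝔤 := InnerProductSpace.ofCore h.core.toCore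
  have hsymm : S.IsSymmetric := fun X Y ↦ congrArg Neg.neg (hS X Y)
  exact ⟨(hsymm.eigenvectorBasis rfl).toBasis, hsymm.eigenvalues rfl, fun i ↦ by
    rw [OrthonormalBasis.coe_toBasis]
    exact hsymm.apply_eigenvectorBasis rfl i⟩

omit [FiniteDimensional ℝ 𝔤] in
theorem eigenvalue_eq_of_repr_ne_zero {S : 𝔤 →ₗ[ℝ] 𝔤} {ι : Type*} [Finite ι] {v : Basis ι ℝ 𝔤}
    {a : ι → ℝ} (hv : ∀ i, S (v i) = a i • v i) {w : 𝔤} {c : ℝ} (hw : S w = c • w) {i : ι}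
    (hi : v.repr w i ≠ 0) : a i = c := by
  have := Fintype.ofFinite ι
  have h1 : v.repr (S w) i = a i * v.repr w i := by
    have h2 : (v.coord i).comp S = a i • v.coord i := by
      classical
      refine v.ext fun j ↦ ?_
      simp only [LinearMap.comp_apply, hv, map_smul, Basis.coord_apply, LinearMap.smul_apply,
        Basis.repr_self, Finsupp.single_apply, smul_eq_mul]
      split_ifs with hij
      · rw [hij]
      · simp
    exact LinearMap.congr_fun h2 w
  rw [hw, map_smul, Finsupp.smul_apply, smul_eq_mul] at h1
  exact (mul_right_cancel₀ hi h1).symm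

-- An eigenvector for `c` only has components along basis vectors with the same eigenvalue `c`. Thus
-- the functional calculus `T = f(S)`, defined in one eigenbasis, holds on every eigenvector.
omit [FiniteDimensional ℝ 𝔤] in
theorem apply_eq_of_eigenbasis {S T : 𝔤 →ₗ[ℝ] 𝔤} {ι : Type*} [Finite ι] {v : Basis ι ℝ 𝔤}
    {a : ι → ℝ} (hv : ∀ i, S (v i) = a i • v i) {f : ℝ → ℝ} (hT : ∀ i, T (v i) = f (a i) • v i)
    {w : 𝔤} {c : ℝ} (hw : S w = c • w) : T w = f c • w := by
  have := Fintype.ofFinite ι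
  conv_lhs => rw [← v.sum_repr w]
  conv_rhs => rw [← v.sum_repr w]
  rw [map_sum, Finset.smul_sum]
  refine Finset.sum_congr rfl fun i _ ↦ ?_
  rw [map_smul, hT, smul_comm]
  by_cases hi : v.repr w i = 0
  · simp [hi]
  · rw [eigenvalue_eq_of_repr_ne_zero hv hw hi]

/-- `Φ` is the exponential of the diagonalizable endomorphism `ad X`. -/
def IsExpAd (X : 𝔤) (Φ : 𝔤 →ₗ[ℝ] 𝔤) : Prop :=
  ∀ (v : 𝔤) (a : ℝ), ⁅X, v⁆ = a • v → Φ v = Real.exp a • v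

-- Self-adjointness of `ad X` for `X` in 𝔭: the sign from moving the bracket across the invariant
-- form cancels that of `θ X = -X`.
omit [FiniteDimensional ℝ 𝔤] in
theorem killingForm_ad_symm {X : 𝔤} (hX : θ X = -X) (Y Z : 𝔤) :
    killingForm ℝ 𝔤 ⁅X, Y⁆ (θ Z) = killingForm ℝ 𝔤 Y (θ ⁅X, Z⁆) := by
  rw [LieModule.traceForm_apply_lie_apply', LieHom.map_lie, hX, neg_lie, map_neg]

theorem IsCartanInvolution.exists_eigenbasis_ad (h : IsCartanInvolution θ) {X : 𝔤} (hX : θ X = -X) :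
    ∃ (v : Basis (Fin (finrank ℝ 𝔤)) ℝ 𝔤) (a : Fin (finrank ℝ 𝔤) → ℝ), ∀ i, ⁅X, v i⁆ = a i • v i :=
  h.exists_eigenbasis (LieAlgebra.ad ℝ 𝔤 X) (killingForm_ad_symm hX)

theorem IsCartanInvolution.ext_of_lie_eq (h : IsCartanInvolution θ) {X Y : 𝔤}
    (hXY : ∀ Z : 𝔤, ⁅X, Z⁆ = ⁅Y, Z⁆) : X = Y := by
  have := h.isKilling
  rw [← sub_eq_zero, ← LieDerivation.IsKilling.ad_apply_eq_zero_iff ℝ 𝔤]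
  ext Z
  simp [hXY]

theorem IsExpAd.linear_eq (h : IsCartanInvolution θ) {X : 𝔤} (hX : θ X = -X) {Φ Ψ : 𝔤 →ₗ[ℝ] 𝔤}
    (h1 : IsExpAd X Φ) (h2 : IsExpAd X Ψ) : Φ = Ψ := by
  obtain ⟨v, a, hv⟩ := h.exists_eigenbasis_ad hX
  exact v.ext fun i ↦ by rw [h1 _ _ (hv i), h2 _ _ (hv i)]

/-- Both `ad X` and `ad Y` are the real logarithm of `Φ`, so they agree; the adjoint representation
is faithful because the Killing form is nondegenerate. -/
theorem IsExpAd.unique (h : IsCartanInvolution θ) {X Y : 𝔤} (hX : θ X = -X) (hY : θ Y = -Y)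
    {Φ : 𝔤 →ₗ[ℝ] 𝔤} (h1 : IsExpAd X Φ) (h2 : IsExpAd Y Φ) : X = Y := by
  obtain ⟨v, a, hv⟩ := h.exists_eigenbasis_ad hX
  obtain ⟨w, b, hw⟩ := h.exists_eigenbasis_ad hY
  have key : ∀ i, ⁅X, v i⁆ = ⁅Y, v i⁆ := by
    intro i
    have h3 := apply_eq_of_eigenbasis (S := Φ) (T := LieAlgebra.ad ℝ 𝔤 Y)
      (fun j ↦ h2 _ _ (hw j)) (f := Real.log)
      (fun j ↦ by rw [Real.log_exp]; exact hw j) (h1 _ _ (hv i))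
    rw [Real.log_exp, ← hv i] at h3
    exact h3.symm
  refine h.ext_of_lie_eq fun Z ↦ ?_
  have : (LieAlgebra.ad ℝ 𝔤 X) = (LieAlgebra.ad ℝ 𝔤 Y) := v.ext key
  exact LinearMap.congr_fun this Z

omit [FiniteDimensional ℝ 𝔤] in
theorem trace_eq_sum_of_eigenbasis {S : 𝔤 →ₗ[ℝ] 𝔤} {ι : Type*} [Fintype ι] {v : Basis ι ℝ 𝔤}
    {a : ι → ℝ} (hv : ∀ i, S (v i) = a i • v i) : LinearMap.trace ℝ 𝔤 S = ∑ i, a i := by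
  classical
  rw [LinearMap.trace_eq_matrix_trace ℝ v, Matrix.trace]
  refine Finset.sum_congr rfl fun i _ ↦ ?_
  rw [Matrix.diag_apply, LinearMap.toMatrix_apply, hv]
  simp

/-- In an eigenbasis of `ad X` the left side is `∑ aᵢ²` and the right side `2 ∑ (exp aᵢ +
exp(-aᵢ))`; compare term by term. This is what will keep the polar part locally bounded. -/
theorem IsExpAd.bound (h : IsCartanInvolution θ) {X : 𝔤} (hX : θ X = -X) {Φ Ψ : 𝔤 →ₗ[ℝ] 𝔤}
    (h1 : IsExpAd X Φ) (h2 : IsExpAd (-X) Ψ) :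
    -(killingForm ℝ 𝔤 X (θ X)) ≤ 2 * (LinearMap.trace ℝ 𝔤 Φ + LinearMap.trace ℝ 𝔤 Ψ) := by
  obtain ⟨v, a, hv⟩ := h.exists_eigenbasis_ad hX
  rw [trace_eq_sum_of_eigenbasis (fun i ↦ h1 _ _ (hv i)),
    trace_eq_sum_of_eigenbasis (a := fun i ↦ Real.exp (-a i))
      (fun i ↦ h2 (v i) (-a i) (by rw [neg_lie, hv, neg_smul])), hX, map_neg, neg_neg,
    killingForm_apply_apply,
    trace_eq_sum_of_eigenbasis (v := v) (a := fun i ↦ a i * a i) (fun i ↦ by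
      simp [hv, smul_smul]), ← Finset.sum_add_distrib, Finset.mul_sum]
  refine Finset.sum_le_sum fun i _ ↦ ?_
  have h3 := Real.quadratic_le_exp_of_nonneg (abs_nonneg (a i))
  rcases abs_cases (a i) with ⟨h4, h5⟩ | ⟨h4, h5⟩ <;> rw [h4] at h3
  · have := Real.exp_pos (-a i)
    nlinarith
  · have := Real.exp_pos (a i)
    nlinarith

-- Automorphisms preserve the Killing form, so the transpose of `φ` for `-B(·, θ·)` is `θ φ⁻¹ θ`.
omit [FiniteDimensional ℝ 𝔤] in
theorem IsCartanInvolution.killing_adjoint (h : IsCartanInvolution θ) (φ : 𝔤 ≃ₗ⁅ℝ⁆ 𝔤) (X Y : 𝔤) :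
    killingForm ℝ 𝔤 (θ (φ.symm (θ X))) (θ Y) = killingForm ℝ 𝔤 X (θ (φ Y)) := by
  rw [h.killing, ← LieAlgebra.killingForm_of_equiv_apply φ, φ.apply_symm_apply, ← h.killing,
    h.involutive]

/-- The logarithm of `φᵀ φ`, for an automorphism `φ`, is `ad X` for some `X ∈ 𝔭`. -/
theorem IsCartanInvolution.exists_log (h : IsCartanInvolution θ) (φ : 𝔤 ≃ₗ⁅ℝ⁆ 𝔤) :
    ∃ X : 𝔤, θ X = -X ∧ ∀ (v : 𝔤) (a : ℝ), ⁅X, v⁆ = a • v →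
      θ (φ.symm (θ (φ v))) = Real.exp a • v := by
  have := h.isKilling
  let T : 𝔤 →ₗ⁅ℝ⁆ 𝔤 := θ.comp (φ.symm.toLieHom.comp (θ.comp φ.toLieHom))
  have hT : ∀ X, T X = θ (φ.symm (θ (φ X))) := fun X ↦ rfl
  obtain ⟨v, τ, hv⟩ := h.exists_eigenbasis T.toLinearMap fun X Y ↦ by
    change killingForm ℝ 𝔤 (θ (φ.symm (θ (φ X)))) (θ Y) =
      killingForm ℝ 𝔤 X (θ (θ (φ.symm (θ (φ Y)))))
    rw [h.killing_adjoint, h.involutive, ← LieAlgebra.killingForm_of_equiv_apply φ X,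
      φ.apply_symm_apply]
  -- `T` is `φᵀ φ`: the squared length of `φ (v i)` is `τ i` times that of `v i`.
  have hpos : ∀ i, 0 < τ i := by
    intro i
    have hne := v.ne_zero i
    have hne' : φ (v i) ≠ 0 := fun h0 ↦ hne (by simpa using congrArg φ.symm h0)
    have h1 := h.pos _ hne'
    rw [← h.killing_adjoint] at h1
    have h2 : θ (φ.symm (θ (φ (v i)))) = τ i • v i := hv i
    rw [h2, map_smul, LinearMap.smul_apply, smul_eq_mul, ← mul_neg] at h1
    exact pos_of_mul_pos_left h1 (h.pos _ hne).le
  let S : 𝔤 →ₗ[ℝ] 𝔤 := v.constr ℝ fun i ↦ Real.log (τ i) • v i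
  have hS : ∀ i, S (v i) = Real.log (τ i) • v i := fun i ↦ v.constr_basis ℝ _ i
  have hSw : ∀ (w : 𝔤) (c : ℝ), T w = c • w → S w = Real.log c • w := fun w c hw ↦
    apply_eq_of_eigenbasis (S := T.toLinearMap) hv hS hw
  -- `T` is an automorphism, so `⁅v i, v j⁆` is scaled by the product `τ i * τ j`. The logarithm
  -- turns this into the Leibniz rule.
  have hder : ∀ X Y, S ⁅X, Y⁆ = ⁅X, S Y⁆ - ⁅Y, S X⁆ := by
    have : (LieModule.toEnd ℝ 𝔤 𝔤 : 𝔤 →ₗ[ℝ] 𝔤 →ₗ[ℝ] 𝔤).compr₂ S =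
        (LieModule.toEnd ℝ 𝔤 𝔤 : 𝔤 →ₗ[ℝ] 𝔤 →ₗ[ℝ] 𝔤).compl₂ S +
          (LieModule.toEnd ℝ 𝔤 𝔤 : 𝔤 →ₗ[ℝ] 𝔤 →ₗ[ℝ] 𝔤).comp S := by
      refine v.ext fun i ↦ v.ext fun j ↦ ?_
      simp only [LinearMap.compr₂_apply, LinearMap.add_apply, LinearMap.compl₂_apply,
        LinearMap.comp_apply, LieHom.coe_toLinearMap, LieModule.toEnd_apply_apply]
      rw [hSw ⁅v i, v j⁆ (τ i * τ j), hS, hS, smul_lie, lie_smul, ← add_smul,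
        Real.log_mul (hpos i).ne' (hpos j).ne', add_comm]
      have h1 : T (v i) = τ i • v i := hv i
      have h2 : T (v j) = τ j • v j := hv j
      rw [LieHom.map_lie, h1, h2, smul_lie, lie_smul, smul_smul]
    intro X Y
    have h1 := LinearMap.congr_fun₂ this X Y
    simp only [LinearMap.compr₂_apply, LinearMap.add_apply, LinearMap.compl₂_apply,
        LinearMap.comp_apply, LieHom.coe_toLinearMap, LieModule.toEnd_apply_apply] at h1
    rw [h1, ← lie_skew Y, sub_neg_eq_add]
  -- Nondegeneracy of the Killing form makes every derivation inner.
  obtain ⟨X, hX⟩ := LieDerivation.IsKilling.exists_eq_ad (⟨S, hder⟩ : LieDerivation ℝ 𝔤 𝔤)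
  have hX' : ∀ Z, ⁅X, Z⁆ = S Z := fun Z ↦ by
    have := DFunLike.congr_fun hX Z
    simpa using this
  refine ⟨X, ?_, ?_⟩
  -- Conjugation by `θ` inverts `T`, so it negates the logarithm `S = ad X`; this puts `X` in 𝔭.
  · have hθS : θ.toLinearMap.comp S = -(S.comp θ.toLinearMap) := by
      refine v.ext fun i ↦ ?_
      have h1 : T (θ (v i)) = (τ i)⁻¹ • θ (v i) := by
        have h2 : T (θ (T (v i))) = θ (v i) := by
          rw [hT, hT]
          simp [h.involutive]
        have h3 : T (v i) = τ i • v i := hv i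
        rw [h3, map_smul, map_smul] at h2
        exact (inv_smul_smul₀ (hpos i).ne' _).symm.trans (congrArg ((τ i)⁻¹ • ·) h2)
      have h4 := hSw _ _ h1
      simp only [LinearMap.comp_apply, LinearMap.neg_apply, LieHom.coe_toLinearMap]
      rw [h4, hS, map_smul, Real.log_inv, neg_smul, neg_neg]
    refine h.ext_of_lie_eq fun Z ↦ ?_
    have h1 := LinearMap.congr_fun hθS (θ Z)
    simp only [LinearMap.comp_apply, LinearMap.neg_apply, LieHom.coe_toLinearMap,
      h.involutive] at h1
    rw [neg_lie, hX', ← h1, ← hX', LieHom.map_lie, h.involutive]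
  · intro w a hw
    have h1 := apply_eq_of_eigenbasis (S := S) (T := T.toLinearMap) hS (f := Real.exp)
      (fun i ↦ by rw [Real.exp_log (hpos i)]; exact hv i) (w := w) (c := a) (by rw [← hX', hw])
    exact h1

-- The `-1` eigenspace of `θ` is orthogonal to its fixed space for the Killing form, which `φ`
-- preserves. If `φ` and its inverse preserve the fixed space, `φ` preserves the other eigenspace
-- too.
omit [FiniteDimensional ℝ 𝔤] in
theorem IsCartanInvolution.commute_of_preserves (h : IsCartanInvolution θ) (φ : 𝔤 ≃ₗ⁅ℝ⁆ 𝔤)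
    (h1 : ∀ X, θ X = X → θ (φ X) = φ X) (h2 : ∀ X, θ X = X → θ (φ.symm X) = φ.symm X) (X : 𝔤) :
    θ (φ X) = φ (θ X) := by
  have hp : ∀ Y, θ Y = -Y → θ (φ Y) = -φ Y := by
    intro Y hY
    -- Twice the `θ`-fixed component of `φ Y`. It is orthogonal to itself, and the form is definite
    -- on fixed vectors.
    set A := φ Y + θ (φ Y) with hA
    have hAθ : θ A = A := by rw [hA, map_add, h.involutive, add_comm]
    have hort : ∀ W, θ W = W → killingForm ℝ 𝔤 Y W = 0 := by
      intro W hW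
      have := h.killing Y W
      rw [hY, hW, map_neg, LinearMap.neg_apply] at this
      linarith
    have h3 : killingForm ℝ 𝔤 (φ Y) A = 0 := by
      rw [← φ.apply_symm_apply A, LieAlgebra.killingForm_of_equiv_apply]
      exact hort _ (h2 A hAθ)
    have h4 : killingForm ℝ 𝔤 (θ (φ Y)) A = 0 := by
      rw [← h3, ← h.killing (φ Y) A, hAθ]
    have h5 : killingForm ℝ 𝔤 A A = 0 := by
      have : killingForm ℝ 𝔤 A = killingForm ℝ 𝔤 (φ Y) + killingForm ℝ 𝔤 (θ (φ Y)) := map_add _ _ _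
      rw [this, LinearMap.add_apply, h3, h4, add_zero]
    have h6 : A = 0 := by
      by_contra hne
      have := h.pos A hne
      rw [hAθ, h5] at this
      simp at this
    exact eq_neg_of_add_eq_zero_right h6
  have h3 : θ (X + θ X) = X + θ X := by rw [map_add, h.involutive, add_comm]
  have h4 : θ (X - θ X) = -(X - θ X) := by rw [map_sub, h.involutive, neg_sub]
  have h5 := h1 _ h3
  have h6 := hp _ h4
  rw [map_add, map_add] at h5
  rw [map_sub, map_sub] at h6
  have h7 : (2 : ℝ) • θ (φ X) = (2 : ℝ) • φ (θ X) := by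
    rw [two_smul, two_smul]
    calc θ (φ X) + θ (φ X) = (θ (φ X) + θ (φ (θ X))) + (θ (φ X) - θ (φ (θ X))) := by abel
      _ = (φ X + φ (θ X)) + -(φ X - φ (θ X)) := by rw [h5, h6]
      _ = _ := by abel
  exact smul_right_injective 𝔤 (two_ne_zero (α := ℝ)) h7

end CartanInvolution

end SymmetricSpace

namespace SymmetricSpace

open Set Filter Topology Module

/-! ### Polar decomposition of the adjoint action -/

section Polar

variable {m : ℕ} {G : Type*} [TopologicalSpace G] [ChartedSpace (EuclideanSpace ℝ (Fin m)) G]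
  [Group G]

local notation "V" => EuclideanSpace ℝ (Fin m)

instance finiteDimensional_groupLieAlgebra : FiniteDimensional ℝ (GroupLieAlgebra (𝓡 m) G) :=
  inferInstanceAs (FiniteDimensional ℝ V)

variable [LieGroup (𝓡 m) ∞ G]

/-- `Φ` is the exponential of the diagonalizable endomorphism `ad X`, on the model space. -/
def IsExp (G : Type*) [TopologicalSpace G] [ChartedSpace (EuclideanSpace ℝ (Fin m)) G]
    [Group G] (X : V) (Φ : V →ₗ[ℝ] V) : Prop :=
  ∀ (v : V) (a : ℝ), bracket G X v = a • v → Φ v = Real.exp a • v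

/-- A Lie algebra endomorphism as a continuous linear map of the model space. -/
noncomputable def onModel (θ : GroupLieAlgebra (𝓡 m) G →ₗ⁅ℝ⁆ GroupLieAlgebra (𝓡 m) G) :
    V →L[ℝ] V :=
  LinearMap.toContinuousLinearMap (θ.toLinearMap : V →ₗ[ℝ] V)

theorem onModel_bracket (θ : GroupLieAlgebra (𝓡 m) G →ₗ⁅ℝ⁆ GroupLieAlgebra (𝓡 m) G) (X Y : V) :
    onModel θ (bracket G X Y) = bracket G (onModel θ X) (onModel θ Y) :=
  LieHom.map_lie θ (X : GroupLieAlgebra (𝓡 m) G) (Y : GroupLieAlgebra (𝓡 m) G)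

theorem bracket_neg (X Y : V) : bracket G (-X) Y = -bracket G X Y :=
  neg_lie (L := GroupLieAlgebra (𝓡 m) G) (M := GroupLieAlgebra (𝓡 m) G) X Y

theorem bracket_skew (X Y : V) : bracket G X Y = -bracket G Y X :=
  (lie_skew (L := GroupLieAlgebra (𝓡 m) G) X Y).symm

theorem bracket_add (X Y Z : V) : bracket G X (Y + Z) = bracket G X Y + bracket G X Z :=
  lie_add (L := GroupLieAlgebra (𝓡 m) G) (M := GroupLieAlgebra (𝓡 m) G) X Y Z

variable [T2Space G]

/-- The adjoint action by automorphisms. -/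
noncomputable def AdEquiv (g : G) : GroupLieAlgebra (𝓡 m) G ≃ₗ⁅ℝ⁆ GroupLieAlgebra (𝓡 m) G :=
  { toFun := fun X ↦ Ad (m := m) g X
    map_add' := fun X Y ↦ map_add (Ad (m := m) g) X Y
    map_smul' := fun r X ↦ map_smul (Ad (m := m) g) r X
    map_lie' := fun {X Y} ↦ Ad_bracket (m := m) g X Y
    invFun := fun X ↦ Ad (m := m) g⁻¹ X
    left_inv := fun X ↦ Ad_inv_apply (m := m) g X
    right_inv := fun X ↦ Ad_apply_inv (m := m) g X }

theorem isExp_Ad_gexp (X : V) : IsExp G X (Ad (gexp G X)).toLinearMap :=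
  fun _ _ h ↦ Ad_gexp_of_bracket_eq h

variable {θ : GroupLieAlgebra (𝓡 m) G →ₗ⁅ℝ⁆ GroupLieAlgebra (𝓡 m) G}
  (h : IsCartanInvolution θ)

include h

omit [T2Space G] in
theorem onModel_onModel (X : V) : onModel θ (onModel θ X) = X := h.involutive X

omit [T2Space G] in
theorem IsExp.linear_eq {X : V} (hX : onModel θ X = -X) {Φ Ψ : V →ₗ[ℝ] V}
    (h1 : IsExp G X Φ) (h2 : IsExp G X Ψ) : Φ = Ψ :=
  IsExpAd.linear_eq h hX h1 h2

omit [T2Space G] in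
theorem IsExp.unique {X Y : V} (hX : onModel θ X = -X) (hY : onModel θ Y = -Y) {Φ : V →ₗ[ℝ] V}
    (h1 : IsExp G X Φ) (h2 : IsExp G Y Φ) : X = Y :=
  IsExpAd.unique h hX hY h1 h2

omit [T2Space G] in
theorem eq_zero_of_bracket {X : V} (hX : ∀ Y : V, bracket G X Y = 0) : X = 0 :=
  h.ext_of_lie_eq fun Z ↦ (hX Z).trans (zero_lie Z).symm

-- Compactness of the unit sphere compares the inner product of the Cartan involution with the
-- Euclidean norm, and the trace bound applies to the former.
omit [T2Space G] in
theorem exists_norm_sq_le : ∃ C : ℝ, 0 < C ∧ ∀ (X : V) (Φ Ψ : V →ₗ[ℝ] V), onModel θ X = -X →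
    IsExp G X Φ → IsExp G (-X) Ψ →
      ‖X‖ ^ 2 ≤ C * (LinearMap.trace ℝ V Φ + LinearMap.trace ℝ V Ψ) := by
  let B : V →ₗ[ℝ] V →ₗ[ℝ] ℝ := killingForm ℝ (GroupLieAlgebra (𝓡 m) G)
  let q : V → ℝ := fun X ↦ -(B X (onModel θ X))
  have hq : Continuous q := by
    have h1 : q = fun X ↦ -(LinearMap.toContinuousBilinearMap B X (onModel θ X)) := rfl
    rw [h1]
    fun_prop
  have hpos : ∀ X : V, X ≠ 0 → 0 < q X := h.pos
  have hle : ∀ (X : V) (Φ Ψ : V →ₗ[ℝ] V), onModel θ X = -X → IsExp G X Φ → IsExp G (-X) Ψ →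
      q X ≤ 2 * (LinearMap.trace ℝ V Φ + LinearMap.trace ℝ V Ψ) := fun X Φ Ψ hX h1 h2 ↦
    IsExpAd.bound h hX h1 h2
  obtain ⟨c, hc, hcq⟩ : ∃ c : ℝ, 0 < c ∧ ∀ X : V, c * ‖X‖ ^ 2 ≤ q X := by
    -- The sphere is empty exactly in dimension zero.
    rcases (Metric.sphere (0 : V) 1).eq_empty_or_nonempty with he | hne
    · refine ⟨1, one_pos, fun X ↦ ?_⟩
      have : X = 0 := by
        by_contra hX
        have : ‖X‖⁻¹ • X ∈ Metric.sphere (0 : V) 1 := by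
          rw [mem_sphere_zero_iff_norm, norm_smul, norm_inv, norm_norm,
            inv_mul_cancel₀ (norm_ne_zero_iff.2 hX)]
        rw [he] at this
        exact this
      rw [this]
      simp [q]
    · obtain ⟨u, hu, hmin⟩ := (isCompact_sphere (0 : V) 1).exists_isMinOn hne hq.continuousOn
      have hu0 : u ≠ 0 := by
        rintro rfl
        simp at hu
      refine ⟨q u, hpos u hu0, fun X ↦ ?_⟩
      by_cases hX : X = 0
      · rw [hX]
        simp [q]
      · have h1 : ‖X‖⁻¹ • X ∈ Metric.sphere (0 : V) 1 := by
          rw [mem_sphere_zero_iff_norm, norm_smul, norm_inv, norm_norm,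
            inv_mul_cancel₀ (norm_ne_zero_iff.2 hX)]
        have h2 : q u ≤ q (‖X‖⁻¹ • X) := hmin h1
        have h3 : q (‖X‖⁻¹ • X) = ‖X‖⁻¹ ^ 2 * q X := by
          simp only [q, map_smul, LinearMap.smul_apply, smul_eq_mul]
          ring
        rw [h3, inv_pow, ← div_eq_inv_mul, le_div_iff₀ (by positivity)] at h2
        exact h2
  refine ⟨2 / c, by positivity, fun X Φ Ψ hX h1 h2 ↦ ?_⟩
  have h3 := (hcq X).trans (hle X Φ Ψ hX h1 h2)
  rw [div_mul_eq_mul_div, le_div_iff₀ hc]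
  linarith

/-- Conjugating `exp(ad X)` by `θ` gives an exponential of `ad(θ X) = ad(-X)`, and this exponential
is determined on an eigenbasis. -/
theorem onModel_Ad_gexp {X : V} (hX : onModel θ X = -X) (v : V) :
    onModel θ (Ad (gexp G X) v) = Ad (gexp G (-X)) (onModel θ v) := by
  have hX' : onModel θ (-X) = -(-X) := by rw [map_neg, hX]
  have h1 : IsExp G (-X) ((onModel θ).comp ((Ad (gexp G X)).comp (onModel θ))).toLinearMap := by
    intro v a hv
    have h2 : bracket G X (onModel θ v) = a • onModel θ v := by
      rw [← map_smul, ← hv, onModel_bracket, map_neg, hX, neg_neg]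
    have h3 : onModel θ (Ad (gexp G X) (onModel θ v)) = Real.exp a • v := by
      rw [Ad_gexp_of_bracket_eq h2, map_smul, onModel_onModel h]
    exact h3
  have h2 : onModel θ (Ad (gexp G X) (onModel θ (onModel θ v))) =
      Ad (gexp G (-X)) (onModel θ v) :=
    LinearMap.congr_fun (IsExp.linear_eq h hX' h1 (isExp_Ad_gexp (-X))) (onModel θ v)
  rwa [onModel_onModel h] at h2

omit h [T2Space G] in
variable (θ) in
/-- `Ad(g)ᵀ Ad(g)`, the transpose taken for the inner product defined by the Cartan involution. -/
noncomputable def cartanSq (g : G) : V →L[ℝ] V :=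
  ((onModel θ).comp (Ad g⁻¹)).comp ((onModel θ).comp (Ad g))

omit h in
omit [T2Space G] in
theorem cartanSq_apply (g : G) (v : V) :
    cartanSq θ g v = onModel θ (Ad g⁻¹ (onModel θ (Ad g v))) := rfl

omit h [T2Space G] in
variable (θ) in
/-- The elements of `G` whose adjoint action commutes with the Cartan involution. -/
def Commutes (g : G) : Prop := ∀ v : V, onModel θ (Ad g v) = Ad g (onModel θ v)

omit h in
omit [T2Space G] in
theorem Commutes.inv {g : G} (hg : Commutes (m := m) θ g) : Commutes (m := m) θ g⁻¹ := by
  intro v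
  have := hg (Ad g⁻¹ v)
  rw [Ad_apply_inv] at this
  rw [this, Ad_inv_apply]

omit h in
omit [T2Space G] in
theorem Commutes.mul {g g' : G} (hg : Commutes (m := m) θ g) (hg' : Commutes (m := m) θ g') :
    Commutes (m := m) θ (g * g') := by
  intro v
  rw [Ad_mul_apply, Ad_mul_apply, hg, hg']

omit [T2Space G] h in
theorem two_smul_mem {X : V} (hX : onModel θ X = -X) : onModel θ ((2 : ℝ) • X) = -((2 : ℝ) • X) := by
  rw [map_smul, hX, smul_neg]

/-- The factor commuting with `θ` acts orthogonally and cancels; `Ad(exp X)` is self-adjoint, so its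
square remains. Hence `X` can be recovered from `cartanSq`. -/
theorem cartanSq_mul_gexp {g : G} (hg : Commutes (m := m) θ g) {X : V} (hX : onModel θ X = -X) :
    cartanSq θ (g * gexp G X) = Ad (gexp G ((2 : ℝ) • X)) := by
  ext1 v
  have h2 : (2 : ℝ) • X = (1 + 1 : ℝ) • X := by norm_num
  have hX' : onModel θ (-X) = -(-X) := by rw [map_neg, hX]
  rw [cartanSq_apply, Ad_mul_apply, hg, mul_inv_rev, Ad_mul_apply, Ad_inv_apply, ← gexp_neg,
    onModel_Ad_gexp h hX', neg_neg, onModel_onModel h, h2, gexp_add_smul, one_smul, Ad_mul_apply]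

/-- The polar decomposition of `Ad g`. Dividing by the positive square root of `Ad(g)ᵀ Ad(g)` leaves
an orthogonal automorphism, and for automorphisms orthogonality means commuting with `θ`. -/
theorem exists_commutes_mul_gexp (g : G) :
    ∃ X : V, onModel θ X = -X ∧ Commutes (m := m) θ (g * gexp G (-X)) := by
  obtain ⟨Y, hY, h1⟩ : ∃ Y : V, onModel θ Y = -Y ∧ IsExp G Y (cartanSq θ g).toLinearMap :=
    h.exists_log (AdEquiv (m := m) g)
  have h2 := IsExp.linear_eq h hY h1 (isExp_Ad_gexp Y)
  -- Halving the logarithm takes the square root.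
  let X : V := (1 / 2 : ℝ) • Y
  have hXY : (2 : ℝ) • X = Y := by
    change (2 : ℝ) • ((1 / 2 : ℝ) • Y) = Y
    rw [smul_smul]; norm_num
  have hX : onModel θ X = -X := by
    change onModel θ ((1 / 2 : ℝ) • Y) = -((1 / 2 : ℝ) • Y)
    rw [map_smul, hY, smul_neg]
  refine ⟨X, hX, fun v ↦ ?_⟩
  have h3 : ∀ w : V, onModel θ (Ad g⁻¹ (onModel θ (Ad g w))) =
      Ad (gexp G X) (Ad (gexp G X) w) := by
    intro w
    have h4 := LinearMap.congr_fun h2 w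
    have h5 : (2 : ℝ) • X = (1 + 1 : ℝ) • X := by norm_num
    have h6 : gexp G Y = gexp G X * gexp G X := by
      rw [← hXY, h5, gexp_add_smul, one_smul]
    have h7 : Ad (gexp G Y) w = Ad (gexp G X) (Ad (gexp G X) w) := by
      rw [h6, Ad_mul_apply]
    exact h4.trans h7
  have h4 : Ad g⁻¹ (onModel θ (Ad g (Ad (gexp G (-X)) v))) =
      onModel θ (Ad (gexp G X) v) := by
    rw [← onModel_onModel h (Ad g⁻¹ (onModel θ (Ad g (Ad (gexp G (-X)) v)))), h3, gexp_neg,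
      Ad_apply_inv]
  rw [Ad_mul_apply, Ad_mul_apply, ← onModel_Ad_gexp h hX, ← h4, Ad_apply_inv]

theorem gexp_unique {g g' : G} (hg : Commutes (m := m) θ g) (hg' : Commutes (m := m) θ g')
    {X X' : V} (hX : onModel θ X = -X) (hX' : onModel θ X' = -X')
    (heq : g * gexp G X = g' * gexp G X') : X = X' := by
  have h1 := cartanSq_mul_gexp h hg hX
  rw [heq, cartanSq_mul_gexp h hg' hX'] at h1
  have h2 := isExp_Ad_gexp (G := G) ((2 : ℝ) • X)
  rw [← h1] at h2
  have h3 := IsExp.unique h (two_smul_mem hX) (two_smul_mem hX') h2 (isExp_Ad_gexp _)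
  exact smul_right_injective V (two_ne_zero (α := ℝ)) h3

/-- Conjugation by `k` maps one-parameter subgroups of `K` into `K`, so `Ad k` preserves the fixed
space of `θ`, and likewise for `k⁻¹`. -/
theorem commutes_of_mem {K : Subgroup G}
    (hθK : ∀ X : GroupLieAlgebra (𝓡 m) G, θ X = X ↔ ∀ t : ℝ, lieExp (t • X) ∈ K) {k : G}
    (hk : k ∈ K) : Commutes (m := m) θ k := by
  have key : ∀ k ∈ K, ∀ X : V, onModel θ X = X → onModel θ (Ad k X) = Ad k X := by
    intro k hk X hX
    refine (hθK (Ad k X)).2 fun t ↦ ?_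
    have h1 : gexp G (t • X) ∈ K := (hθK X).1 hX t
    have h2 : gexp G (t • Ad k X) = k * gexp G (t • X) * k⁻¹ := by rw [conj_gexp, map_smul]
    have h3 : gexp G (t • Ad k X) ∈ K := by
      rw [h2]
      exact K.mul_mem (K.mul_mem hk h1) (K.inv_mem hk)
    exact h3
  exact h.commute_of_preserves (AdEquiv (m := m) k) (key k hk) (key k⁻¹ (K.inv_mem hk))

end Polar

end SymmetricSpace

namespace SymmetricSpace

open Set Filter Topology Module

/-! ### Cartan decomposition of the group and polar coordinates on the homogeneous space -/

section CartanDecomposition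

variable {m : ℕ} {G : Type*} [TopologicalSpace G] [ChartedSpace (EuclideanSpace ℝ (Fin m)) G]
  [Group G] [LieGroup (𝓡 m) ∞ G] [T2Space G]

local notation "V" => EuclideanSpace ℝ (Fin m)

variable {θ : GroupLieAlgebra (𝓡 m) G →ₗ⁅ℝ⁆ GroupLieAlgebra (𝓡 m) G}
  (h : IsCartanInvolution θ)

include h

theorem cartanSq_eq {g : G} {X : V} (hX : onModel θ X = -X)
    (hg : Commutes (m := m) θ (g * gexp G (-X))) :
    cartanSq θ g = Ad (gexp G ((2 : ℝ) • X)) := by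
  have := cartanSq_mul_gexp h hg hX
  rwa [mul_assoc, gexp_neg, inv_mul_cancel, mul_one] at this

/-- The `𝔭`-component of an element of `G`. -/
noncomputable def polarPart (g : G) : V := (exists_commutes_mul_gexp h g).choose

theorem onModel_polarPart (g : G) : onModel θ (polarPart h g) = -polarPart h g :=
  (exists_commutes_mul_gexp h g).choose_spec.1

theorem commutes_mul_polarPart (g : G) : Commutes (m := m) θ (g * gexp G (-polarPart h g)) :=
  (exists_commutes_mul_gexp (m := m) h g).choose_spec.2

theorem eq_polarPart {g : G} {Y : V} (hY : onModel θ Y = -Y)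
    (hg : ∀ v : V, cartanSq θ g v = Ad (gexp G ((2 : ℝ) • Y)) v) : Y = polarPart h g := by
  have h0 := onModel_polarPart h g
  have h1 := cartanSq_eq h h0 (commutes_mul_polarPart h g)
  have h2 := isExp_Ad_gexp (G := G) ((2 : ℝ) • Y)
  have h3 : Ad (m := m) (gexp G ((2 : ℝ) • Y)) = Ad (gexp G ((2 : ℝ) • polarPart h g)) := by
    rw [← h1]
    ext1 v
    exact (hg v).symm
  rw [h3] at h2
  exact smul_right_injective V (two_ne_zero (α := ℝ))
    (IsExp.unique h (two_smul_mem hY) (two_smul_mem h0) h2 (isExp_Ad_gexp _))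

/-- The polar part is locally bounded by traces that are continuous in `g`. Any cluster point as `g
→ g₀` satisfies the equation that characterizes the polar part of `g₀`. By compactness this forces
convergence. -/
theorem continuous_polarPart : Continuous (polarPart h) := by
  have := topologicalGroup_of_lieGroup (𝓡 m) ∞ (G := G)
  rw [continuous_iff_continuousAt]
  intro g₀
  obtain ⟨C, hC, hbound⟩ := exists_norm_sq_le h
  -- The inverse of `cartanSq θ g`; the bound needs the traces of the exponentials of both signs.
  let Ψ : G → V →L[ℝ] V := fun g ↦ (Ad g⁻¹).comp ((onModel θ).comp ((Ad g).comp (onModel θ)))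
  have hAd : Continuous (Ad (m := m) : G → V →L[ℝ] V) := continuous_Ad
  have hAd' : Continuous (fun g : G ↦ Ad (m := m) g⁻¹) := hAd.comp continuous_inv
  have hΨ : Continuous Ψ := hAd'.clm_comp (continuous_const.clm_comp (hAd.clm_comp continuous_const))
  have hS : Continuous (cartanSq (m := m) θ : G → V →L[ℝ] V) :=
    (continuous_const.clm_comp hAd').clm_comp (continuous_const.clm_comp hAd)
  let tr : (V →L[ℝ] V) →ₗ[ℝ] ℝ := (LinearMap.trace ℝ V).comp (ContinuousLinearMap.coeLM ℝ)
  have htr : Continuous tr := tr.continuous_of_finiteDimensional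
  have hb : ∀ g : G, ‖(2 : ℝ) • polarPart h g‖ ^ 2 ≤ C * (tr (cartanSq θ g) + tr (Ψ g)) := by
    intro g
    have h0 := onModel_polarPart h g
    have h1 := cartanSq_eq h h0 (commutes_mul_polarPart h g)
    have h2 : Ψ g = Ad (gexp G (-((2 : ℝ) • polarPart h g))) := by
      ext1 v
      have h3 : cartanSq θ g (Ψ g v) = v := by
        change onModel θ (Ad g⁻¹ (onModel θ (Ad g (Ad g⁻¹ (onModel θ (Ad g (onModel θ v))))))) = v
        rw [Ad_apply_inv, onModel_onModel h, Ad_inv_apply, onModel_onModel h]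
      rw [h1] at h3
      rw [gexp_neg]
      conv_rhs => rw [← h3]
      rw [Ad_inv_apply]
    refine hbound _ _ _ (two_smul_mem h0) ?_ ?_
    · rw [h1]
      exact isExp_Ad_gexp _
    · rw [h2]
      exact isExp_Ad_gexp _
  have hcont : Continuous fun g ↦ C * (tr (cartanSq θ g) + tr (Ψ g)) :=
    continuous_const.mul ((htr.comp hS).add (htr.comp hΨ))
  set R := C * (tr (cartanSq θ g₀) + tr (Ψ g₀)) + 1 with hR
  -- The inequality `4‖X‖² ≤ R` implies `‖X‖ ≤ R + 1`.
  refine (isCompact_closedBall (0 : V) (R + 1)).tendsto_nhds_of_unique_mapClusterPt ?_ ?_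
  · filter_upwards [hcont.continuousAt.eventually_lt continuousAt_const (lt_add_one _)] with g hg
    have h1 := (hb g).trans hg.le
    rw [norm_smul, mul_pow] at h1
    norm_num at h1
    rw [mem_closedBall_zero_iff]
    nlinarith [norm_nonneg (polarPart h g), sq_nonneg (‖polarPart h g‖ - 1)]
  · intro Y _ hY
    obtain ⟨U, hU, hUY⟩ := mapClusterPt_iff_ultrafilter.1 hY
    have hU' : Tendsto (fun g : G ↦ g) U (𝓝 g₀) := hU
    refine eq_polarPart h ?_ fun v ↦ ?_
    · have h1 : Tendsto (fun g ↦ onModel θ (polarPart h g)) U (𝓝 (onModel θ Y)) :=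
        ((onModel θ).continuous.tendsto Y).comp hUY
      have h2 : Tendsto (fun g ↦ -polarPart h g) U (𝓝 (-Y)) := hUY.neg
      simp only [onModel_polarPart] at h1
      exact tendsto_nhds_unique h1 h2
    · have h1 : Tendsto (fun g : G ↦ cartanSq θ g v) U (𝓝 (cartanSq θ g₀ v)) :=
        ((hS.clm_apply continuous_const).tendsto g₀).comp hU'
      have h2 : Continuous fun Y : V ↦ Ad (gexp G ((2 : ℝ) • Y)) v :=
        (hAd.comp (continuous_gexp.comp (continuous_const_smul (2 : ℝ)))).clm_apply continuous_const
      have h3 := (h2.tendsto Y).comp hUY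
      refine tendsto_nhds_unique h1 (h3.congr fun g ↦ ?_)
      change Ad (gexp G ((2 : ℝ) • polarPart h g)) v = _
      rw [cartanSq_eq h (onModel_polarPart h g) (commutes_mul_polarPart h g)]

omit [T2Space G] h in
theorem commutes_one : Commutes (m := m) θ (1 : G) := fun v ↦ by
  rw [Ad_one]
  rfl

omit [T2Space G] in
/-- Near `0` no `exp`-like chart point of a nonzero element of `𝔭` commutes with `θ`. -/
theorem eventually_eq_zero_of_commutes :
    ∀ᶠ Z : V in 𝓝 0, onModel θ Z = -Z →
      Commutes (m := m) θ ((extChartAt (𝓡 m) (1 : G)).symm (oneChart m G + Z)) → Z = 0 := by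
  let A : V → V →L[ℝ] V := fun z ↦ Ad (m := m) ((extChartAt (𝓡 m) (1 : G)).symm z)
  let A' : V →L[ℝ] V →L[ℝ] V := fderiv ℝ A (oneChart m G)
  have hA : HasFDerivAt (fun Z : V ↦ A (oneChart m G + Z)) A' 0 := by
    have h1 : HasFDerivAt A A' (oneChart m G + 0) := by
      rw [add_zero]
      exact ((contDiffAt_Ad_symm_chart oneChart_mem).differentiableAt (by simp)).hasFDerivAt
    have h2 : HasFDerivAt (fun Z : V ↦ oneChart m G + Z) (ContinuousLinearMap.id ℝ V) 0 :=
      (hasFDerivAt_id (0 : V)).const_add _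
    exact h1.comp (0 : V) h2
  let L : (V →L[ℝ] V) →L[ℝ] (V →L[ℝ] V) :=
    ContinuousLinearMap.compL ℝ V V V (onModel θ) -
      (ContinuousLinearMap.compL ℝ V V V).flip (onModel θ)
  -- `D` vanishes exactly when both conditions hold. Its derivative at `0` is `Z ↦ ([θ, ad Z], Z + θ
  -- Z)`; a vector of 𝔭 whose `ad` commutes with `θ` has `ad Z = 0`, so the derivative is injective.
  let D : V → (V →L[ℝ] V) × V := fun Z ↦ (L (A (oneChart m G + Z)), Z + onModel θ Z)
  let D' : V →L[ℝ] (V →L[ℝ] V) × V :=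
    (L.comp A').prod (ContinuousLinearMap.id ℝ V + onModel θ)
  have hD : HasFDerivAt D D' 0 :=
    (L.hasFDerivAt.comp (0 : V) hA).prodMk ((hasFDerivAt_id (0 : V)).add (onModel θ).hasFDerivAt)
  have hinj : Function.Injective D' := by
    rw [injective_iff_map_eq_zero]
    intro Z hZ
    have h1 : Z + onModel θ Z = 0 := congrArg Prod.snd hZ
    have hZ' : onModel θ Z = -Z := eq_neg_of_add_eq_zero_right h1
    have h2 : L (A' Z) = 0 := congrArg Prod.fst hZ
    have h3 : ∀ v : V, bracket G Z v = 0 := by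
      intro v
      have h4 : onModel θ (A' Z v) - A' Z (onModel θ v) = 0 :=
        congrArg (fun T : V →L[ℝ] V ↦ T v) h2
      have h5 : ∀ v, A' Z v = bracket G Z v := fun v ↦ fderiv_Ad_symm_chart Z v
      rw [h5, h5, onModel_bracket, hZ', bracket_neg] at h4
      have h6 : bracket G Z (onModel θ v) = 0 := by
        have h7 : (-2 : ℝ) • bracket G Z (onModel θ v) = 0 := by
          rw [← h4]; module
        exact (smul_eq_zero.1 h7).resolve_left (by norm_num)
      have h8 := congrArg (onModel θ) h6
      rw [onModel_bracket, onModel_onModel h, hZ', bracket_neg, map_zero, neg_eq_zero] at h8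
      exact h8
    exact eq_zero_of_bracket h h3
  -- In finite dimension injectivity is a lower bound on the derivative, which makes `0` an isolated
  -- zero of `D`.
  have hanti : ∃ C, AntilipschitzWith C D' := by
    obtain ⟨C, -, hC⟩ := D'.toLinearMap.exists_antilipschitzWith (LinearMap.ker_eq_bot.2 hinj)
    exact ⟨C, hC⟩
  have h1 := hD.eventually_ne (c := 0) hanti
  rw [eventually_nhdsWithin_iff] at h1
  filter_upwards [h1] with Z hZ hp hc
  by_contra h0
  refine hZ h0 ?_
  refine Prod.ext ?_ ?_
  · ext1 v
    change onModel θ (A (oneChart m G + Z) v) - A (oneChart m G + Z) (onModel θ v) = 0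
    rw [sub_eq_zero]
    exact hc v
  · change Z + onModel θ Z = 0
    rw [hp, add_neg_cancel]

variable {n : ℕ} {M : Type*} [TopologicalSpace M] [ChartedSpace (EuclideanSpace ℝ (Fin n)) M]
    [IsManifold (𝓡 n) ∞ M] [MulAction G M] [ContMDiffSMul (𝓡 m) (𝓡 n) ∞ G M]

local notation "W" => EuclideanSpace ℝ (Fin n)

omit h [LieGroup (𝓡 m) ∞ G] [T2Space G] [IsManifold (𝓡 n) ∞ M] in
variable (m n) in
theorem smooth_orbit (p : M) : ContMDiff (𝓡 m) (𝓡 n) ∞ (fun g : G ↦ g • p) :=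
  (contMDiff_smul (I := 𝓡 m) (I' := 𝓡 n) (n := ∞) (G := G) (M := M)).comp
    (contMDiff_id.prodMk contMDiff_const)

omit h in
theorem smooth_smul (m : ℕ) {G : Type*} [TopologicalSpace G]
    [ChartedSpace (EuclideanSpace ℝ (Fin m)) G] [Group G] (n : ℕ) {M : Type*} [TopologicalSpace M]
    [ChartedSpace (EuclideanSpace ℝ (Fin n)) M] [MulAction G M] [ContMDiffSMul (𝓡 m) (𝓡 n) ∞ G M]
    (g : G) : ContMDiff (𝓡 n) (𝓡 n) ∞ (fun x : M ↦ g • x) :=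
  (contMDiff_smul (I := 𝓡 m) (I' := 𝓡 n) (n := ∞) (G := G) (M := M)).comp
    (contMDiff_const.prodMk contMDiff_id)

omit h in
/-- The differential at the identity of the orbit map of `p`. -/
noncomputable def orbitDeriv {m : ℕ} (G : Type*) [TopologicalSpace G]
    [ChartedSpace (EuclideanSpace ℝ (Fin m)) G] [Group G] {n : ℕ} {M : Type*} [TopologicalSpace M]
    [ChartedSpace (EuclideanSpace ℝ (Fin n)) M] [MulAction G M] (p : M) :
    EuclideanSpace ℝ (Fin m) →L[ℝ] EuclideanSpace ℝ (Fin n) :=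
  dAt (E := EuclideanSpace ℝ (Fin m)) (E' := EuclideanSpace ℝ (Fin n)) (fun g : G ↦ g • p) 1

omit h [IsManifold (𝓡 n) ∞ M] in
theorem dAt_gexp_smul_point (p : M) (X : V) :
    dAt (E := ℝ) (E' := W) (fun t : ℝ ↦ gexp G (t • X) • p) 0 1 = orbitDeriv G (n := n) p X := by
  have h0 : gexp G ((0 : ℝ) • X) = 1 := by rw [zero_smul, gexp_zero]
  have h1 := dAt_comp (E := ℝ) (E' := V) (E'' := W) (g := fun g : G ↦ g • p)
    (f := fun t : ℝ ↦ gexp G (t • X)) 0 (mdiff_of_smooth (smooth_orbit m n p _))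
    (mdiff_of_smooth (contMDiff_gexp_smul X 0))
  rw [h1, ContinuousLinearMap.comp_apply, dAt_gexp_smul, h0]
  rfl

omit h [IsManifold (𝓡 n) ∞ M] in
theorem orbitDeriv_eq_zero {p : M} {X : V} (hX : ∀ t : ℝ, gexp G (t • X) • p = p) :
    orbitDeriv G (n := n) p X = 0 := by
  rw [← dAt_gexp_smul_point]
  simp only [hX]
  rw [dAt_const]
  rfl

/-- Near the identity the elements commuting with `θ` belong to the stabilizer. -/
theorem eventually_mem_of_commutes {K : Subgroup G}
    (hθK : ∀ X : GroupLieAlgebra (𝓡 m) G, θ X = X ↔ ∀ t : ℝ, lieExp (t • X) ∈ K)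
    {p : M} (hstab : MulAction.stabilizer G p = K)
    (hsurj : Function.Surjective (orbitDeriv G (n := n) p : V → W)) :
    ∀ᶠ g : G in 𝓝 1, Commutes (m := m) θ g → g ∈ K := by
  -- The projection onto 𝔭 along the fixed space of `θ`.
  let pr : V →L[ℝ] V := (1 / 2 : ℝ) • (ContinuousLinearMap.id ℝ V - onModel θ)
  have hpr : ∀ Z, pr Z = (1 / 2 : ℝ) • (Z - onModel θ Z) := fun Z ↦ rfl
  have hprp : ∀ Z, onModel θ (pr Z) = -pr Z := by
    intro Z
    rw [hpr, map_smul, map_sub, onModel_onModel h]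
    module
  have hPpr : ∀ Z, orbitDeriv G (n := n) p (pr Z) = orbitDeriv G (n := n) p Z := by
    intro Z
    have h1 : onModel θ ((1 / 2 : ℝ) • (Z + onModel θ Z)) = (1 / 2 : ℝ) • (Z + onModel θ Z) := by
      rw [map_smul, map_add, onModel_onModel h, add_comm]
    have h2 : orbitDeriv G (n := n) p ((1 / 2 : ℝ) • (Z + onModel θ Z)) = 0 := by
      refine orbitDeriv_eq_zero fun t ↦ ?_
      have h3 : gexp G (t • ((1 / 2 : ℝ) • (Z + onModel θ Z))) ∈ K := (hθK _).1 h1 t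
      rw [← hstab] at h3
      exact h3
    have h3 : Z = pr Z + (1 / 2 : ℝ) • (Z + onModel θ Z) := by
      rw [hpr]; module
    conv_rhs => rw [h3, map_add, h2, add_zero]
  -- A slice transverse to `K` at the identity, taken in the chart because no smoothness of the
  -- exponential in its generator has been established.
  let σ : V → G := fun Z ↦ (extChartAt (𝓡 m) (1 : G)).symm (oneChart m G + pr Z)
  have hσ0 : σ 0 = 1 := by
    change (extChartAt (𝓡 m) (1 : G)).symm (oneChart m G + pr 0) = 1
    rw [map_zero, add_zero, symm_oneChart]
  have hσ : ContMDiffAt (𝓡 m) (𝓡 m) ∞ σ 0 := by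
    have h1 : ContMDiffAt (𝓡 m) (𝓡 m) ∞ (extChartAt (𝓡 m) (1 : G)).symm (oneChart m G + pr 0) := by
      rw [map_zero, add_zero]
      exact contMDiffAt_chart_symm oneChart_mem
    have h2 : ContDiff ℝ ∞ (fun Z : V ↦ oneChart m G + pr Z) := contDiff_const.add pr.contDiff
    exact ContMDiffAt.comp (g := (extChartAt (𝓡 m) (1 : G)).symm)
      (f := fun Z : V ↦ oneChart m G + pr Z) 0 h1 h2.contDiffAt.contMDiffAt
  have hdσ : dAt (E := V) (E' := V) σ 0 = pr := by
    have h1 : MDifferentiableAt (𝓡 m) (𝓡 m) (extChartAt (𝓡 m) (1 : G)).symm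
        (oneChart m G + pr 0) := by
      rw [map_zero, add_zero]
      exact mdiff_of_smooth (contMDiffAt_chart_symm oneChart_mem)
    have h2 : HasFDerivAt (fun Z : V ↦ oneChart m G + pr Z) pr 0 := pr.hasFDerivAt.const_add _
    have h3 := dAt_comp (E := V) (E' := V) (E'' := V) (g := (extChartAt (𝓡 m) (1 : G)).symm)
      (f := fun Z : V ↦ oneChart m G + pr Z) 0 h1 h2.differentiableAt.mdifferentiableAt
    rw [dAt_eq_fderiv, h2.fderiv, map_zero, add_zero] at h3
    rw [← ContinuousLinearMap.id_comp pr, ← dAt_symm_self (1 : G)]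
    exact h3
  let f : V → M := fun Z ↦ σ Z • p
  have hf0 : f 0 = p := by
    change σ 0 • p = p
    rw [hσ0, one_smul]
  have hf : ContMDiffAt (𝓡 m) (𝓡 n) ∞ f 0 :=
    ContMDiffAt.comp (g := fun g : G ↦ g • p) (f := σ) 0 (smooth_orbit m n p _) hσ
  have hdf : dAt (E := V) (E' := W) f 0 = (orbitDeriv G (n := n) p).comp pr := by
    have h1 := dAt_comp (E := V) (E' := V) (E'' := W) (g := fun g : G ↦ g • p) (f := σ) 0
      (mdiff_of_smooth (smooth_orbit m n p _)) (mdiff_of_smooth hσ)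
    rw [hdσ, hσ0] at h1
    exact h1
  set c := extChartAt (𝓡 n) p with hc
  have hsrc : f 0 ∈ c.source := by rw [hf0]; exact mem_extChartAt_source p
  have hF : ContDiffAt ℝ ∞ (fun Z ↦ c (f Z)) 0 := contDiffAt_chart_comp hf hsrc
  have hdF : fderiv ℝ (fun Z ↦ c (f Z)) 0 = (orbitDeriv G (n := n) p).comp pr := by
    have h1 := dAt_comp (E := V) (E' := W) (E'' := W) (g := c) (f := f) 0
      (mdiff_of_smooth (contMDiffAt_chart hsrc)) (mdiff_of_smooth hf)
    rw [dAt_eq_fderiv, hdf, hf0, dAt_chart_self, ContinuousLinearMap.id_comp] at h1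
    exact h1
  have hstrict : HasStrictFDerivAt (fun Z ↦ c (f Z)) ((orbitDeriv G (n := n) p).comp pr) 0 := by
    rw [← hdF]
    exact hF.hasStrictFDerivAt (by simp)
  -- The orbit differential kills the Lie algebra of `K`, so 𝔭 alone fills the tangent space at `p`.
  -- Hence all points near `p` have the form `σ Z • p` with `Z` small.
  have hmap := hstrict.map_nhds_eq_of_surj (by
    rw [LinearMap.range_eq_top]
    intro w
    obtain ⟨Z, hZ⟩ := hsurj w
    exact ⟨Z, (hPpr Z).trans hZ⟩)
  have hev : ∀ᶠ Z : V in 𝓝 0, f Z ∈ c.source ∧ (Commutes (m := m) θ (σ Z) → pr Z = 0) := by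
    have h1 : ∀ᶠ Z : V in 𝓝 0, f Z ∈ c.source :=
      hf.continuousAt.eventually_mem ((isOpen_extChartAt_source p).mem_nhds hsrc)
    have h2 : Tendsto pr (𝓝 0) (𝓝 0) := by
      have := pr.continuous.tendsto 0
      rwa [map_zero] at this
    filter_upwards [h1, h2.eventually (eventually_eq_zero_of_commutes h (G := G))] with Z hZ1 hZ2
    exact ⟨hZ1, hZ2 (hprp Z)⟩
  have himg := image_mem_map (m := fun Z ↦ c (f Z)) hev
  rw [hmap] at himg
  have hcont : ContinuousAt (fun g : G ↦ c (g • p)) 1 := by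
    have h1 : ContinuousAt c ((1 : G) • p) := by
      rw [one_smul]
      exact continuousAt_extChartAt p
    exact ContinuousAt.comp (f := fun g : G ↦ g • p) h1 (smooth_orbit m n p).continuous.continuousAt
  have hlim : Tendsto (fun g : G ↦ c (g • p)) (𝓝 1) (𝓝 (c (f 0))) := by
    have := hcont.tendsto
    simp only [one_smul] at this
    rwa [hf0]
  have hsrc' : ∀ᶠ g : G in 𝓝 1, g • p ∈ c.source := by
    refine (smooth_orbit m n p).continuous.continuousAt.eventually_mem ?_
    rw [one_smul]
    exact extChartAt_source_mem_nhds p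
  -- Write `g • p = σ Z • p`. Then `(σ Z)⁻¹ g` lies in `K` and commutes with `θ`, so `σ Z` commutes
  -- with `θ`. This forces `pr Z = 0` and `σ Z = 1`.
  filter_upwards [hlim.eventually himg, hsrc'] with g ⟨Z, ⟨hZ1, hZ2⟩, hZ⟩ hg hcomm
  have h1 : σ Z • p = g • p := c.injOn hZ1 hg hZ
  have h2 : (σ Z)⁻¹ * g ∈ K := by
    rw [← hstab, MulAction.mem_stabilizer_iff, mul_smul, ← h1, inv_smul_smul]
  have h3 : Commutes (m := m) θ (σ Z) := by
    have := hcomm.mul (commutes_of_mem h hθK h2).inv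
    rwa [mul_inv_rev, inv_inv, mul_inv_cancel_left] at this
  have h4 : σ Z = 1 := by
    change (extChartAt (𝓡 m) (1 : G)).symm (oneChart m G + pr Z) = 1
    rw [hZ2 h3, add_zero, symm_oneChart]
  rwa [h4, inv_one, one_mul] at h2

/-- The Cartan decomposition of a connected group. -/
theorem mul_polarPart_mem [T2Space M] [ConnectedSpace G] {K : Subgroup G}
    (hθK : ∀ X : GroupLieAlgebra (𝓡 m) G, θ X = X ↔ ∀ t : ℝ, lieExp (t • X) ∈ K)
    {p : M} (hstab : MulAction.stabilizer G p = K)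
    (hsurj : Function.Surjective (orbitDeriv G (n := n) p : V → W)) (g : G) :
    g * gexp G (-polarPart h g) ∈ K := by
  have := topologicalGroup_of_lieGroup (𝓡 m) ∞ (G := G)
  have hr : Continuous fun g : G ↦ g * gexp G (-polarPart h g) :=
    continuous_id.mul (continuous_gexp.comp (continuous_polarPart h).neg)
  have hK : IsClosed (K : Set G) := by
    have h1 : (K : Set G) = (fun g : G ↦ g • p) ⁻¹' {p} := by
      rw [← hstab]
      rfl
    rw [h1]
    exact isClosed_singleton.preimage (smooth_orbit m n p).continuous
  have hcl : IsClosed {g : G | g * gexp G (-polarPart h g) ∈ K} := hK.preimage hr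
  have hop : IsOpen {g : G | g * gexp G (-polarPart h g) ∈ K} := by
    rw [isOpen_iff_mem_nhds]
    intro g₀ hg₀
    -- The left factors of `g` and `g₀` both commute with `θ`, and their quotient tends to `1`; so
    -- it is in `K` once `g` is close to `g₀`.
    have h1 : Tendsto (fun g : G ↦ (g₀ * gexp G (-polarPart h g₀))⁻¹ * (g * gexp G (-polarPart h g)))
        (𝓝 g₀) (𝓝 1) := by
      have := (hr.tendsto g₀).const_mul (g₀ * gexp G (-polarPart h g₀))⁻¹
      rwa [inv_mul_cancel] at this
    filter_upwards [h1.eventually (eventually_mem_of_commutes h hθK hstab hsurj)] with g hg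
    have h2 := hg ((commutes_mul_polarPart h g₀).inv.mul (commutes_mul_polarPart h g))
    have h3 := K.mul_mem hg₀ h2
    rwa [mul_inv_cancel_left] at h3
  have hne : {g : G | g * gexp G (-polarPart h g) ∈ K}.Nonempty := by
    refine ⟨1, ?_⟩
    have h0 := onModel_polarPart h (1 : G)
    have h1 := gexp_unique h (commutes_mul_polarPart h (1 : G)) (commutes_one) h0
      (X' := 0) (by rw [map_zero, neg_zero]) (by rw [gexp_neg, gexp_zero]; simp)
    change (1 : G) * gexp G (-polarPart h 1) ∈ K
    rw [h1, neg_zero, gexp_zero, mul_one]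
    exact K.one_mem
  have huniv := IsClopen.eq_univ ⟨hcl, hop⟩ hne
  exact (Set.ext_iff.1 huniv g).2 (mem_univ g)

/-- The decomposition has `K` on the left, so it is applied to `g⁻¹ = k exp X`, giving `g • p =
exp(-X) • p`. -/
theorem exists_polar [T2Space M] [ConnectedSpace G] [MulAction.IsPretransitive G M] {K : Subgroup G}
    (hθK : ∀ X : GroupLieAlgebra (𝓡 m) G, θ X = X ↔ ∀ t : ℝ, lieExp (t • X) ∈ K)
    {p : M} (hstab : MulAction.stabilizer G p = K)
    (hsurj : Function.Surjective (orbitDeriv G (n := n) p : V → W)) (x : M) :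
    ∃ X : V, onModel θ X = -X ∧ gexp G X • p = x := by
  obtain ⟨g, rfl⟩ := MulAction.exists_smul_eq G p x
  refine ⟨-polarPart h g⁻¹, by rw [map_neg, onModel_polarPart], ?_⟩
  have h1 := mul_polarPart_mem h hθK hstab hsurj g⁻¹
  rw [← hstab, MulAction.mem_stabilizer_iff, mul_smul] at h1
  exact inv_smul_eq_iff.1 h1

-- Two polar vectors of one point satisfy `exp(-X) = k exp(-X')` with `k` in `K`, and the polar part
-- of an element is unique.
omit [IsManifold (𝓡 n) ∞ M] [TopologicalSpace M] [ChartedSpace (EuclideanSpace ℝ (Fin n)) M]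
  [ContMDiffSMul (𝓡 m) (𝓡 n) ∞ G M] in
theorem polar_unique {K : Subgroup G}
    (hθK : ∀ X : GroupLieAlgebra (𝓡 m) G, θ X = X ↔ ∀ t : ℝ, lieExp (t • X) ∈ K)
    {p : M} (hstab : MulAction.stabilizer G p = K) {X X' : V}
    (hX : onModel θ X = -X) (hX' : onModel θ X' = -X') (heq : gexp G X • p = gexp G X' • p) :
    X = X' := by
  have h1 : (gexp G X)⁻¹ * gexp G X' ∈ K := by
    rw [← hstab, MulAction.mem_stabilizer_iff, mul_smul, ← heq, inv_smul_smul]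
  have h2 := gexp_unique h (commutes_one) (commutes_of_mem h hθK h1) (X := -X) (X' := -X')
    (by rw [map_neg, hX]) (by rw [map_neg, hX']) (by
      rw [gexp_neg, gexp_neg, one_mul, mul_inv_cancel_right])
  exact neg_injective h2

end CartanDecomposition

end SymmetricSpace

namespace SymmetricSpace

open Set Filter Topology Module

/-! ### The Riemannian metric in charts -/

section Metric

variable {n : ℕ} {M : Type*} [TopologicalSpace M] [ChartedSpace (EuclideanSpace ℝ (Fin n)) M]
  [RiemannianBundle (fun x : M ↦ TangentSpace (𝓡 n) x)]

local notation "W" => EuclideanSpace ℝ (Fin n)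

/-- The Riemannian metric as a bilinear form on the model space. -/
noncomputable def metric (x : M) : W →L[ℝ] W →L[ℝ] ℝ :=
  LinearMap.toContinuousBilinearMap
    (LinearMap.mk₂ ℝ (fun u v : W ↦ (inner ℝ : TangentSpace (𝓡 n) x → TangentSpace (𝓡 n) x → ℝ) u v)
      (fun u v w ↦ inner_add_left (E := TangentSpace (𝓡 n) x) u v w)
      (fun r u v ↦ real_inner_smul_left (F := TangentSpace (𝓡 n) x) u v r)
      (fun u v w ↦ inner_add_right (E := TangentSpace (𝓡 n) x) u v w)
      (fun r u v ↦ real_inner_smul_right (F := TangentSpace (𝓡 n) x) u v r))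

theorem metric_symm (x : M) (u v : W) : metric x u v = metric x v u :=
  real_inner_comm (F := TangentSpace (𝓡 n) x) v u

theorem metric_pos (x : M) {u : W} (hu : u ≠ 0) : 0 < metric x u u :=
  real_inner_self_pos (F := TangentSpace (𝓡 n) x) |>.2 hu

/-- The metric in the chart around `c`, as a continuous bilinear form. -/
noncomputable def chartForm (c : M) (z : W) : W →L[ℝ] W →L[ℝ] ℝ :=
  (metric ((extChartAt (𝓡 n) c).symm z)).bilinearComp
    (dAt (E := W) (E' := W) (extChartAt (𝓡 n) c).symm z)
    (dAt (E := W) (E' := W) (extChartAt (𝓡 n) c).symm z)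

theorem chartForm_apply (c : M) (z u v : W) : chartForm c z u v =
    metric ((extChartAt (𝓡 n) c).symm z)
      (dAt (E := W) (E' := W) (extChartAt (𝓡 n) c).symm z u)
      (dAt (E := W) (E' := W) (extChartAt (𝓡 n) c).symm z v) := rfl

theorem chartForm_symm (c : M) (z u v : W) : chartForm c z u v = chartForm c z v u :=
  metric_symm _ _ _

variable [IsManifold (𝓡 n) ∞ M]

theorem chartForm_chart {c x : M} (hx : x ∈ (extChartAt (𝓡 n) c).source) (u v : W) :
    chartForm c (extChartAt (𝓡 n) c x) (dAt (E := W) (E' := W) (extChartAt (𝓡 n) c) x u)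
      (dAt (E := W) (E' := W) (extChartAt (𝓡 n) c) x v) = metric x u v := by
  rw [chartForm_apply, dAt_symm_chart_apply hx, dAt_symm_chart_apply hx,
    (extChartAt (𝓡 n) c).left_inv hx]

theorem chartForm_pos {c : M} {z : W} (hz : z ∈ (extChartAt (𝓡 n) c).target) {u : W} (hu : u ≠ 0) :
    0 < chartForm c z u u := by
  rw [chartForm_apply]
  apply metric_pos
  intro h0
  have h1 := dAt_chart_symm_apply ((extChartAt (𝓡 n) c).map_target hz) u
  rw [(extChartAt (𝓡 n) c).right_inv hz, h0, map_zero] at h1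
  exact hu h1.symm

/-- Invariance of the metric under an isometry, in charts. -/
theorem chartForm_isometry {f : M → M} (hf : ContMDiff (𝓡 n) (𝓡 n) ∞ f)
    (hiso : ∀ (x : M) (u v : W), metric (f x) (dAt (E := W) (E' := W) f x u)
      (dAt (E := W) (E' := W) f x v) = metric x u v)
    {c c' : M} {z : W} (hz : z ∈ (extChartAt (𝓡 n) c).target)
    (hfz : f ((extChartAt (𝓡 n) c).symm z) ∈ (extChartAt (𝓡 n) c').source) (u v : W) :
    chartForm c' (extChartAt (𝓡 n) c' (f ((extChartAt (𝓡 n) c).symm z)))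
      (fderiv ℝ (fun z ↦ extChartAt (𝓡 n) c' (f ((extChartAt (𝓡 n) c).symm z))) z u)
      (fderiv ℝ (fun z ↦ extChartAt (𝓡 n) c' (f ((extChartAt (𝓡 n) c).symm z))) z v) =
    chartForm c z u v := by
  have h1 := mdiff_of_smooth (contMDiffAt_chart_symm hz)
  have h2 := mdiff_of_smooth (hf ((extChartAt (𝓡 n) c).symm z))
  have h3 := dAt_comp (E := W) (E' := W) (E'' := W) z h2 h1
  have h4 := dAt_comp (E := W) (E' := W) (E'' := W) (g := extChartAt (𝓡 n) c')
    (f := fun z ↦ f ((extChartAt (𝓡 n) c).symm z)) z (mdiff_of_smooth (contMDiffAt_chart hfz))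
    (MDifferentiableAt.comp (g := f) z h2 h1)
  rw [dAt_eq_fderiv, h3] at h4
  rw [h4]
  simp only [ContinuousLinearMap.comp_apply]
  rw [chartForm_chart hfz, hiso]
  rfl

variable [IsContMDiffRiemannianBundle (𝓡 n) ∞ (EuclideanSpace ℝ (Fin n))
      (fun x : M ↦ TangentSpace (𝓡 n) x)]

/-- Coordinate fields with constant coefficients are smooth sections of the tangent bundle, and a
smooth metric pairs smooth sections smoothly. -/
theorem contDiffOn_chartMetric (c : M) (u v : W) :
    ContDiffOn ℝ ∞ (fun z ↦ chartForm c z u v) (extChartAt (𝓡 n) c).target := by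
  have hop := isOpen_extChartAt_target (I := 𝓡 n) c
  have key : ∀ w : W, ContMDiffOn (𝓡 n) (𝓡 n).tangent ∞
      (fun z : W ↦ (⟨(extChartAt (𝓡 n) c).symm z,
        dAt (E := W) (E' := W) (extChartAt (𝓡 n) c).symm z w⟩ : TangentBundle (𝓡 n) M))
      (extChartAt (𝓡 n) c).target := by
    intro w
    have h1 := (contMDiffOn_extChartAt_symm (I := 𝓡 n) (n := ∞) c).contMDiffOn_tangentMapWithin
      (m := ∞) (by simp) hop.uniqueMDiffOn
    have h2 : ContMDiff (𝓡 n) (𝓡 n).tangent ∞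
        (fun z : W ↦ (⟨z, w⟩ : TangentBundle (𝓡 n) W)) :=
      contMDiff_vectorSpace_iff_contDiff.2 contDiff_const
    have h3 := ContMDiffOn.comp (f := fun z : W ↦ (⟨z, w⟩ : TangentBundle (𝓡 n) W)) h1
      (h2.contMDiffOn (s := (extChartAt (𝓡 n) c).target)) (fun z hz ↦ hz)
    refine h3.congr fun z hz ↦ ?_
    change _ = (⟨_, mfderivWithin (𝓡 n) (𝓡 n) (extChartAt (𝓡 n) c).symm
      (extChartAt (𝓡 n) c).target z w⟩ : TangentBundle (𝓡 n) M)
    rw [mfderivWithin_of_isOpen hop hz]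
    rfl
  have := (key u).inner_bundle (key v)
  exact contMDiffOn_iff_contDiffOn.1 this

theorem contDiffOn_chartForm (c : M) :
    ContDiffOn ℝ ∞ (chartForm (n := n) c) (extChartAt (𝓡 n) c).target := by
  rw [contDiffOn_clm_apply]
  intro u
  rw [contDiffOn_clm_apply]
  intro v
  exact contDiffOn_chartMetric c u v

theorem contDiffAt_chartForm {c : M} {z : W} (hz : z ∈ (extChartAt (𝓡 n) c).target) :
    ContDiffAt ℝ ∞ (chartForm (n := n) c) z :=
  (contDiffOn_chartForm c).contDiffAt ((isOpen_extChartAt_target c).mem_nhds hz)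

end Metric

end SymmetricSpace

namespace SymmetricSpace

open Set Filter Topology Module

/-! ### From conserved momentum to the Euler-Lagrange equation -/

section EulerLagrange

variable {E : Type*} [NormedAddCommGroup E] [NormedSpace ℝ E]

theorem differentiableAt_bilinear {B : E → E →L[ℝ] E →L[ℝ] ℝ} {z : E} (hB : DifferentiableAt ℝ B z)
    (a b : E) : DifferentiableAt ℝ (fun q : E × E × E ↦ B q.1 q.2.1 q.2.2) (z, a, b) := by
  have h1 : DifferentiableAt ℝ (fun q : E × E × E ↦ B q.1) (z, a, b) :=
    DifferentiableAt.comp (𝕜 := ℝ) (E := E × E × E) (F := E) (G := E →L[ℝ] E →L[ℝ] ℝ) (g := B)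
      (f := fun q : E × E × E ↦ q.1) (z, a, b) hB (by fun_prop)
  have h2 : DifferentiableAt ℝ (fun q : E × E × E ↦ q.2.1) (z, a, b) := by fun_prop
  have h3 : DifferentiableAt ℝ (fun q : E × E × E ↦ q.2.2) (z, a, b) := by fun_prop
  exact (h1.clm_apply h2).clm_apply h3

theorem hasDerivAt_bilinear {B : E → E →L[ℝ] E →L[ℝ] ℝ} {x a b : ℝ → E} {x' a' b' : E} {t : ℝ}
    (hB : DifferentiableAt ℝ B (x t)) (hx : HasDerivAt x x' t)
    (ha : HasDerivAt a a' t) (hb : HasDerivAt b b' t) :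
    HasDerivAt (fun s ↦ B (x s) (a s) (b s))
      (fderiv ℝ (fun z ↦ B z (a t) (b t)) (x t) x' + B (x t) a' (b t) + B (x t) (a t) b') t := by
  have hd := (differentiableAt_bilinear hB (a t) (b t)).hasFDerivAt
  set L := fderiv ℝ (fun q : E × E × E ↦ B q.1 q.2.1 q.2.2) (x t, a t, b t)
  have h1 : HasDerivAt (fun s ↦ (x s, a s, b s)) (x', a', b') t := hx.prodMk (ha.prodMk hb)
  refine (hd.comp_hasDerivAt t h1).congr_deriv ?_
  have hxd : fderiv ℝ (fun z ↦ B z (a t) (b t)) (x t) x' = L (x', 0, 0) := by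
    have h2 : HasFDerivAt (fun z : E ↦ (z, a t, b t)) (ContinuousLinearMap.inl ℝ E (E × E)) (x t) :=
      (hasFDerivAt_id _).prodMk (hasFDerivAt_const _ _)
    have h3 := HasFDerivAt.fderiv (HasFDerivAt.comp (g := fun q : E × E × E ↦ B q.1 q.2.1 q.2.2)
      (f := fun z : E ↦ (z, a t, b t)) (x t) hd h2)
    exact congrArg (fun T : E →L[ℝ] ℝ ↦ T x') h3
  have had : B (x t) a' (b t) = L (0, a', 0) := by
    have h2 : HasFDerivAt (fun z : E ↦ (x t, z, b t))
        ((0 : E →L[ℝ] E).prod ((ContinuousLinearMap.id ℝ E).prod 0)) (a t) :=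
      (hasFDerivAt_const _ _).prodMk ((hasFDerivAt_id _).prodMk (hasFDerivAt_const _ _))
    have h3 := HasFDerivAt.comp (g := fun q : E × E × E ↦ B q.1 q.2.1 q.2.2)
      (f := fun z : E ↦ (x t, z, b t)) (a t) hd h2
    have h4 : HasFDerivAt (fun z ↦ B (x t) z (b t)) ((B (x t)).flip (b t)) (a t) :=
      ((B (x t)).flip (b t)).hasFDerivAt
    exact congrArg (fun T : E →L[ℝ] ℝ ↦ T a') (h4.unique h3)
  have hbd : B (x t) (a t) b' = L (0, 0, b') := by
    have h2 : HasFDerivAt (fun z : E ↦ (x t, a t, z))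
        ((0 : E →L[ℝ] E).prod ((0 : E →L[ℝ] E).prod (ContinuousLinearMap.id ℝ E))) (b t) :=
      (hasFDerivAt_const _ _).prodMk ((hasFDerivAt_const _ _).prodMk (hasFDerivAt_id _))
    have h3 := HasFDerivAt.comp (g := fun q : E × E × E ↦ B q.1 q.2.1 q.2.2)
      (f := fun z : E ↦ (x t, a t, z)) (b t) hd h2
    have h4 : HasFDerivAt (fun z ↦ B (x t) (a t) z) (B (x t) (a t)) (b t) :=
      (B (x t) (a t)).hasFDerivAt
    exact congrArg (fun T : E →L[ℝ] ℝ ↦ T b') (h4.unique h3)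
  rw [hxd, had, hbd, ← map_add, ← map_add]
  simp

/-- If a local flow preserves the metric and the momentum of a curve along the flow is constant, then
the curve satisfies the Euler-Lagrange equation in the direction of the flow. -/
theorem hasDerivAt_momentum {Φ : ℝ × E → E} {B : E → E →L[ℝ] E →L[ℝ] ℝ} {z₀ : E}
    (hΦ : ContDiffAt ℝ ∞ Φ (0, z₀)) (hΦ0 : ∀ᶠ z in 𝓝 z₀, Φ (0, z) = z)
    (hB : DifferentiableAt ℝ B z₀) (hsymm : ∀ a b, B z₀ a b = B z₀ b a)
    (hinv : ∀ᶠ s in 𝓝 (0 : ℝ), ∀ a, B (Φ (s, z₀)) (fderiv ℝ (fun z ↦ Φ (s, z)) z₀ a)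
      (fderiv ℝ (fun z ↦ Φ (s, z)) z₀ a) = B z₀ a a)
    {u u' : ℝ → E} {t₀ : ℝ} {u'' : E} (hu0 : u t₀ = z₀) (hu : HasDerivAt u (u' t₀) t₀)
    (hu' : HasDerivAt u' u'' t₀)
    (hcons : HasDerivAt (fun s ↦ B (u s) (u' s) (fderiv ℝ Φ (0, u s) (1, 0))) 0 t₀) :
    HasDerivAt (fun s ↦ B (u s) (u' s) (fderiv ℝ Φ (0, z₀) (1, 0)))
      ((1 / 2) * fderiv ℝ (fun z ↦ B z (u' t₀) (u' t₀)) z₀ (fderiv ℝ Φ (0, z₀) (1, 0))) t₀ := by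
  set a := u' t₀ with ha
  set ξ₀ := fderiv ℝ Φ (0, z₀) (1, 0) with hξ₀
  have hΦ' : ContDiffAt ℝ ∞ (fderiv ℝ Φ) (0, z₀) := hΦ.fderiv_right (by simp)
  set D := fderiv ℝ (fderiv ℝ Φ) (0, z₀) with hD
  have hDd : HasFDerivAt (fderiv ℝ Φ) D (0, z₀) := (hΦ'.differentiableAt (by simp)).hasFDerivAt
  have hDsymm : ∀ x y, D x y = D y x := fun x y ↦
    (hΦ.isSymmSndFDerivAt (by
      rw [minSmoothness_of_isRCLikeNormedField]
      exact ENat.LEInfty.out)) x y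
  have hΦd : HasFDerivAt Φ (fderiv ℝ Φ (0, z₀)) (0, z₀) :=
    (hΦ.differentiableAt (by simp)).hasFDerivAt
  have hline : HasDerivAt (fun s : ℝ ↦ (s, z₀)) ((1 : ℝ), (0 : E)) 0 :=
    (hasDerivAt_id (0 : ℝ)).prodMk (hasDerivAt_const (0 : ℝ) z₀)
  have hΦz₀ : Φ (0, z₀) = z₀ := hΦ0.self_of_nhds
  have hflow : HasDerivAt (fun s : ℝ ↦ Φ (s, z₀)) ξ₀ 0 := hΦd.comp_hasDerivAt (0 : ℝ) hline
  have hA : HasDerivAt (fun s : ℝ ↦ fderiv ℝ Φ (s, z₀) (0, a)) (D (1, 0) (0, a)) 0 := by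
    have h1 := hDd.comp_hasDerivAt (0 : ℝ) hline
    exact (ContinuousLinearMap.apply ℝ E ((0 : ℝ), a)).hasFDerivAt.comp_hasDerivAt (0 : ℝ) h1
  have hev : ∀ᶠ s in 𝓝 (0 : ℝ), fderiv ℝ (fun z ↦ Φ (s, z)) z₀ a = fderiv ℝ Φ (s, z₀) (0, a) := by
    have h1 : ∀ᶠ q in 𝓝 ((0 : ℝ), z₀), DifferentiableAt ℝ Φ q := by
      have := (hΦ.of_le (m := 1) (by exact_mod_cast le_top)).eventually (by simp)
      exact this.mono fun q hq ↦ hq.differentiableAt (by simp)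
    filter_upwards [(hline.continuousAt.tendsto).eventually h1] with s hs
    have h2 : HasFDerivAt (fun z : E ↦ (s, z)) (ContinuousLinearMap.inr ℝ ℝ E) z₀ :=
      (hasFDerivAt_const s z₀).prodMk (hasFDerivAt_id z₀)
    have h3 := (hs.hasFDerivAt.comp z₀ h2).fderiv
    change fderiv ℝ (fun z ↦ Φ (s, z)) z₀ = _ at h3
    rw [h3]
    rfl
  have hA0 : fderiv ℝ Φ (0, z₀) (0, a) = a := by
    rw [← hev.self_of_nhds]
    have h1 : (fun z ↦ Φ (0, z)) =ᶠ[𝓝 z₀] fun z ↦ z := hΦ0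
    rw [h1.fderiv_eq, fderiv_fun_id]
    rfl
  have hB0 : DifferentiableAt ℝ B (Φ (0, z₀)) := by rwa [hΦz₀]
  have h1 : HasDerivAt (fun s : ℝ ↦ B (Φ (s, z₀)) (fderiv ℝ Φ (s, z₀) (0, a))
      (fderiv ℝ Φ (s, z₀) (0, a)))
      -- Differentiated invariance is the Killing equation: this expression vanishes, and `D (1, 0)
      -- (0, a)` is the derivative of the generating field along `a`.
      (fderiv ℝ (fun z ↦ B z a a) z₀ ξ₀ + B z₀ (D (1, 0) (0, a)) a + B z₀ a (D (1, 0) (0, a))) 0 := by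
    have h2 := hasDerivAt_bilinear hB0 hflow hA hA
    rwa [hA0, hΦz₀] at h2
  have h2 : HasDerivAt (fun s : ℝ ↦ B (Φ (s, z₀)) (fderiv ℝ Φ (s, z₀) (0, a))
      (fderiv ℝ Φ (s, z₀) (0, a))) 0 0 := by
    refine (hasDerivAt_const (0 : ℝ) (B z₀ a a)).congr_of_eventuallyEq ?_
    filter_upwards [hinv, hev] with s hs1 hs2
    rw [← hs2, hs1 a]
  have h3 := h1.unique h2
  have hBu : DifferentiableAt ℝ B (u t₀) := by rwa [hu0]
  have hξ : HasDerivAt (fun s ↦ fderiv ℝ Φ (0, u s) (1, 0)) (D (0, a) (1, 0)) t₀ := by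
    have h4 : HasDerivAt (fun s : ℝ ↦ ((0 : ℝ), u s)) ((0 : ℝ), a) t₀ :=
      (hasDerivAt_const t₀ (0 : ℝ)).prodMk hu
    have h5 : HasFDerivAt (fderiv ℝ Φ) D (0, u t₀) := by rw [hu0]; exact hDd
    have h6 := h5.comp_hasDerivAt t₀ h4
    exact (ContinuousLinearMap.apply ℝ E ((1 : ℝ), (0 : E))).hasFDerivAt.comp_hasDerivAt t₀ h6
  -- Pairing with the moving field instead of the frozen vector `ξ₀` adds one term, the velocity
  -- against the derivative of the field. The Killing equation evaluates that term as half the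
  -- Lagrangian derivative with a minus sign.
  have h4 := (hasDerivAt_bilinear hBu hu hu' hξ).unique hcons
  have h5 := hasDerivAt_bilinear hBu hu hu' (hasDerivAt_const t₀ ξ₀)
  rw [hu0, ← ha, ← hξ₀] at h4
  rw [hu0, ← ha, map_zero, add_zero] at h5
  refine h5.congr_deriv ?_
  have h7 := hsymm (D (1, 0) (0, a)) a
  rw [← hDsymm (1, 0) (0, a)] at h4
  linarith

end EulerLagrange

end SymmetricSpace

namespace SymmetricSpace

open Set Filter Topology Module

/-! ### Killing fields of the action and velocities of orbit curves -/

section OrbitMaps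

variable {m : ℕ} {G : Type*} [TopologicalSpace G] [ChartedSpace (EuclideanSpace ℝ (Fin m)) G]
  [Group G] [LieGroup (𝓡 m) ∞ G] [T2Space G]
  {n : ℕ} {M : Type*} [TopologicalSpace M] [ChartedSpace (EuclideanSpace ℝ (Fin n)) M]
  [MulAction G M] [ContMDiffSMul (𝓡 m) (𝓡 n) ∞ G M]

local notation "V" => EuclideanSpace ℝ (Fin m)
local notation "W" => EuclideanSpace ℝ (Fin n)

omit [T2Space G] in
/-- Equivariance of the vector fields generated by the action. -/
theorem dAt_smul_orbitDeriv (g : G) (x : M) (X : V) :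
    dAt (E := W) (E' := W) (fun z : M ↦ g • z) x (orbitDeriv G x X) =
      orbitDeriv G (n := n) (g • x) (Ad g X) := by
  have h1 : MDifferentiableAt (𝓡 n) (𝓡 n) (fun z : M ↦ g • z) ((1 : G) • x) :=
    mdiff_of_smooth (smooth_smul m n g _)
  have h2 := dAt_comp (E := V) (E' := W) (E'' := W) (g := fun z : M ↦ g • z)
    (f := fun h : G ↦ h • x) 1 h1 (mdiff_of_smooth (smooth_orbit m n x 1))
  have h3 : MDifferentiableAt (𝓡 m) (𝓡 n) (fun h : G ↦ h • g • x) (g * 1 * g⁻¹) :=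
    mdiff_of_smooth (smooth_orbit m n (g • x) _)
  have h4 := dAt_comp (E := V) (E' := V) (E'' := W) (g := fun h : G ↦ h • g • x)
    (f := fun h : G ↦ g * h * g⁻¹) 1 h3 (mdiff_conj g 1)
  have h5 : (fun h : G ↦ g • h • x) = fun h : G ↦ (g * h * g⁻¹) • g • x := by
    funext h
    rw [mul_smul, mul_smul, inv_smul_smul]
  have h6 : g * 1 * g⁻¹ = 1 := by group
  rw [h5, h4, h6, one_smul] at h2
  exact congrArg (fun T : V →L[ℝ] W ↦ T X) h2.symm

omit [LieGroup (𝓡 m) ∞ G] [T2Space G] in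
variable (m) in
include m in
theorem dAt_smul_surjective (g : G) (x : M) :
    Function.Surjective (dAt (E := W) (E' := W) (fun z : M ↦ g • z) x) := by
  intro w
  have h1 : MDifferentiableAt (𝓡 n) (𝓡 n) (fun z : M ↦ g • z) (g⁻¹ • g • x) :=
    mdiff_of_smooth (smooth_smul m n g _)
  have h2 := dAt_comp (E := W) (E' := W) (E'' := W) (g := fun z : M ↦ g • z)
    (f := fun z : M ↦ g⁻¹ • z) (g • x) h1 (mdiff_of_smooth (smooth_smul m n g⁻¹ _))
  simp only [smul_inv_smul, dAt_id, inv_smul_smul] at h2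
  exact ⟨dAt (E := W) (E' := W) (fun z : M ↦ g⁻¹ • z) (g • x) w,
    (congrArg (fun T : W →L[ℝ] W ↦ T w) h2).symm⟩

-- Equivariance transports surjectivity from `p` to any point of the orbit.
omit [T2Space G] in
theorem orbitDeriv_surjective [MulAction.IsPretransitive G M] {p : M}
    (hsurj : Function.Surjective (orbitDeriv G (n := n) p : V → W)) (x : M) :
    Function.Surjective (orbitDeriv G (n := n) x : V → W) := by
  obtain ⟨g, rfl⟩ := MulAction.exists_smul_eq G p x
  intro w
  obtain ⟨v, rfl⟩ := dAt_smul_surjective m g p w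
  obtain ⟨X, rfl⟩ := hsurj v
  exact ⟨Ad g X, (dAt_smul_orbitDeriv g p X).symm⟩

theorem contMDiff_orbitCurve (g : G) (Y : V) (p : M) :
    ContMDiff 𝓘(ℝ, ℝ) (𝓡 n) ∞ (fun t : ℝ ↦ (g * gexp G (t • Y)) • p) :=
  (smooth_orbit m n p).comp ((smooth_mul_left g).comp (contMDiff_gexp_smul Y))

theorem dAt_orbitCurve (g : G) (Y : V) (p : M) (t : ℝ) :
    dAt (E := ℝ) (E' := W) (fun t : ℝ ↦ (g * gexp G (t • Y)) • p) t 1 =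
      dAt (E := W) (E' := W) (fun x : M ↦ (g * gexp G (t • Y)) • x) p (orbitDeriv G p Y) := by
  let δ : ℝ → M := fun s ↦ gexp G (s • Y) • p
  have hδ : ContMDiff 𝓘(ℝ, ℝ) (𝓡 n) ∞ δ := (smooth_orbit m n p).comp (contMDiff_gexp_smul Y)
  have h1 : (fun s : ℝ ↦ (g * gexp G (s • Y)) • p) =
      fun s ↦ (g * gexp G (t • Y)) • δ (s - t) := by
    funext s
    change _ = (g * gexp G (t • Y)) • gexp G ((s - t) • Y) • p
    rw [← mul_smul, mul_assoc, ← gexp_add_smul, add_sub_cancel]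
  have hsub : HasDerivAt (fun s : ℝ ↦ s - t) 1 t := (hasDerivAt_id t).sub_const t
  have h2 : dAt (E := ℝ) (E' := W) (fun s ↦ δ (s - t)) t 1 = orbitDeriv G p Y := by
    have h3 := dAt_comp (E := ℝ) (E' := ℝ) (E'' := W) (g := δ) (f := fun s : ℝ ↦ s - t) t
      (mdiff_of_smooth (hδ _)) hsub.differentiableAt.mdifferentiableAt
    rw [h3, ContinuousLinearMap.comp_apply, dAt_eq_fderiv, sub_self]
    have h4 : fderiv ℝ (fun s : ℝ ↦ s - t) t 1 = 1 := hsub.deriv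
    rw [h4]
    exact dAt_gexp_smul_point p Y
  have h0 : δ (t - t) = p := by
    change gexp G ((t - t) • Y) • p = p
    rw [sub_self, zero_smul, gexp_zero, one_smul]
  have h3 := dAt_comp (E := ℝ) (E' := W) (E'' := W)
    (g := fun x : M ↦ (g * gexp G (t • Y)) • x) (f := fun s ↦ δ (s - t)) t
    (mdiff_of_smooth (smooth_smul m n _ _))
    (MDifferentiableAt.comp (g := δ) t (mdiff_of_smooth (hδ _))
      hsub.differentiableAt.mdifferentiableAt)
  rw [h0] at h3
  rw [h1, h3, ContinuousLinearMap.comp_apply, h2]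

end OrbitMaps

/-! ### Orbit curves generated by 𝔭 are geodesics -/

section OrbitGeodesics

/-- The group `G` acts by isometries. -/
def IsometricAction {n : ℕ} (G M : Type*) [TopologicalSpace M]
    [ChartedSpace (EuclideanSpace ℝ (Fin n)) M] [SMul G M]
    [RiemannianBundle (fun x : M ↦ TangentSpace (𝓡 n) x)] : Prop :=
  ∀ (g : G) (x : M) (u v : EuclideanSpace ℝ (Fin n)), metric (n := n) (g • x)
    (dAt (E := EuclideanSpace ℝ (Fin n)) (E' := EuclideanSpace ℝ (Fin n)) (fun z : M ↦ g • z) x u)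
    (dAt (E := EuclideanSpace ℝ (Fin n)) (E' := EuclideanSpace ℝ (Fin n)) (fun z : M ↦ g • z) x v) =
      metric (n := n) x u v

variable {m : ℕ} {G : Type*} [TopologicalSpace G] [ChartedSpace (EuclideanSpace ℝ (Fin m)) G]
  [Group G] [LieGroup (𝓡 m) ∞ G] [T2Space G]
  {n : ℕ} {M : Type*} [TopologicalSpace M] [ChartedSpace (EuclideanSpace ℝ (Fin n)) M]
  [MulAction G M] [ContMDiffSMul (𝓡 m) (𝓡 n) ∞ G M]
  [RiemannianBundle (fun x : M ↦ TangentSpace (𝓡 n) x)]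

local notation "V" => EuclideanSpace ℝ (Fin m)
local notation "W" => EuclideanSpace ℝ (Fin n)

variable {θ : GroupLieAlgebra (𝓡 m) G →ₗ⁅ℝ⁆ GroupLieAlgebra (𝓡 m) G}
  (h : IsCartanInvolution θ)
  (hiso : IsometricAction (n := n) G M)

include h hiso

/-- Split `Z` along the eigenspaces of `θ`. The bracket of `Y` with the 𝔭-part is fixed by `θ`,
hence killed by the orbit differential. The fixed part generates isometries that fix `p`, and
differentiating the constant length of the image of `Y` gives the orthogonality. -/
theorem metric_orbitDeriv_bracket {K : Subgroup G}
    (hθK : ∀ X : GroupLieAlgebra (𝓡 m) G, θ X = X ↔ ∀ t : ℝ, lieExp (t • X) ∈ K)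
    {p : M} (hstab : MulAction.stabilizer G p = K) {Y : V} (hY : onModel θ Y = -Y) (Z : V) :
    metric (n := n) p (orbitDeriv G p Y) (orbitDeriv G p (bracket G Y Z)) = 0 := by
  have hk : ∀ X : V, onModel θ X = X → ∀ t : ℝ, gexp G (t • X) • p = p := by
    intro X hX t
    have h1 : gexp G (t • X) ∈ K := (hθK X).1 hX t
    rw [← hstab] at h1
    exact h1
  let Z₁ : V := (1 / 2 : ℝ) • (Z + onModel θ Z)
  let Z₂ : V := (1 / 2 : ℝ) • (Z - onModel θ Z)
  have hZ : Z = Z₁ + Z₂ := by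
    change Z = (1 / 2 : ℝ) • (Z + onModel θ Z) + (1 / 2 : ℝ) • (Z - onModel θ Z)
    module
  have hZ₁ : onModel θ Z₁ = Z₁ := by
    change onModel θ ((1 / 2 : ℝ) • (Z + onModel θ Z)) = (1 / 2 : ℝ) • (Z + onModel θ Z)
    rw [map_smul, map_add, onModel_onModel h, add_comm]
  have hZ₂ : onModel θ Z₂ = -Z₂ := by
    change onModel θ ((1 / 2 : ℝ) • (Z - onModel θ Z)) = -((1 / 2 : ℝ) • (Z - onModel θ Z))
    rw [map_smul, map_sub, onModel_onModel h]
    module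
  have h2 : orbitDeriv G (n := n) p (bracket G Y Z₂) = 0 := by
    refine orbitDeriv_eq_zero (hk _ ?_)
    rw [onModel_bracket, hY, hZ₂, bracket_neg, bracket_skew Y (-Z₂), bracket_neg, neg_neg,
      ← bracket_skew, bracket_skew, ← bracket_skew]
  have h1 : metric (n := n) p (orbitDeriv G p Y) (orbitDeriv G p (bracket G Z₁ Y)) = 0 := by
    let f : ℝ → W := fun t ↦ orbitDeriv G p (Ad (gexp G (t • Z₁)) Y)
    have hf : HasDerivAt f (orbitDeriv G p (bracket G Z₁ Y)) 0 :=
      (orbitDeriv G (n := n) p).hasFDerivAt.comp_hasDerivAt (0 : ℝ)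
        (hasDerivAt_Ad_gexp_zero (G := G) Z₁ Y)
    have hf0 : f 0 = orbitDeriv G p Y := by
      change orbitDeriv G p (Ad (gexp G ((0 : ℝ) • Z₁)) Y) = _
      rw [zero_smul, gexp_zero, Ad_one]
      rfl
    have hconst : ∀ t, metric (n := n) p (f t) (f t) = metric (n := n) p (orbitDeriv G p Y) (orbitDeriv G p Y) := by
      intro t
      have h3 := dAt_smul_orbitDeriv (n := n) (gexp G (t • Z₁)) p Y
      have h4 := hiso (gexp G (t • Z₁)) p (orbitDeriv G p Y) (orbitDeriv G p Y)
      rw [h3, hk _ hZ₁ t] at h4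
      exact h4
    have h5 : HasDerivAt (fun t ↦ metric (n := n) p (f t) (f t))
        (metric (n := n) p (orbitDeriv G p (bracket G Z₁ Y)) (f 0) +
          metric (n := n) p (f 0) (orbitDeriv G p (bracket G Z₁ Y))) 0 :=
      ((metric (n := n) p).hasFDerivAt.comp_hasDerivAt (0 : ℝ) hf).clm_apply hf
    simp only [hconst] at h5
    have h6 := h5.unique (hasDerivAt_const _ _)
    rw [hf0, metric_symm] at h6
    linarith
  rw [hZ, bracket_add, map_add, h2, add_zero, bracket_skew, map_neg, map_neg, h1, neg_zero]

/-- Moving everything back to `p` by the isometry `g exp(tY)` turns the momentum into the pairing of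
`Y` with `Ad(exp(-tY)) Ad(g⁻¹) Z`, whose derivative is a pairing with a bracket `-[Y, ·]`. -/
theorem hasDerivAt_orbit_momentum {K : Subgroup G}
    (hθK : ∀ X : GroupLieAlgebra (𝓡 m) G, θ X = X ↔ ∀ t : ℝ, lieExp (t • X) ∈ K)
    {p : M} (hstab : MulAction.stabilizer G p = K) {Y : V} (hY : onModel θ Y = -Y)
    (g : G) (Z : V) (t : ℝ) :
    HasDerivAt (fun t : ℝ ↦ metric (n := n) ((g * gexp G (t • Y)) • p)
      (dAt (E := ℝ) (E' := W) (fun t : ℝ ↦ (g * gexp G (t • Y)) • p) t 1)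
      (orbitDeriv G ((g * gexp G (t • Y)) • p) Z)) 0 t := by
  have h1 : (fun t : ℝ ↦ metric (n := n) ((g * gexp G (t • Y)) • p)
      (dAt (E := ℝ) (E' := W) (fun t : ℝ ↦ (g * gexp G (t • Y)) • p) t 1)
      (orbitDeriv G ((g * gexp G (t • Y)) • p) Z)) =
      fun t : ℝ ↦ metric (n := n) p (orbitDeriv G p Y)
        (orbitDeriv G p (Ad (gexp G (t • (-Y))) (Ad g⁻¹ Z))) := by
    funext t
    have h2 : Ad (g * gexp G (t • Y)) (Ad (gexp G (t • (-Y))) (Ad g⁻¹ Z)) = Z := by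
      rw [smul_neg, gexp_neg, ← Ad_mul_apply, ← Ad_mul_apply, mul_inv_cancel_right, mul_inv_cancel, Ad_one]
      rfl
    have h3 := dAt_smul_orbitDeriv (n := n) (g * gexp G (t • Y)) p
      (Ad (gexp G (t • (-Y))) (Ad g⁻¹ Z))
    rw [h2] at h3
    rw [dAt_orbitCurve, ← h3, hiso]
  rw [h1]
  have h2 := ((metric (n := n) p (orbitDeriv G p Y)).comp (orbitDeriv G (n := n) p)).hasFDerivAt.comp_hasDerivAt t
    (hasDerivAt_Ad_gexp (G := G) (-Y) (Ad g⁻¹ Z) t)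
  refine h2.congr_deriv ?_
  rw [ContinuousLinearMap.comp_apply, bracket_neg, map_neg, map_neg,
    metric_orbitDeriv_bracket h hiso hθK hstab hY, neg_zero]

variable [IsManifold (𝓡 n) ∞ M] [IsContMDiffRiemannianBundle (𝓡 n) ∞ (EuclideanSpace ℝ (Fin n))
      (fun x : M ↦ TangentSpace (𝓡 n) x)] [MulAction.IsPretransitive G M]

theorem isGeodesic_orbitCurve {K : Subgroup G}
    (hθK : ∀ X : GroupLieAlgebra (𝓡 m) G, θ X = X ↔ ∀ t : ℝ, lieExp (t • X) ∈ K)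
    {p : M} (hstab : MulAction.stabilizer G p = K)
    (hsurj : Function.Surjective (orbitDeriv G (n := n) p : V → W))
    {Y : V} (hY : onModel θ Y = -Y) (g : G) :
    IsGeodesic W (fun t : ℝ ↦ (g * gexp G (t • Y)) • p) := by
  have hγ := contMDiff_orbitCurve (n := n) g Y p
  refine ⟨hγ, fun c t₀ hc w ↦ ?_⟩
  set γ : ℝ → M := fun t : ℝ ↦ (g * gexp G (t • Y)) • p with hγdef
  set κ := extChartAt (𝓡 n) c with hκ
  set z₀ := κ (γ t₀) with hz₀
  have hz₀t : z₀ ∈ κ.target := κ.map_source hc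
  have hsymm₀ : κ.symm z₀ = γ t₀ := κ.left_inv hc
  -- The test direction `w` is realized at `γ t₀` by a Killing field, whose flow in the chart is `Φ`
  -- below.
  obtain ⟨Z, hZ⟩ := orbitDeriv_surjective (G := G) hsurj (γ t₀)
    (dAt (E := W) (E' := W) κ.symm z₀ w)
  let A : ℝ × W → M := fun q ↦ gexp G (q.1 • Z) • κ.symm q.2
  have hA : ∀ z ∈ κ.target, ContMDiffAt 𝓘(ℝ, ℝ × W) (𝓡 n) ∞ A (0, z) := by
    intro z hz
    have h1 : ContMDiffAt 𝓘(ℝ, ℝ × W) (𝓡 m) ∞ (fun q : ℝ × W ↦ gexp G (q.1 • Z)) (0, z) :=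
      ContMDiffAt.comp (g := fun s : ℝ ↦ gexp G (s • Z)) (f := fun q : ℝ × W ↦ q.1) (0, z)
        (contMDiff_gexp_smul Z _) contDiff_fst.contMDiff.contMDiffAt
    have h2 : ContMDiffAt 𝓘(ℝ, ℝ × W) (𝓡 n) ∞ (fun q : ℝ × W ↦ κ.symm q.2) (0, z) :=
      ContMDiffAt.comp (g := κ.symm) (f := fun q : ℝ × W ↦ q.2) (0, z)
        (contMDiffAt_chart_symm hz) contDiff_snd.contMDiff.contMDiffAt
    exact h1.smul h2
  have hA0 : ∀ z, A (0, z) = κ.symm z := by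
    intro z
    change gexp G ((0 : ℝ) • Z) • κ.symm z = κ.symm z
    rw [zero_smul, gexp_zero, one_smul]
  let Φ : ℝ × W → W := fun q ↦ κ (A q)
  have hΦ : ∀ z ∈ κ.target, ContDiffAt ℝ ∞ Φ (0, z) := fun z hz ↦
    contDiffAt_chart_comp (hA z hz) (by rw [hA0]; exact κ.map_target hz)
  have hξ : ∀ z ∈ κ.target, fderiv ℝ Φ (0, z) (1, 0) =
      dAt (E := W) (E' := W) κ (κ.symm z) (orbitDeriv G (κ.symm z) Z) := by
    intro z hz
    have hline : HasDerivAt (fun s : ℝ ↦ (s, z)) ((1 : ℝ), (0 : W)) 0 :=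
      (hasDerivAt_id (0 : ℝ)).prodMk (hasDerivAt_const (0 : ℝ) z)
    have h1 := ((hΦ z hz).differentiableAt (by simp)).hasFDerivAt.comp_hasDerivAt (0 : ℝ) hline
    have h2 : ContMDiff 𝓘(ℝ, ℝ) (𝓡 n) ∞ (fun s : ℝ ↦ gexp G (s • Z) • κ.symm z) :=
      (smooth_orbit m n (κ.symm z)).comp (contMDiff_gexp_smul Z)
    have h0 : gexp G ((0 : ℝ) • Z) • κ.symm z = κ.symm z := hA0 z
    have h3 := hasDerivAt_chart (c := c) (mdiff_of_smooth (h2 0))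
      (by rw [h0]; exact κ.map_target hz)
    rw [dAt_gexp_smul_point, h0] at h3
    exact h1.unique h3
  have hξ₀ : fderiv ℝ Φ (0, z₀) (1, 0) = w := by
    rw [hξ z₀ hz₀t, hsymm₀, hZ]
    exact dAt_chart_symm_apply hc w
  have hev : ∀ᶠ t in 𝓝 t₀, γ t ∈ κ.source :=
    hγ.continuous.continuousAt.eventually_mem ((isOpen_extChartAt_source c).mem_nhds hc)
  have hu : ContDiffAt ℝ ∞ (fun t ↦ κ (γ t)) t₀ := contDiffAt_chart_comp (hγ t₀) hc
  have hu' : DifferentiableAt ℝ (deriv (fun t ↦ κ (γ t))) t₀ := by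
    have h1 : ContDiffAt ℝ ∞ (fderiv ℝ (fun t ↦ κ (γ t))) t₀ := hu.fderiv_right (by simp)
    exact (ContinuousLinearMap.apply ℝ W (1 : ℝ)).differentiableAt.comp t₀
      (h1.differentiableAt (by simp))
  have key := hasDerivAt_momentum (Φ := Φ) (B := chartForm c) (z₀ := z₀)
    (u := fun t ↦ κ (γ t)) (u' := deriv (fun t ↦ κ (γ t))) (t₀ := t₀) (hΦ z₀ hz₀t)
    (by
      filter_upwards [(isOpen_extChartAt_target c).mem_nhds hz₀t] with z hz
      change κ (A (0, z)) = z
      rw [hA0, κ.right_inv hz])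
    ((contDiffAt_chartForm hz₀t).differentiableAt (by simp))
    (fun a b ↦ chartForm_symm c z₀ a b)
    (by
      have h1 : ∀ᶠ s in 𝓝 (0 : ℝ), A (s, z₀) ∈ κ.source := by
        have h2 : ContinuousAt (fun s : ℝ ↦ A (s, z₀)) 0 :=
          ContinuousAt.comp (g := A) (f := fun s : ℝ ↦ (s, z₀)) (hA z₀ hz₀t).continuousAt
            (by fun_prop)
        refine h2.eventually_mem ((isOpen_extChartAt_source c).mem_nhds ?_)
        rw [hA0]
        exact κ.map_target hz₀t
      filter_upwards [h1] with s hs a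
      exact chartForm_isometry (smooth_smul m n (gexp G (s • Z))) (hiso _) hz₀t hs a a)
    rfl (hu.differentiableAt (by simp)).hasDerivAt hu'.hasDerivAt
    (by
      refine (hasDerivAt_orbit_momentum h hiso hθK hstab hY g Z t₀).congr_of_eventuallyEq ?_
      filter_upwards [hev] with t ht
      rw [hξ _ (κ.map_source ht), (hasDerivAt_chart (mdiff_of_smooth (hγ t)) ht).deriv,
        κ.left_inv ht, chartForm_chart ht])
  rw [hξ₀] at key
  exact key

end OrbitGeodesics

end SymmetricSpace

namespace SymmetricSpace

open Set Filter Topology Module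

/-! ### Uniqueness of geodesics -/

section GeodesicUniqueness

variable {n : ℕ} {M : Type*} [TopologicalSpace M] [ChartedSpace (EuclideanSpace ℝ (Fin n)) M]
  [RiemannianBundle (fun x : M ↦ TangentSpace (𝓡 n) x)]

local notation "W" => EuclideanSpace ℝ (Fin n)

/-- The Gram operator of the metric in a chart. -/
noncomputable def gram (c : M) (z : W) : W →L[ℝ] W :=
  ∑ i : Fin n, ((chartForm c z).flip (EuclideanSpace.single i (1 : ℝ))).smulRight
    (EuclideanSpace.single i (1 : ℝ))

theorem gram_apply (c : M) (z a : W) : gram c z a =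
    ∑ i : Fin n, chartForm c z a (EuclideanSpace.single i (1 : ℝ)) •
      EuclideanSpace.single i (1 : ℝ) := by
  simp [gram]

theorem sum_smul_single (x : W) :
    ∑ i : Fin n, x i • EuclideanSpace.single i (1 : ℝ) = x := by
  ext j
  simp [Pi.single_apply]

/-- The lower-index quadratic part of the geodesic equation in a chart. -/
noncomputable def christoffel (c : M) (q : W × W) : W :=
  ∑ i : Fin n, ((1 / 2) * fderiv ℝ (fun z ↦ chartForm c z q.2 q.2) q.1
      (EuclideanSpace.single i (1 : ℝ)) -
    fderiv ℝ (fun z ↦ chartForm c z q.2 (EuclideanSpace.single i (1 : ℝ))) q.1 q.2) •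
      EuclideanSpace.single i (1 : ℝ)

/-- The geodesic vector field in a chart. -/
noncomputable def geodesicField (c : M) (q : W × W) : W × W :=
  (q.2, ContinuousLinearMap.inverse (gram c q.1) (christoffel c q))

variable [IsManifold (𝓡 n) ∞ M]

/-- A vector in the kernel pairs to zero with the standard basis, hence with itself, against
positivity. -/
theorem exists_gram_equiv {c : M} {z : W} (hz : z ∈ (extChartAt (𝓡 n) c).target) :
    ∃ e : W ≃L[ℝ] W, (e : W →L[ℝ] W) = gram c z := by
  have hinj : Function.Injective (gram c z).toLinearMap := by
    rw [injective_iff_map_eq_zero]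
    intro a ha
    by_contra h0
    have h1 : gram c z a = 0 := ha
    have h2 : ∀ j, chartForm c z a (EuclideanSpace.single j (1 : ℝ)) = 0 := by
      intro j
      have := congrArg (fun v : W ↦ v j) h1
      simpa [gram_apply, Pi.single_apply] using this
    have h3 : chartForm c z a a = 0 := by
      conv_lhs => rw [← sum_smul_single a]
      rw [sum_smul_single a, ← sum_smul_single a, map_sum]
      refine Finset.sum_eq_zero fun i _ ↦ ?_
      rw [map_smul, sum_smul_single a, h2, smul_zero]
    exact (chartForm_pos hz h0).ne' h3
  refine ⟨(LinearEquiv.ofInjectiveEndo _ hinj).toContinuousLinearEquiv, ?_⟩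
  ext1 v
  rfl

theorem inverse_gram_apply {c : M} {z : W} (hz : z ∈ (extChartAt (𝓡 n) c).target) (a : W) :
    ContinuousLinearMap.inverse (gram c z) (gram c z a) = a := by
  obtain ⟨e, he⟩ := exists_gram_equiv hz
  rw [← he, ContinuousLinearMap.inverse_equiv]
  exact e.symm_apply_apply a

variable [IsContMDiffRiemannianBundle (𝓡 n) ∞ (EuclideanSpace ℝ (Fin n))
      (fun x : M ↦ TangentSpace (𝓡 n) x)]

theorem contDiffAt_gram {c : M} {z : W} (hz : z ∈ (extChartAt (𝓡 n) c).target) :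
    ContDiffAt ℝ ∞ (gram (n := n) c) z := by
  have h1 : ContDiffOn ℝ ∞ (gram (n := n) c) (extChartAt (𝓡 n) c).target := by
    rw [contDiffOn_clm_apply]
    intro a
    simp only [gram_apply]
    refine ContDiffOn.sum fun i _ ↦ ?_
    exact (contDiffOn_chartMetric c a _).smul contDiffOn_const
  exact h1.contDiffAt ((isOpen_extChartAt_target c).mem_nhds hz)

theorem contDiffAt_christoffel {c : M} {q : W × W} (hq : q.1 ∈ (extChartAt (𝓡 n) c).target) :
    ContDiffAt ℝ 1 (christoffel (n := n) c) q := by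
  have hB := contDiffAt_chartForm (n := n) hq
  have hsnd : ContDiffAt ℝ ∞ (fun r : (W × W) × W ↦ r.2) (q, q.1) := contDiffAt_snd
  have hB' : ContDiffAt ℝ ∞ (fun r : (W × W) × W ↦ chartForm c r.2) (q, q.1) :=
    ContDiffAt.comp (g := chartForm c) (f := fun r : (W × W) × W ↦ r.2) (q, q.1) hB hsnd
  have hv : ContDiffAt ℝ ∞ (fun r : (W × W) × W ↦ r.1.2) (q, q.1) :=
    (contDiff_snd.comp contDiff_fst).contDiffAt
  have h12 : (1 : WithTop ℕ∞) + 1 ≤ ∞ := by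
    rw [one_add_one_eq_two]
    exact ENat.LEInfty.out
  refine ContDiffAt.sum fun i _ ↦ ?_
  have hd1 : ContDiffAt ℝ 1 (fun q : W × W ↦ fderiv ℝ (fun z ↦ chartForm c z q.2 q.2) q.1
      (EuclideanSpace.single i (1 : ℝ))) q := by
    have h1 : ContDiffAt ℝ ∞ (Function.uncurry fun (q : W × W) (z : W) ↦ chartForm c z q.2 q.2)
        (q, q.1) := (hB'.clm_apply hv).clm_apply hv
    exact (ContDiffAt.fderiv (g := fun q : W × W ↦ q.1) h1 contDiffAt_fst h12).clm_apply
      contDiffAt_const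
  have hd2 : ContDiffAt ℝ 1 (fun q : W × W ↦ fderiv ℝ
      (fun z ↦ chartForm c z q.2 (EuclideanSpace.single i (1 : ℝ))) q.1 q.2) q := by
    have h1 : ContDiffAt ℝ ∞ (Function.uncurry fun (q : W × W) (z : W) ↦
        chartForm c z q.2 (EuclideanSpace.single i (1 : ℝ))) (q, q.1) :=
      (hB'.clm_apply hv).clm_apply contDiffAt_const
    exact (ContDiffAt.fderiv (g := fun q : W × W ↦ q.1) h1 contDiffAt_fst h12).clm_apply
      contDiffAt_snd
  have hc1 : ContDiffAt ℝ 1 (fun _ : W × W ↦ (1 / 2 : ℝ)) q := contDiffAt_const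
  have hc2 : ContDiffAt ℝ 1 (fun _ : W × W ↦ (EuclideanSpace.single i (1 : ℝ) : W)) q :=
    contDiffAt_const
  exact ((hc1.mul hd1).sub hd2).smul hc2

theorem contDiffAt_geodesicField {c : M} {q : W × W} (hq : q.1 ∈ (extChartAt (𝓡 n) c).target) :
    ContDiffAt ℝ 1 (geodesicField (n := n) c) q := by
  have hA : ContDiffAt ℝ 1 (fun q : W × W ↦ gram c q.1) q :=
    ContDiffAt.comp (g := gram c) (f := fun q : W × W ↦ q.1) q
      ((contDiffAt_gram hq).of_le ENat.LEInfty.out) contDiffAt_fst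
  obtain ⟨e, he⟩ := exists_gram_equiv (n := n) hq
  have hI : ContDiffAt ℝ 1 ContinuousLinearMap.inverse (gram c q.1) := by
    rw [← he]
    exact contDiffAt_map_inverse e
  have h1 : ContDiffAt ℝ 1 (fun q : W × W ↦ ContinuousLinearMap.inverse (gram c q.1)) q :=
    ContDiffAt.comp (g := ContinuousLinearMap.inverse) (f := fun q : W × W ↦ gram c q.1) q hI hA
  exact contDiffAt_snd.prodMk (h1.clm_apply (contDiffAt_christoffel hq))

/-- The product rule in the Euler-Lagrange equation isolates `g(u'', w)`; letting `w` run over the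
basis, the inverse Gram operator solves for `u''`. -/
theorem IsGeodesic.hasDerivAt {γ : ℝ → M} (hγ : IsGeodesic W γ) {c : M} {t : ℝ}
    (ht : γ t ∈ (extChartAt (𝓡 n) c).source) :
    HasDerivAt (fun s ↦ (extChartAt (𝓡 n) c (γ s), deriv (fun r ↦ extChartAt (𝓡 n) c (γ r)) s))
      (geodesicField c (extChartAt (𝓡 n) c (γ t), deriv (fun r ↦ extChartAt (𝓡 n) c (γ r)) t)) t := by
  set u : ℝ → W := fun s ↦ extChartAt (𝓡 n) c (γ s) with hu
  have hz : u t ∈ (extChartAt (𝓡 n) c).target := (extChartAt (𝓡 n) c).map_source ht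
  have huc : ContDiffAt ℝ ∞ u t := contDiffAt_chart_comp (hγ.contMDiff t) ht
  have hu1 : HasDerivAt u (deriv u t) t := (huc.differentiableAt (by simp)).hasDerivAt
  have hu2 : HasDerivAt (deriv u) (deriv (deriv u) t) t := by
    have h1 : ContDiffAt ℝ ∞ (fderiv ℝ u) t := huc.fderiv_right (by simp)
    exact ((ContinuousLinearMap.apply ℝ W (1 : ℝ)).differentiableAt.comp t
      (h1.differentiableAt (by simp))).hasDerivAt
  refine (hu1.prodMk hu2).congr_deriv ?_
  refine Prod.ext rfl ?_
  change deriv (deriv u) t = ContinuousLinearMap.inverse (gram c (u t)) (christoffel c (u t, deriv u t))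
  rw [← inverse_gram_apply hz (deriv (deriv u) t)]
  congr 1
  rw [gram_apply]
  refine Finset.sum_congr rfl fun i _ ↦ ?_
  congr 1
  have h1 := hγ.eq c t ht (EuclideanSpace.single i (1 : ℝ))
  have h2 := hasDerivAt_bilinear (B := chartForm c)
    ((contDiffAt_chartForm hz).differentiableAt (by simp)) hu1 hu2
    (hasDerivAt_const t (EuclideanSpace.single i (1 : ℝ) : W))
  have h3 := h2.unique h1
  rw [map_zero, add_zero] at h3
  rw [eq_sub_iff_add_eq, add_comm]
  exact h3

/-- Position and velocity solve a first-order system whose field is `C¹`, hence locally Lipschitz.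
-/
theorem IsGeodesic.eventuallyEq {γ γ' : ℝ → M} (hγ : IsGeodesic W γ) (hγ' : IsGeodesic W γ')
    {c : M} {t : ℝ} (ht : γ t ∈ (extChartAt (𝓡 n) c).source)
    (ht' : γ' t ∈ (extChartAt (𝓡 n) c).source)
    (h0 : extChartAt (𝓡 n) c (γ t) = extChartAt (𝓡 n) c (γ' t))
    (h1 : deriv (fun r ↦ extChartAt (𝓡 n) c (γ r)) t = deriv (fun r ↦ extChartAt (𝓡 n) c (γ' r)) t) :
    γ =ᶠ[𝓝 t] γ' := by
  have hs : ∀ᶠ s in 𝓝 t, γ s ∈ (extChartAt (𝓡 n) c).source :=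
    hγ.contMDiff.continuous.continuousAt.eventually_mem ((isOpen_extChartAt_source c).mem_nhds ht)
  have hs' : ∀ᶠ s in 𝓝 t, γ' s ∈ (extChartAt (𝓡 n) c).source :=
    hγ'.contMDiff.continuous.continuousAt.eventually_mem ((isOpen_extChartAt_source c).mem_nhds ht')
  let f : ℝ → W × W := fun s ↦
    (extChartAt (𝓡 n) c (γ s), deriv (fun r ↦ extChartAt (𝓡 n) c (γ r)) s)
  let f' : ℝ → W × W := fun s ↦
    (extChartAt (𝓡 n) c (γ' s), deriv (fun r ↦ extChartAt (𝓡 n) c (γ' r)) s)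
  have heq : f t = f' t := Prod.ext h0 h1
  obtain ⟨K, N, hN, hK⟩ := (contDiffAt_geodesicField (n := n) (c := c) (q := f t)
    ((extChartAt (𝓡 n) c).map_source ht)).exists_lipschitzOnWith
  have hf : ContinuousAt f t := (hγ.hasDerivAt ht).continuousAt
  have hf' : ContinuousAt f' t := (hγ'.hasDerivAt ht').continuousAt
  have key : f =ᶠ[𝓝 t] f' := by
    refine ODE_solution_unique_of_eventually (v := fun _ ↦ geodesicField c) (s := fun _ ↦ N) (K := K)
      (Eventually.of_forall fun _ ↦ hK) ?_ ?_ heq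
    · filter_upwards [hs, hf.eventually_mem hN] with s hs1 hs2
      exact ⟨hγ.hasDerivAt hs1, hs2⟩
    · rw [heq] at hN
      filter_upwards [hs', hf'.eventually_mem hN] with s hs1 hs2
      exact ⟨hγ'.hasDerivAt hs1, hs2⟩
  filter_upwards [key, hs, hs'] with s hs1 hs2 hs3
  exact (extChartAt (𝓡 n) c).injOn hs2 hs3 (congrArg Prod.fst hs1)

theorem IsGeodesic.unique [T2Space M] {γ γ' : ℝ → M} (hγ : IsGeodesic W γ) (hγ' : IsGeodesic W γ')
    (h0 : γ 0 = γ' 0)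
    (h1 : dAt (E := ℝ) (E' := W) γ 0 1 = dAt (E := ℝ) (E' := W) γ' 0 1) : γ = γ' := by
  have hop : IsOpen {t | γ =ᶠ[𝓝 t] γ'} := by
    rw [isOpen_iff_mem_nhds]
    exact fun t ht ↦ eventually_eventually_nhds.2 ht
  have hcl : IsClosed {t | γ =ᶠ[𝓝 t] γ'} := by
    rw [isClosed_iff_frequently]
    -- At a limit of times of agreement, continuity gives equal position and equal velocity, so
    -- local uniqueness starts afresh there.
    intro t ht
    have ht0 : γ t = γ' t := by
      have hc : IsClosed {t | γ t = γ' t} :=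
        isClosed_eq hγ.contMDiff.continuous hγ'.contMDiff.continuous
      exact isClosed_iff_frequently.1 hc t (ht.mono fun s hs ↦ hs.self_of_nhds)
    have hsrc : γ t ∈ (extChartAt (𝓡 n) (γ t)).source := mem_extChartAt_source _
    have hsrc' : γ' t ∈ (extChartAt (𝓡 n) (γ t)).source := by rwa [← ht0]
    refine hγ.eventuallyEq hγ' hsrc hsrc' (by rw [ht0]) ?_
    have hc : ContinuousAt (deriv fun r ↦ extChartAt (𝓡 n) (γ t) (γ r)) t :=
      continuousAt_snd.comp (hγ.hasDerivAt hsrc).continuousAt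
    have hc' : ContinuousAt (deriv fun r ↦ extChartAt (𝓡 n) (γ t) (γ' r)) t :=
      continuousAt_snd.comp (hγ'.hasDerivAt hsrc').continuousAt
    refine tendsto_nhds_unique_of_frequently_eq hc.tendsto hc'.tendsto (ht.mono fun s hs ↦ ?_)
    exact Filter.EventuallyEq.deriv_eq (hs.mono fun r hr ↦ by
      change extChartAt (𝓡 n) (γ t) (γ r) = extChartAt (𝓡 n) (γ t) (γ' r)
      rw [hr])
  have hne : {t | γ =ᶠ[𝓝 t] γ'}.Nonempty := by
    refine ⟨0, ?_⟩
    have hsrc : γ 0 ∈ (extChartAt (𝓡 n) (γ 0)).source := mem_extChartAt_source _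
    have hsrc' : γ' 0 ∈ (extChartAt (𝓡 n) (γ 0)).source := by rwa [← h0]
    refine hγ.eventuallyEq hγ' hsrc hsrc' (by rw [h0]) ?_
    rw [(hasDerivAt_chart (mdiff_of_smooth (hγ.contMDiff 0)) hsrc).deriv,
      (hasDerivAt_chart (mdiff_of_smooth (hγ'.contMDiff 0)) hsrc').deriv, h1, ← h0]
  funext t
  have huniv := IsClopen.eq_univ ⟨hcl, hop⟩ hne
  exact ((Set.ext_iff.1 huniv t).2 (mem_univ t)).self_of_nhds

theorem geodesicEndpoint_eq [T2Space M] {γ : ℝ → M} (hγ : IsGeodesic W γ) {x : M} {v : W}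
    (h0 : γ 0 = x) (h1 : dAt (E := ℝ) (E' := W) γ 0 1 = v) :
    geodesicEndpoint (E := W) x v = γ 1 := by
  have hex : ∃ γ : ℝ → M, IsGeodesic W γ ∧ velocity γ 0 = (⟨x, v⟩ : TangentBundle (𝓡 n) M) :=
    ⟨γ, hγ, velocity_eq_iff.2 ⟨h0, h1⟩⟩
  have h2 := velocity_eq_iff.1 hex.choose_spec.2
  have h3 := hex.choose_spec.1.unique hγ (h2.1.trans h0.symm) (h2.2.trans h1.symm)
  exact (dif_pos hex).trans (congrFun h3 1)

end GeodesicUniqueness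

end SymmetricSpace

namespace SymmetricSpace

open Set Filter Topology Module

/-! ### Gram determinants -/

section GramDeterminant

variable {n : ℕ}

local notation "W" => EuclideanSpace ℝ (Fin n)

/-- The determinant of the matrix of a bilinear form in the standard basis. -/
noncomputable def gramDet (B : W →L[ℝ] W →L[ℝ] ℝ) : ℝ :=
  Matrix.det (Matrix.of fun i j : Fin n ↦
    B (EuclideanSpace.single i (1 : ℝ)) (EuclideanSpace.single j (1 : ℝ)))

/-- Pulling back along `T` replaces the matrix of the form by its congruence with the matrix of `T`.
-/
theorem gramDet_comp {B B' : W →L[ℝ] W →L[ℝ] ℝ} {T : W →L[ℝ] W}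
    (h : ∀ u v, B' (T u) (T v) = B u v) : gramDet B = T.det ^ 2 * gramDet B' := by
  let b := (EuclideanSpace.basisFun (Fin n) ℝ).toBasis
  let toB : (W →L[ℝ] W →L[ℝ] ℝ) → LinearMap.BilinForm ℝ W := fun B ↦
    LinearMap.mk₂ ℝ (fun u v ↦ B u v) (by simp) (by simp) (by simp) (by simp)
  have hmat : ∀ B, gramDet B = (LinearMap.BilinForm.toMatrix b (toB B)).det := by
    intro B
    unfold gramDet
    congr 1
  have h1 : toB B = (toB B').comp T.toLinearMap T.toLinearMap := by
    refine LinearMap.ext fun u ↦ LinearMap.ext fun v ↦ ?_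
    exact (h u v).symm
  rw [hmat, hmat, h1, LinearMap.BilinForm.toMatrix_comp b, Matrix.det_mul, Matrix.det_mul,
    Matrix.det_transpose, LinearMap.det_toMatrix, pow_two]
  change LinearMap.det T.toLinearMap * _ * LinearMap.det T.toLinearMap = _
  rw [ContinuousLinearMap.det]
  ring

theorem gramDet_pos {B : W →L[ℝ] W →L[ℝ] ℝ} (hsymm : ∀ u v, B u v = B v u)
    (hpos : ∀ u, u ≠ 0 → 0 < B u u) : 0 < gramDet B := by
  apply Matrix.PosDef.det_pos
  refine Matrix.PosDef.of_dotProduct_mulVec_pos ?_ fun x hx ↦ ?_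
  · ext i j
    simp [hsymm (EuclideanSpace.single j (1 : ℝ))]
  · have h0 : WithLp.toLp 2 x ≠ (0 : W) := by
      intro h0
      apply hx
      funext i
      exact congrArg (fun v : W ↦ v i) h0
    have h1 := hpos _ h0
    have h2 : B (WithLp.toLp 2 x) (WithLp.toLp 2 x) = ∑ i, ∑ j, x i * (x j *
        B (EuclideanSpace.single i (1 : ℝ)) (EuclideanSpace.single j (1 : ℝ))) := by
      conv_lhs => rw [← sum_smul_single (WithLp.toLp 2 x)]
      simp only [map_sum, map_smul, sum_apply, smul_apply,
        smul_eq_mul, Finset.mul_sum]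
      refine Finset.sum_congr rfl fun i _ ↦ Finset.sum_congr rfl fun j _ ↦ ?_
      rw [hsymm]
    rw [h2] at h1
    refine h1.trans_le (le_of_eq ?_)
    simp only [dotProduct, Matrix.mulVec, star_trivial, Matrix.of_apply, Finset.mul_sum]
    refine Finset.sum_congr rfl fun i _ ↦ Finset.sum_congr rfl fun j _ ↦ ?_
    ring

theorem continuous_gramDet : Continuous (gramDet : (W →L[ℝ] W →L[ℝ] ℝ) → ℝ) := by
  unfold gramDet
  refine Continuous.matrix_det ?_
  refine continuous_matrix fun i j ↦ ?_
  simp only [Matrix.of_apply]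
  fun_prop

end GramDeterminant

/-! ### Chart volumes under isometries -/

section ChartVolume

variable {n : ℕ} {M : Type*} [TopologicalSpace M] [ChartedSpace (EuclideanSpace ℝ (Fin n)) M]
  [IsManifold (𝓡 n) ∞ M] [MeasurableSpace M] [BorelSpace M]

local notation "W" => EuclideanSpace ℝ (Fin n)

omit [IsManifold (𝓡 n) ∞ M] in
theorem measurableSet_chart_preimage (c : M) {A : Set M} (hA : MeasurableSet A) :
    MeasurableSet ((extChartAt (𝓡 n) c).target ∩ (extChartAt (𝓡 n) c).symm ⁻¹' A) := by
  classical
  have ht : MeasurableSet (extChartAt (𝓡 n) c).target :=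
    (isOpen_extChartAt_target c).measurableSet
  have h1 : Measurable ((extChartAt (𝓡 n) c).target.piecewise (extChartAt (𝓡 n) c).symm
      fun _ ↦ c) :=
    (continuousOn_extChartAt_symm c).measurable_piecewise continuousOn_const ht
  have h2 := ht.inter (h1 hA)
  convert h2 using 1
  ext z
  simp only [mem_inter_iff, mem_preimage]
  refine and_congr_right fun hz ↦ ?_
  rw [Set.piecewise_eq_of_mem _ _ _ hz]

variable [RiemannianBundle (fun x : M ↦ TangentSpace (𝓡 n) x)]

omit [IsManifold (𝓡 n) ∞ M] in
theorem chartVolume_apply (c : M) {A : Set M} (hA : MeasurableSet A) :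
    chartVolume n c A =
      ∫⁻ z in (extChartAt (𝓡 n) c).target ∩ (extChartAt (𝓡 n) c).symm ⁻¹' A,
        ENNReal.ofReal (Real.sqrt (gramDet (chartForm (n := n) c z))) := by
  have ht : MeasurableSet (extChartAt (𝓡 n) c).target :=
    (isOpen_extChartAt_target c).measurableSet
  have h1 : AEMeasurable (extChartAt (𝓡 n) c).symm
      ((volume : Measure W).restrict (extChartAt (𝓡 n) c).target) :=
    (continuousOn_extChartAt_symm c).aemeasurable ht
  unfold chartVolume
  rw [Measure.map_apply_of_aemeasurable (h1.mono_ac (withDensity_absolutelyContinuous _ _)) hA,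
    withDensity_apply', Measure.restrict_restrict' ht, inter_comm]
  rfl

/-- An isometry maps the chart volumes into each other. -/
theorem chartVolume_isometry {f f' : M → M} (hf : ContMDiff (𝓡 n) (𝓡 n) ∞ f)
    (hiso : ∀ (x : M) (u v : W), metric (n := n) (f x) (dAt (E := W) (E' := W) f x u)
      (dAt (E := W) (E' := W) f x v) = metric (n := n) x u v)
    (hff' : Function.LeftInverse f' f) (hf'f : Function.RightInverse f' f)
    (hf'm : Measurable f') {c c' : M} {A : Set M}
    (hA : MeasurableSet A) (hAc : A ⊆ (extChartAt (𝓡 n) c).source)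
    (hAc' : ∀ x ∈ A, f x ∈ (extChartAt (𝓡 n) c').source) :
    chartVolume n c' (f' ⁻¹' A) = chartVolume n c A := by
  set κ := extChartAt (𝓡 n) c with hκ
  set κ' := extChartAt (𝓡 n) c' with hκ'
  rw [chartVolume_apply c' (hf'm hA), chartVolume_apply c hA]
  let T : W → W := fun z ↦ κ' (f (κ.symm z))
  have himg : κ'.target ∩ κ'.symm ⁻¹' (f' ⁻¹' A) = T '' (κ.target ∩ κ.symm ⁻¹' A) := by
    ext z
    constructor
    · rintro ⟨hz, hzA⟩
      have hx : f' (κ'.symm z) ∈ A := hzA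
      refine ⟨κ (f' (κ'.symm z)), ⟨κ.map_source (hAc hx), ?_⟩, ?_⟩
      · rw [mem_preimage, κ.left_inv (hAc hx)]
        exact hx
      · change κ' (f (κ.symm (κ (f' (κ'.symm z))))) = z
        rw [κ.left_inv (hAc hx), hf'f, κ'.right_inv hz]
    · rintro ⟨z, ⟨hz, hzA⟩, rfl⟩
      have h1 : f (κ.symm z) ∈ κ'.source := hAc' _ hzA
      refine ⟨κ'.map_source h1, ?_⟩
      change f' (κ'.symm (κ' (f (κ.symm z)))) ∈ A
      rw [κ'.left_inv h1, hff']
      exact hzA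
  have hT : ∀ z ∈ κ.target ∩ κ.symm ⁻¹' A,
      HasFDerivWithinAt T (fderiv ℝ T z) (κ.target ∩ κ.symm ⁻¹' A) z := by
    rintro z ⟨hz, hzA⟩
    have h1 : ContMDiffAt (𝓡 n) (𝓡 n) ∞ (fun z ↦ f (κ.symm z)) z :=
      ContMDiffAt.comp (g := f) (f := κ.symm) z (hf _) (contMDiffAt_chart_symm hz)
    have h2 : ContDiffAt ℝ ∞ T z := contDiffAt_chart_comp h1 (hAc' _ hzA)
    exact (h2.differentiableAt (by simp)).hasFDerivAt.hasFDerivWithinAt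
  have hinj : InjOn T (κ.target ∩ κ.symm ⁻¹' A) := by
    rintro z ⟨hz, hzA⟩ w ⟨hw, hwA⟩ hzw
    have h1 : f (κ.symm z) = f (κ.symm w) := κ'.injOn (hAc' _ hzA) (hAc' _ hwA) hzw
    exact κ.symm.injOn hz hw (hff'.injective h1)
  have hS := measurableSet_chart_preimage (n := n) c hA
  -- Change of variables along the coordinate expression `T` of `f`; its Jacobian is exactly the
  -- factor between the two densities.
  rw [himg, lintegral_image_eq_lintegral_abs_det_fderiv_mul volume hS hT hinj]
  refine setLIntegral_congr_fun hS fun z hz ↦ ?_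
  have h1 : gramDet (chartForm (n := n) c z) = (fderiv ℝ T z).det ^ 2 * gramDet (chartForm (n := n) c' (T z)) :=
    gramDet_comp fun u v ↦ chartForm_isometry hf hiso hz.1 (hAc' _ hz.2) u v
  change ENNReal.ofReal |(fderiv ℝ T z).det| *
    ENNReal.ofReal (Real.sqrt (gramDet (chartForm (n := n) c' (T z)))) = _
  rw [h1, Real.sqrt_mul (sq_nonneg _), Real.sqrt_sq_eq_abs, ENNReal.ofReal_mul (abs_nonneg _)]

/-- Independence of the chart is the case of the identity, an isometry read in two charts. -/
theorem chartVolume_eq {c c' : M} {A : Set M} (hA : MeasurableSet A)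
    (hAc : A ⊆ (extChartAt (𝓡 n) c).source) (hAc' : A ⊆ (extChartAt (𝓡 n) c').source) :
    chartVolume n c' A = chartVolume n c A :=
  chartVolume_isometry (f := fun x ↦ x) (f' := fun x ↦ x) contMDiff_id
    (fun x u v ↦ by rw [dAt_id]; rfl) (fun _ ↦ rfl) (fun _ ↦ rfl) measurable_id hA hAc hAc'

end ChartVolume

/-! ### Invariance, local finiteness and positivity of the Riemannian volume -/

section RiemannianVolume

variable {n : ℕ} {M : Type*} [TopologicalSpace M] [ChartedSpace (EuclideanSpace ℝ (Fin n)) M]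
  [IsManifold (𝓡 n) ∞ M] [MeasurableSpace M] [BorelSpace M]
  [RiemannianBundle (fun x : M ↦ TangentSpace (𝓡 n) x)] [SecondCountableTopology M] [Nonempty M]

local notation "W" => EuclideanSpace ℝ (Fin n)

/-- A countable atlas. -/
noncomputable def atlasPoint (n : ℕ) (M : Type*) [TopologicalSpace M]
    [ChartedSpace (EuclideanSpace ℝ (Fin n)) M] [SecondCountableTopology M] [Nonempty M] : ℕ → M :=
  (exists_chart_cover n M).choose

/-- A decomposition of the manifold into pieces of chart domains. -/
def atlasPiece (n : ℕ) (M : Type*) [TopologicalSpace M]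
    [ChartedSpace (EuclideanSpace ℝ (Fin n)) M] [SecondCountableTopology M] [Nonempty M] :
    ℕ → Set M :=
  disjointed fun j ↦ (extChartAt (𝓡 n) (atlasPoint n M j)).source

omit [IsManifold (𝓡 n) ∞ M] [RiemannianBundle (fun x : M ↦ TangentSpace (𝓡 n) x)] in
theorem measurableSet_atlasPiece (i : ℕ) : MeasurableSet (atlasPiece n M i) :=
  MeasurableSet.disjointed (fun _ ↦ (isOpen_extChartAt_source _).measurableSet) i

omit [IsManifold (𝓡 n) ∞ M] [RiemannianBundle (fun x : M ↦ TangentSpace (𝓡 n) x)]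
  [MeasurableSpace M] [BorelSpace M] in
theorem atlasPiece_subset (i : ℕ) :
    atlasPiece n M i ⊆ (extChartAt (𝓡 n) (atlasPoint n M i)).source :=
  disjointed_subset _ i

omit [IsManifold (𝓡 n) ∞ M] [RiemannianBundle (fun x : M ↦ TangentSpace (𝓡 n) x)]
  [MeasurableSpace M] [BorelSpace M] in
theorem iUnion_atlasPiece : ⋃ i, atlasPiece n M i = univ :=
  iUnion_disjointed.trans (exists_chart_cover n M).choose_spec

omit [IsManifold (𝓡 n) ∞ M] [RiemannianBundle (fun x : M ↦ TangentSpace (𝓡 n) x)]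
  [MeasurableSpace M] [BorelSpace M] in
theorem pairwise_disjoint_atlasPiece : Pairwise (Function.onFun Disjoint (atlasPiece n M)) :=
  disjoint_disjointed _

omit [IsManifold (𝓡 n) ∞ M] [RiemannianBundle (fun x : M ↦ TangentSpace (𝓡 n) x)] in
theorem measure_eq_tsum_atlasPiece (μ : Measure M) {f : M → M} (hf : Measurable f) {A : Set M}
    (hA : MeasurableSet A) : μ A = ∑' i, μ (A ∩ f ⁻¹' atlasPiece n M i) := by
  conv_lhs => rw [← inter_univ A, ← preimage_univ (f := f), ← iUnion_atlasPiece (n := n) (M := M),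
    preimage_iUnion, inter_iUnion]
  exact measure_iUnion (fun i j hij ↦ ((pairwise_disjoint_atlasPiece hij).preimage f).mono
    inter_subset_right inter_subset_right) fun i ↦ hA.inter (hf (measurableSet_atlasPiece i))

omit [IsManifold (𝓡 n) ∞ M] [BorelSpace M] in
theorem riemannianVolume_apply [BorelSpace M] {A : Set M} (hA : MeasurableSet A) :
    riemannianVolume n M A =
      ∑' i, chartVolume n (atlasPoint n M i) (A ∩ atlasPiece n M i) := by
  unfold riemannianVolume
  rw [Measure.sum_apply _ hA]
  exact tsum_congr fun i ↦ Measure.restrict_apply hA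

theorem riemannianVolume_eq_chartVolume {c : M} {A : Set M} (hA : MeasurableSet A)
    (hAc : A ⊆ (extChartAt (𝓡 n) c).source) :
    riemannianVolume n M A = chartVolume n c A := by
  rw [riemannianVolume_apply hA, measure_eq_tsum_atlasPiece (n := n) (chartVolume n c) measurable_id hA]
  exact tsum_congr fun i ↦ chartVolume_eq (hA.inter (measurableSet_atlasPiece i))
    (inter_subset_left.trans hAc) (inter_subset_right.trans (atlasPiece_subset i))

/-- Cut the set twice, by the atlas piece of a point and by that of its image. Each part then sits
in one chart before and after `f`, where the chart computation applies. -/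
theorem riemannianVolume_isometry {f f' : M → M} (hf : ContMDiff (𝓡 n) (𝓡 n) ∞ f)
    (hiso : ∀ (x : M) (u v : W), metric (n := n) (f x) (dAt (E := W) (E' := W) f x u)
      (dAt (E := W) (E' := W) f x v) = metric (n := n) x u v)
    (hff' : Function.LeftInverse f' f) (hf'f : Function.RightInverse f' f)
    (hfm : Measurable f) (hf'm : Measurable f') {A : Set M} (hA : MeasurableSet A) :
    riemannianVolume n M (f' ⁻¹' A) = riemannianVolume n M A := by
  have h1 : ∀ B : Set M, MeasurableSet B → ∀ i j, B ⊆ atlasPiece n M i → B ⊆ f ⁻¹' atlasPiece n M j →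
      (riemannianVolume n M).map f' B = riemannianVolume n M B := by
    intro B hB i j hBi hBj
    have h2 : f' ⁻¹' B ⊆ (extChartAt (𝓡 n) (atlasPoint n M j)).source := by
      intro x hx
      have h3 : f (f' x) ∈ atlasPiece n M j := hBj hx
      rw [hf'f] at h3
      exact atlasPiece_subset j h3
    rw [Measure.map_apply hf'm hB, riemannianVolume_eq_chartVolume (hf'm hB) h2,
      riemannianVolume_eq_chartVolume hB (hBi.trans (atlasPiece_subset i))]
    exact chartVolume_isometry hf hiso hff' hf'f hf'm hB (hBi.trans (atlasPiece_subset i))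
      fun x hx ↦ atlasPiece_subset j (hBj hx)
  rw [← Measure.map_apply hf'm hA, measure_eq_tsum_atlasPiece (n := n) _ measurable_id hA,
    measure_eq_tsum_atlasPiece (n := n) (riemannianVolume n M) measurable_id hA]
  refine tsum_congr fun i ↦ ?_
  have hAi : MeasurableSet (A ∩ id ⁻¹' atlasPiece n M i) := hA.inter (measurableSet_atlasPiece i)
  rw [measure_eq_tsum_atlasPiece (n := n) _ hfm hAi,
    measure_eq_tsum_atlasPiece (n := n) (riemannianVolume n M) hfm hAi]
  exact tsum_congr fun j ↦ h1 _ (hAi.inter (hfm (measurableSet_atlasPiece j))) i j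
    (inter_subset_left.trans inter_subset_right) inter_subset_right

variable [IsContMDiffRiemannianBundle (𝓡 n) ∞ (EuclideanSpace ℝ (Fin n))
      (fun x : M ↦ TangentSpace (𝓡 n) x)]

omit [MeasurableSpace M] [BorelSpace M] [SecondCountableTopology M] [Nonempty M] in
theorem continuousOn_volumeDensity (c : M) :
    ContinuousOn (fun z ↦ Real.sqrt (gramDet (chartForm (n := n) c z)))
      (extChartAt (𝓡 n) c).target :=
  (Real.continuous_sqrt.comp continuous_gramDet).comp_continuousOn
    (contDiffOn_chartForm c).continuousOn

/-- The density is continuous, hence bounded on a compact coordinate neighbourhood. -/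
instance isLocallyFiniteMeasure_riemannianVolume :
    IsLocallyFiniteMeasure (riemannianVolume n M) := by
  refine ⟨fun x ↦ ?_⟩
  set κ := extChartAt (𝓡 n) x with hκ
  obtain ⟨S, hS, hxS, hSt⟩ := exists_compact_subset (isOpen_extChartAt_target x)
    (mem_extChartAt_target (I := 𝓡 n) x)
  have hop : IsOpen (κ.source ∩ κ ⁻¹' interior S) :=
    (continuousOn_extChartAt x).isOpen_inter_preimage (isOpen_extChartAt_source x) isOpen_interior
  refine ⟨κ.source ∩ κ ⁻¹' interior S, hop.mem_nhds ⟨mem_extChartAt_source x, hxS⟩, ?_⟩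
  rw [riemannianVolume_eq_chartVolume (c := x) hop.measurableSet inter_subset_left,
    chartVolume_apply x hop.measurableSet]
  have hsub : κ.target ∩ κ.symm ⁻¹' (κ.source ∩ κ ⁻¹' interior S) ⊆ S := by
    rintro z ⟨hz, -, hzS⟩
    have h1 : κ (κ.symm z) ∈ interior S := hzS
    rw [κ.right_inv hz] at h1
    exact interior_subset h1
  obtain ⟨C, hC⟩ := hS.exists_bound_of_continuousOn ((continuousOn_volumeDensity x).mono hSt)
  calc _ ≤ ∫⁻ z in S, ENNReal.ofReal (Real.sqrt (gramDet (chartForm (n := n) x z))) :=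
        lintegral_mono_set hsub
    _ ≤ ∫⁻ _ in S, ENNReal.ofReal C := by
        refine setLIntegral_mono' hS.measurableSet fun z hz ↦ ENNReal.ofReal_le_ofReal ?_
        exact (le_abs_self _).trans (hC z hz)
    _ = ENNReal.ofReal C * volume S := setLIntegral_const _ _
    _ < ⊤ := ENNReal.mul_lt_top ENNReal.ofReal_lt_top hS.measure_lt_top

/-- The density is strictly positive, so a null open set would have Lebesgue-null, yet open and
nonempty, coordinates. -/
instance isOpenPosMeasure_riemannianVolume : (riemannianVolume n M).IsOpenPosMeasure := by
  refine ⟨fun U hU ⟨x, hxU⟩ h0 ↦ ?_⟩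
  set κ := extChartAt (𝓡 n) x with hκ
  have hop : IsOpen (κ.target ∩ κ.symm ⁻¹' (U ∩ κ.source)) :=
    (continuousOn_extChartAt_symm x).isOpen_inter_preimage (isOpen_extChartAt_target x)
      (hU.inter (isOpen_extChartAt_source x))
  have hs : MeasurableSet (U ∩ κ.source) :=
    (hU.inter (isOpen_extChartAt_source x)).measurableSet
  have h1 : chartVolume n x (U ∩ κ.source) = 0 := by
    rw [← riemannianVolume_eq_chartVolume hs inter_subset_right]
    exact measure_mono_null inter_subset_left h0
  rw [chartVolume_apply x hs, lintegral_eq_zero_iff' (((continuousOn_volumeDensity x).mono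
    inter_subset_left).aemeasurable hop.measurableSet).ennreal_ofReal,
    Filter.EventuallyEq, ae_restrict_iff' hop.measurableSet] at h1
  have h3 : ∀ᵐ z ∂(volume : Measure W), z ∉ κ.target ∩ κ.symm ⁻¹' (U ∩ κ.source) := by
    filter_upwards [h1] with z hz hzt
    have h4 : 0 < gramDet (chartForm (n := n) x z) :=
      gramDet_pos (chartForm_symm x z) fun u hu ↦ chartForm_pos hzt.1 hu
    have h5 := hz hzt
    rw [Pi.zero_apply, ENNReal.ofReal_eq_zero] at h5
    exact h5.not_gt (Real.sqrt_pos.2 h4)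
  have hne : (κ.target ∩ κ.symm ⁻¹' (U ∩ κ.source)).Nonempty := by
    refine ⟨κ x, mem_extChartAt_target x, ?_⟩
    rw [mem_preimage, extChartAt_to_inv]
    exact ⟨hxU, mem_extChartAt_source x⟩
  exact hop.measure_ne_zero volume hne (measure_eq_zero_iff_ae_notMem.2 h3)

end RiemannianVolume

end SymmetricSpace

namespace SymmetricSpace

open Set Filter Topology Module

/-! ### Functions on the quotient -/

section Descend

variable {G : Type*} [Group G] {M : Type*} [MulAction G M] {K : Subgroup G} {o : M}
  {𝕜 : Type*} [Zero 𝕜]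

theorem descend_smul (hstab : MulAction.stabilizer G o = K) {φ : G → 𝕜}
    (hφ : ∀ g, ∀ k ∈ K, φ (g * k) = φ g) (g : G) : descend o φ (g • o) = φ g := by
  refine Function.FactorsThrough.extend_apply (f := fun g : G ↦ g • o) ?_ (0 : M → 𝕜) g
  intro a b hab
  have h : a⁻¹ * b ∈ K := by
    rw [← hstab, MulAction.mem_stabilizer_iff, mul_smul, ← show a • o = b • o from hab,
      inv_smul_smul]
  simpa using (hφ a _ h).symm

variable [TopologicalSpace G] [IsTopologicalGroup G] [TopologicalSpace M] [ContinuousSMul G M]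
  [MulAction.IsPretransitive G M]

omit [IsTopologicalGroup G] in
theorem hasCompactSupport_descend [T2Space M] (hstab : MulAction.stabilizer G o = K) {φ : G → 𝕜}
    (hφ : ∀ g, ∀ k ∈ K, φ (g * k) = φ g) (hc : HasCompactSupport φ) :
    HasCompactSupport (descend o φ) := by
  refine HasCompactSupport.intro (hc.isCompact.image
    (continuous_id.smul continuous_const : Continuous fun g : G ↦ g • o)) fun x hx ↦ ?_
  obtain ⟨g, rfl⟩ := MulAction.exists_smul_eq G o x
  rw [descend_smul hstab hφ]
  by_contra h
  exact hx ⟨g, subset_tsupport _ h, rfl⟩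

/-- A transitive action of a σ-compact group on a Baire Hausdorff space has open orbit maps, so the
orbit map is a quotient map. -/
theorem continuous_descend [SigmaCompactSpace G] [BaireSpace M] [T2Space M] [TopologicalSpace 𝕜]
    (hstab : MulAction.stabilizer G o = K) {φ : G → 𝕜}
    (hφ : ∀ g, ∀ k ∈ K, φ (g * k) = φ g) (hc : Continuous φ) : Continuous (descend o φ) := by
  have hq : IsQuotientMap fun g : G ↦ g • o :=
    (isOpenMap_smul_of_sigmaCompact o).isQuotientMap (continuous_id.smul continuous_const)
      (MulAction.exists_smul_eq G o)
  rw [hq.continuous_iff]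
  convert hc using 1
  exact funext (descend_smul hstab hφ)

end Descend

/-! ### Integration along the cosets of the stabilizer -/

section FiberIntegral

variable {G : Type*} [Group G] [TopologicalSpace G] [IsTopologicalGroup G] [MeasurableSpace G]
  [BorelSpace G] {K : Subgroup G} {dk : Measure K}

variable (dk) in
/-- The integral of a function on `G` along the left cosets of `K`. -/
noncomputable def fiberIntegral (f : G → ℝ) (g : G) : ℝ := ∫ k : K, f (g * k) ∂dk

theorem fiberIntegral_mul_right [dk.IsMulLeftInvariant] (f : G → ℝ) (g : G) :
    ∀ k ∈ K, fiberIntegral dk f (g * k) = fiberIntegral dk f g := by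
  intro k hk
  have h := integral_mul_left_eq_self (μ := dk) (fun k' : K ↦ f (g * k')) ⟨k, hk⟩
  simpa [fiberIntegral, mul_assoc] using h

omit [TopologicalSpace G] [IsTopologicalGroup G] [BorelSpace G] in
theorem fiberIntegral_mul_left (f : G → ℝ) (a g : G) :
    fiberIntegral dk (fun x ↦ f (a * x)) g = fiberIntegral dk f (a * g) := by
  simp [fiberIntegral, mul_assoc]

omit [TopologicalSpace G] [IsTopologicalGroup G] [BorelSpace G] in
theorem fiberIntegral_eq_self [IsProbabilityMeasure dk] {f : G → ℝ}
    (hf : ∀ g, ∀ k ∈ K, f (g * k) = f g) : fiberIntegral dk f = f := by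
  funext g
  simp [fiberIntegral, fun k : K ↦ hf g k k.2]

omit [BorelSpace G] in
theorem hasCompactSupport_fiberIntegral [CompactSpace K] [T2Space G] {f : G → ℝ}
    (hf : HasCompactSupport f) :
    HasCompactSupport (fiberIntegral dk f) := by
  refine HasCompactSupport.intro
    (hf.isCompact.mul (isCompact_iff_compactSpace.2 ‹_› : IsCompact (K : Set G))) fun g hg ↦ ?_
  refine integral_eq_zero_of_ae (Eventually.of_forall fun k ↦ ?_)
  by_contra h
  exact hg ⟨g * k, subset_tsupport _ h, (k : G)⁻¹, inv_mem k.2, by simp⟩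

theorem continuous_fiberIntegral [FirstCountableTopology G] [LocallyCompactSpace G]
    [CompactSpace K] [IsFiniteMeasureOnCompacts dk] [SecondCountableTopology G] {f : G → ℝ}
    (hf : Continuous f) : Continuous (fiberIntegral dk f) := by
  have h := continuous_parametric_integral_of_continuous (μ := dk)
    (f := fun (g : G) (k : K) ↦ f (g * k)) (by fun_prop) (s := univ) isCompact_univ
  simp only [setIntegral_univ] at h
  exact h

theorem integrable_fiber [CompactSpace K] [IsFiniteMeasureOnCompacts dk] {f : G → ℝ}
    (hf : Continuous f) (g : G) : Integrable (fun k : K ↦ f (g * k)) dk :=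
  Continuous.integrable_of_hasCompactSupport (by fun_prop)
    (HasCompactSupport.of_compactSpace _)

end FiberIntegral

/-! ### The Haar measure determined by the quotient integral formula -/

section QuotientMeasure

variable {G : Type*} [Group G] [TopologicalSpace G] [IsTopologicalGroup G] [MeasurableSpace G]
  [BorelSpace G] [T2Space G] [LocallyCompactSpace G] [SecondCountableTopology G]
  {K : Subgroup G} [CompactSpace K] {dk : Measure K} [dk.IsHaarMeasure]
  {M : Type*} [TopologicalSpace M] [T2Space M] [BaireSpace M] [MeasurableSpace M]
  [BorelSpace M] [MulAction G M] [ContinuousSMul G M] [MulAction.IsPretransitive G M]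
  {o : M} {μ : Measure M} [IsFiniteMeasureOnCompacts μ]

/-- The function `g • o ↦ ∫ f(gk) dk` on `M = G/K`. -/
noncomputable def cosetIntegral (dk : Measure K) (o : M) (f : G → ℝ) : M → ℝ :=
  descend o (fiberIntegral dk f)

omit [T2Space G] [LocallyCompactSpace G] [SecondCountableTopology G] [CompactSpace K]
  [TopologicalSpace M] [T2Space M] [BaireSpace M] [MeasurableSpace M] [BorelSpace M]
  [ContinuousSMul G M] [MulAction.IsPretransitive G M] in
theorem cosetIntegral_smul (hstab : MulAction.stabilizer G o = K) (f : G → ℝ) (g : G) :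
    cosetIntegral dk o f (g • o) = fiberIntegral dk f g :=
  descend_smul hstab (fiberIntegral_mul_right f) g

omit [MeasurableSpace M] [BorelSpace M] in
theorem continuous_cosetIntegral (hstab : MulAction.stabilizer G o = K) {f : G → ℝ}
    (hf : Continuous f) : Continuous (cosetIntegral dk o f) :=
  continuous_descend hstab (fiberIntegral_mul_right f) (continuous_fiberIntegral hf)

omit [LocallyCompactSpace G] [SecondCountableTopology G] [BaireSpace M] [MeasurableSpace M]
  [BorelSpace M] in
theorem hasCompactSupport_cosetIntegral (hstab : MulAction.stabilizer G o = K) {f : G → ℝ}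
    (hf : HasCompactSupport f) : HasCompactSupport (cosetIntegral dk o f) :=
  hasCompactSupport_descend hstab (fiberIntegral_mul_right f) (hasCompactSupport_fiberIntegral hf)

theorem integrable_cosetIntegral (hstab : MulAction.stabilizer G o = K) {f : G → ℝ}
    (hf : Continuous f) (hc : HasCompactSupport f) : Integrable (cosetIntegral dk o f) μ :=
  (continuous_cosetIntegral hstab hf).integrable_of_hasCompactSupport
    (hasCompactSupport_cosetIntegral hstab hc)

open CompactlySupported

variable (dk μ) in
/-- The positive functional `f ↦ ∫_{G/K} (∫_K f(gk) dk) dμ(gK)` on `C_c(G)`. -/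
noncomputable def quotientFunctional (hstab : MulAction.stabilizer G o = K) : C_c(G, ℝ) →ₚ[ℝ] ℝ :=
  PositiveLinearMap.mk₀
    { toFun := fun f ↦ ∫ x, cosetIntegral dk o f x ∂μ
      map_add' := fun f g ↦ by
        rw [← integral_add (integrable_cosetIntegral (f := f) hstab f.continuous f.hasCompactSupport)
          (integrable_cosetIntegral (f := g) hstab g.continuous g.hasCompactSupport)]
        refine integral_congr_ae (Eventually.of_forall fun x ↦ ?_)
        obtain ⟨a, rfl⟩ := MulAction.exists_smul_eq G o x
        simp only [cosetIntegral_smul hstab]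
        exact integral_add (integrable_fiber f.continuous a) (integrable_fiber g.continuous a)
      map_smul' := fun c f ↦ by
        rw [RingHom.id_apply, smul_eq_mul, ← integral_const_mul]
        refine integral_congr_ae (Eventually.of_forall fun x ↦ ?_)
        obtain ⟨a, rfl⟩ := MulAction.exists_smul_eq G o x
        simp only [cosetIntegral_smul hstab]
        exact integral_const_mul c _ }
    fun f hf ↦ by
      refine integral_nonneg fun x ↦ ?_
      obtain ⟨a, rfl⟩ := MulAction.exists_smul_eq G o x
      rw [cosetIntegral_smul hstab]
      exact integral_nonneg fun k ↦ hf _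

theorem integral_rieszMeasure_quotientFunctional (hstab : MulAction.stabilizer G o = K) {f : G → ℝ}
    (hf : Continuous f) (hc : HasCompactSupport f) :
    ∫ g, f g ∂(RealRMK.rieszMeasure (quotientFunctional dk μ hstab)) =
      ∫ x, cosetIntegral dk o f x ∂μ :=
  RealRMK.integral_rieszMeasure (quotientFunctional dk μ hstab) ⟨⟨f, hf⟩, hc⟩

/-- Coset integration commutes with left translation and `μ` is invariant, so the functional is
invariant; regular measures are determined by their integrals over `C_c(G)`. -/
theorem isMulLeftInvariant_rieszMeasure_quotientFunctional [SMulInvariantMeasure G M μ]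
    (hstab : MulAction.stabilizer G o = K) :
    (RealRMK.rieszMeasure (quotientFunctional dk μ hstab)).IsMulLeftInvariant := by
  refine ⟨fun a ↦ ?_⟩
  set ν := RealRMK.rieszMeasure (quotientFunctional dk μ hstab) with hν
  have : (ν.map (a * ·)).Regular := Measure.Regular.map (Homeomorph.mulLeft a)
  refine Measure.ext_of_integral_eq_on_compactlySupported fun f ↦ ?_
  have hfa : Continuous fun g ↦ f (a * g) := by fun_prop
  have hca : HasCompactSupport fun g ↦ f (a * g) :=
    f.hasCompactSupport.comp_homeomorph (Homeomorph.mulLeft a)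
  rw [integral_map (by fun_prop) (by fun_prop),
    integral_rieszMeasure_quotientFunctional hstab hfa hca,
    integral_rieszMeasure_quotientFunctional (f := f) hstab f.continuous f.hasCompactSupport,
    ← integral_smul_eq_self (cosetIntegral dk o f) (g := a)]
  refine integral_congr_ae (Eventually.of_forall fun x ↦ ?_)
  obtain ⟨b, rfl⟩ := MulAction.exists_smul_eq G o x
  simp only [smul_smul, cosetIntegral_smul hstab, fiberIntegral_mul_left]

/-- Test on a nonnegative bump at `1`: its integral over `K` is positive, so its coset integral is
positive at `o`, and `μ` charges open sets. -/
theorem rieszMeasure_quotientFunctional_ne_zero [μ.IsOpenPosMeasure]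
    (hstab : MulAction.stabilizer G o = K) :
    RealRMK.rieszMeasure (quotientFunctional dk μ hstab) ≠ 0 := by
  intro h0
  obtain ⟨f, hc, hf, hf1⟩ := exists_continuous_nonneg_pos (1 : G)
  have h1 := integral_rieszMeasure_quotientFunctional (dk := dk) (μ := μ) hstab f.continuous hc
  rw [h0, integral_zero_measure] at h1
  refine (Continuous.integral_pos_of_hasCompactSupport_nonneg_nonzero (μ := μ) (x := o)
    (continuous_cosetIntegral (dk := dk) hstab f.continuous)
    (hasCompactSupport_cosetIntegral hstab hc) (fun x ↦ ?_) ?_).ne h1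
  · obtain ⟨a, rfl⟩ := MulAction.exists_smul_eq G o x
    rw [cosetIntegral_smul hstab]
    exact integral_nonneg fun k ↦ hf _
  · have h2 : 0 < ∫ k : K, f k ∂dk :=
      Continuous.integral_pos_of_hasCompactSupport_nonneg_nonzero (x := 1)
        (f.continuous.comp continuous_subtype_val) (HasCompactSupport.of_compactSpace _)
        (fun k ↦ hf _) hf1
    have h3 := cosetIntegral_smul (dk := dk) hstab f 1
    rw [one_smul] at h3
    rw [h3]
    simpa [fiberIntegral] using h2.ne'

theorem existsUnique_isHaarMeasure_quotient [SMulInvariantMeasure G M μ] [μ.IsOpenPosMeasure]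
    (hstab : MulAction.stabilizer G o = K) :
    ∃! dg : Measure G, dg.IsHaarMeasure ∧ ∀ f : G → ℝ, Continuous f → HasCompactSupport f →
      ∫ g, f g ∂dg = ∫ x, cosetIntegral dk o f x ∂μ := by
  have h1 := isMulLeftInvariant_rieszMeasure_quotientFunctional (dk := dk) (μ := μ) hstab
  have h2 : NeZero (RealRMK.rieszMeasure (quotientFunctional dk μ hstab)) :=
    ⟨rieszMeasure_quotientFunctional_ne_zero hstab⟩
  refine ⟨RealRMK.rieszMeasure (quotientFunctional dk μ hstab), ⟨{}, fun f hf hc ↦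
    integral_rieszMeasure_quotientFunctional hstab hf hc⟩, fun ν ⟨hν, h⟩ ↦ ?_⟩
  refine Measure.ext_of_integral_eq_on_compactlySupported fun f ↦ ?_
  rw [h f f.continuous f.hasCompactSupport,
    integral_rieszMeasure_quotientFunctional (f := f) hstab f.continuous f.hasCompactSupport]

-- For a right-`K`-invariant function the inner integral changes nothing, as `dk` has mass one. The
-- formula, known for real test functions, is applied to real and imaginary parts.
omit [T2Space G] [CompactSpace ↥K] in
theorem integral_eq_integral_descend [IsProbabilityMeasure dk] {dg : Measure G}
    [dg.IsHaarMeasure] (hstab : MulAction.stabilizer G o = K)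
    (h : ∀ f : G → ℝ, Continuous f → HasCompactSupport f →
      ∫ g, f g ∂dg = ∫ x, cosetIntegral dk o f x ∂μ)
    {𝕜 : Type*} [RCLike 𝕜] {f : G → 𝕜} (hf : Continuous f) (hc : HasCompactSupport f)
    (hK : ∀ g, ∀ k ∈ K, f (g * k) = f g) :
    Integrable (descend o f) μ ∧ Integrable f dg ∧ ∫ x, descend o f x ∂μ = ∫ g, f g ∂dg := by
  have hi : Integrable (descend o f) μ :=
    (continuous_descend hstab hK hf).integrable_of_hasCompactSupport
      (hasCompactSupport_descend hstab hK hc)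
  have hi' : Integrable f dg := hf.integrable_of_hasCompactSupport hc
  have key : ∀ L : 𝕜 →ₗ[ℝ] ℝ, Continuous L → ∫ g, L (f g) ∂dg = ∫ x, L (descend o f x) ∂μ := by
    intro L hL
    rw [h (fun g ↦ L (f g)) (hL.comp hf) (hc.comp_left (map_zero L))]
    refine integral_congr_ae (Eventually.of_forall fun x ↦ ?_)
    obtain ⟨b, rfl⟩ := MulAction.exists_smul_eq G o x
    simp only [cosetIntegral_smul hstab, descend_smul hstab hK]
    rw [fiberIntegral_eq_self fun g k hk ↦ by rw [hK g k hk]]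
  refine ⟨hi, hi', ?_⟩
  apply RCLike.ext
  · rw [← integral_re hi, ← integral_re hi']
    exact (key RCLike.reLm RCLike.continuous_re).symm
  · rw [← integral_im hi, ← integral_im hi']
    exact (key RCLike.imLm RCLike.continuous_im).symm

end QuotientMeasure

end SymmetricSpace

namespace SymmetricSpace

open Set Filter Topology Module

/-! ### The Möbius sum as multiplication in the group -/

section MobiusSum

variable {m : ℕ} {G : Type*} [TopologicalSpace G] [ChartedSpace (EuclideanSpace ℝ (Fin m)) G]
  [Group G] [LieGroup (𝓡 m) ∞ G] [T2Space G]
  {n : ℕ} {M : Type*} [TopologicalSpace M] [ChartedSpace (EuclideanSpace ℝ (Fin n)) M]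
  [MulAction G M] [ContMDiffSMul (𝓡 m) (𝓡 n) ∞ G M]

local notation "V" => EuclideanSpace ℝ (Fin m)
local notation "W" => EuclideanSpace ℝ (Fin n)

variable {θ : GroupLieAlgebra (𝓡 m) G →ₗ⁅ℝ⁆ GroupLieAlgebra (𝓡 m) G}
  (h : IsCartanInvolution θ) {K : Subgroup G}
  (hθK : ∀ X : GroupLieAlgebra (𝓡 m) G, θ X = X ↔ ∀ t : ℝ, lieExp (t • X) ∈ K)
  {p : M} (hstab : MulAction.stabilizer G p = K)

include h hθK hstab

omit [TopologicalSpace M] in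
theorem polarVector_gexp_smul {X : V} (hX : onModel θ X = -X) :
    polarVector θ p (gexp G X • p) = (X : GroupLieAlgebra (𝓡 m) G) := by
  have hex : ∃ Y : GroupLieAlgebra (𝓡 m) G, θ Y = -Y ∧ lieExp Y • p = gexp G X • p :=
    ⟨X, hX, rfl⟩
  exact (dif_pos hex).trans
    (polar_unique h hθK hstab (X := hex.choose) hex.choose_spec.1 hX hex.choose_spec.2)

omit [TopologicalSpace M] in
theorem mobiusNeg_gexp_smul {X : V} (hX : onModel θ X = -X) :
    mobiusNeg θ p (gexp G X • p) = gexp G (-X) • p := by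
  rw [mobiusNeg, polarVector_gexp_smul h hθK hstab hX]
  rfl

variable [T2Space M] [IsManifold (𝓡 n) ∞ M]
  [RiemannianBundle (fun x : M ↦ TangentSpace (𝓡 n) x)]
  [IsContMDiffRiemannianBundle (𝓡 n) ∞ (EuclideanSpace ℝ (Fin n))
      (fun x : M ↦ TangentSpace (𝓡 n) x)] [MulAction.IsPretransitive G M]
  (hiso : IsometricAction (n := n) G M)

include hiso

/-- The geodesic `t ↦ exp(X) exp(tY) • p` has the prescribed initial point and velocity, and by
uniqueness it is the one that defines the sum. -/
theorem mobiusAdd_gexp_smul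
    (hsurj : Function.Surjective (orbitDeriv G (n := n) p : V → W))
    {X Y : V} (hX : onModel θ X = -X) (hY : onModel θ Y = -Y) :
    mobiusAdd (n := n) θ p (gexp G X • p) (gexp G Y • p) = gexp G X • gexp G Y • p := by
  have h1 := geodesicEndpoint_eq
    (isGeodesic_orbitCurve h hiso hθK hstab hsurj hY (gexp G X)) (x := gexp G X • p)
    (by rw [zero_smul, gexp_zero, mul_one]) rfl
  rw [dAt_orbitCurve] at h1
  simp only [zero_smul, gexp_zero, mul_one, one_smul] at h1
  rw [mobiusAdd, polarVector_gexp_smul h hθK hstab hX, polarVector_gexp_smul h hθK hstab hY,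
    ← mul_smul]
  exact h1

variable [ConnectedSpace G] {𝕜 : Type*} [RCLike 𝕜] {φ ψ : G → 𝕜}

/-- The integrand of the convolution on `M` comes from the one of the convolution on `G`. -/
theorem mobiusConvIntegrand_eq_descend
    (hsurj : Function.Surjective (orbitDeriv G (n := n) p : V → W))
    (hφ : IsBiInvariant K φ) (hψ : IsBiInvariant K ψ) (g : G) :
    mobiusConvIntegrand (n := n) θ p φ ψ (g • p) = descend p fun a ↦ φ (a⁻¹ * g) * ψ a := by
  have hφr : ∀ a, ∀ k ∈ K, φ (a * k) = φ a := fun a k hk ↦ by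
    simpa using hφ 1 (one_mem K) k hk a
  have hφl : ∀ a, ∀ k ∈ K, φ (k * a) = φ a := fun a k hk ↦ by
    simpa using hφ k hk 1 (one_mem K) a
  have hψr : ∀ a, ∀ k ∈ K, ψ (a * k) = ψ a := fun a k hk ↦ by
    simpa using hψ 1 (one_mem K) k hk a
  funext x
  obtain ⟨X, hX, rfl⟩ := exists_polar h hθK hstab hsurj x
  obtain ⟨Y, hY, hYg⟩ := exists_polar h hθK hstab hsurj (g • p)
  have hX' : onModel θ (-X) = -(-X) := by rw [map_neg, hX]
  -- Both sides become `φ(exp(-X) g) ψ(exp X)`. The polar vector of `g • p` only serves to evaluate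
  -- the Möbius sum and is then eliminated through `hYg`.
  rw [descend_smul hstab (fun a k hk ↦ by
    rw [hψr a k hk, mul_inv_rev, mul_assoc, hφl _ _ (inv_mem hk)]), mobiusConvIntegrand,
    mobiusNeg_gexp_smul h hθK hstab hX, ← hYg, mobiusAdd_gexp_smul h hθK hstab hiso hsurj hX' hY,
    hYg, ← mul_smul, descend_smul hstab hφr, descend_smul hstab hψr, gexp_neg]

end MobiusSum

end SymmetricSpace

/-! ### The convolution identity -/

theorem theorem3p2
    {m : ℕ} {G : Type*} [TopologicalSpace G] [ChartedSpace (EuclideanSpace ℝ (Fin m)) G] [Group G]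
    [LieGroup (𝓡 m) ∞ G]
    [T2Space G] [SecondCountableTopology G] [ConnectedSpace G]
    [MeasurableSpace G] [BorelSpace G]
    [LieAlgebra.IsSemisimple ℝ (GroupLieAlgebra (𝓡 m) G)]
    (hcenter : Finite (Subgroup.center G))
    (K : Subgroup G) (hK : SymmetricSpace.IsMaximalCompact K)
    (θ : GroupLieAlgebra (𝓡 m) G →ₗ⁅ℝ⁆ GroupLieAlgebra (𝓡 m) G)
    (hθ : SymmetricSpace.IsCartanInvolution θ)
    (hθK : ∀ X : GroupLieAlgebra (𝓡 m) G,
      θ X = X ↔ ∀ t : ℝ, SymmetricSpace.lieExp (t • X) ∈ K)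
    {n : ℕ} {M : Type*} [TopologicalSpace M] [ChartedSpace (EuclideanSpace ℝ (Fin n)) M]
    [IsManifold (𝓡 n) ∞ M] [T2Space M] [SecondCountableTopology M] [ConnectedSpace M]
    [MeasurableSpace M] [BorelSpace M]
    [RiemannianBundle (fun x : M ↦ TangentSpace (𝓡 n) x)]
    [IsContMDiffRiemannianBundle (𝓡 n) ∞ (EuclideanSpace ℝ (Fin n))
      (fun x : M ↦ TangentSpace (𝓡 n) x)]
    [MulAction G M] [ContMDiffSMul (𝓡 m) (𝓡 n) ∞ G M] [MulAction.IsPretransitive G M]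
    (hisom : ∀ (g : G) (x : M) (u v : TangentSpace (𝓡 n) x),
      inner ℝ (mfderiv (𝓡 n) (𝓡 n) (fun z : M ↦ g • z) x u)
        (mfderiv (𝓡 n) (𝓡 n) (fun z : M ↦ g • z) x v) = inner ℝ u v)
    (p : M) (hstab : MulAction.stabilizer G p = K)
    (hsubm : Function.Surjective (mfderiv (𝓡 m) (𝓡 n) (fun g : G ↦ g • p) 1))
    {𝕜 : Type*} [RCLike 𝕜] (dk : Measure K) [dk.IsHaarMeasure] [IsProbabilityMeasure dk] :
    (∃! dg : Measure G, dg.IsHaarMeasure ∧ SymmetricSpace.QuotientIntegralFormula K p dg dk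
      (SymmetricSpace.riemannianVolume n M)) ∧
    ∀ dg : Measure G, dg.IsHaarMeasure →
      SymmetricSpace.QuotientIntegralFormula K p dg dk (SymmetricSpace.riemannianVolume n M) →
      ∀ φ ψ : G → 𝕜,
        Continuous φ → HasCompactSupport φ → SymmetricSpace.IsBiInvariant K φ →
        Continuous ψ → HasCompactSupport ψ → SymmetricSpace.IsBiInvariant K ψ →
        ∀ (y : M) (g_y : G), y = g_y • p →
          Integrable (SymmetricSpace.mobiusConvIntegrand (n := n) θ p φ ψ y)
            (SymmetricSpace.riemannianVolume n M) ∧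
          Integrable (fun g ↦ φ (g⁻¹ * g_y) * ψ g) dg ∧
          SymmetricSpace.mobiusConv (n := n) θ p φ ψ y =
            ((dk.real Set.univ : ℝ) : 𝕜) * SymmetricSpace.groupConv dg φ ψ g_y := by
  have hne : Nonempty M := ⟨p⟩
  have : IsTopologicalGroup G := topologicalGroup_of_lieGroup (𝓡 m) ∞
  have : ContinuousSMul G M := ContMDiffSMul.continuousSMul (I := 𝓡 m) (I' := 𝓡 n) ∞
  have : LocallyCompactSpace G := ChartedSpace.locallyCompactSpace (EuclideanSpace ℝ (Fin m)) G
  have : LocallyCompactSpace M := ChartedSpace.locallyCompactSpace (EuclideanSpace ℝ (Fin n)) M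
  have : CompactSpace K := isCompact_iff_compactSpace.1 hK.prop
  have hiso : SymmetricSpace.IsometricAction (n := n) G M := hisom
  have : SMulInvariantMeasure G M (SymmetricSpace.riemannianVolume n M) :=
    ⟨fun g s hs ↦ SymmetricSpace.riemannianVolume_isometry
      (SymmetricSpace.smooth_smul m n g⁻¹) (hiso g⁻¹) (fun x ↦ smul_inv_smul g x)
      (fun x ↦ inv_smul_smul g x) (measurable_const_smul g⁻¹) (measurable_const_smul g) hs⟩
  refine ⟨SymmetricSpace.existsUnique_isHaarMeasure_quotient hstab, ?_⟩
  intro dg hdg hquot φ ψ hφ hφc hφK hψ hψc hψK y g hy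
  subst hy
  have hcont : Continuous fun a ↦ φ (a⁻¹ * g) * ψ a := by fun_prop
  -- Left invariance of `φ` absorbs `k⁻¹`, right invariance of `ψ` absorbs `k`.
  have hright : ∀ a, ∀ k ∈ K, φ ((a * k)⁻¹ * g) * ψ (a * k) = φ (a⁻¹ * g) * ψ a := by
    intro a k hk
    have h1 := hφK k⁻¹ (inv_mem hk) 1 (one_mem K) (a⁻¹ * g)
    have h2 := hψK 1 (one_mem K) k hk a
    rw [mul_one] at h1
    rw [one_mul] at h2
    rw [h2, mul_inv_rev, mul_assoc, h1]
  have hint := SymmetricSpace.integral_eq_integral_descend hstab hquot hcont hψc.mul_left hright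
  have heq := SymmetricSpace.mobiusConvIntegrand_eq_descend hθ hθK hstab hiso hsubm hφK hψK g
  refine ⟨by rw [heq]; exact hint.1, hint.2.1, ?_⟩
  rw [SymmetricSpace.mobiusConv, heq, hint.2.2, probReal_univ, RCLike.ofReal_one, one_mul]
  rfl
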